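/- **Setting.** For $0<\alpha\le 1$ consider the spatially homogeneous inelastic Boltzmann equation for hard spheres with constant normal restitution coefficient $\alpha$, $$\partial_t f=Q(f,f)=Q^+(f,f)-f\,Lf,\qquad f(0,\cdot)=f_0,\qquad f=f(t,v)\ge 0,\ t\ge 0,\ v\in\mathbb R^3,$$ $$Q^+(f,f)(v)=\frac1{\alpha^2}\int_{\mathbb R^3}\int_{\mathbb S^2_+}|(v-v_*)\cdot n|\,f({}'v_*)\,f({}'v)\,dn\,dv_*,\qquad Lf(v)=\int_{\mathbb R^3}\int_{\mathbb S^2_+}|(v-v_*)\cdot n|\,f(v_*)\,dn\,dv_*,$$ where $\mathbb S^2_+=\{n\in\mathbb S^2:(v_*-v)\cdot n\ge 0\}$, ${}'v=v-\gamma((v-v_*)\cdot n)n$, ${}'v_*=v_*+\gamma((v-v_*)\cdot n)n$ and $\gamma=\frac12(1+\frac1\alpha)$. Write $\|g\|_{p,s}=\|g(v)(1+|v|^2)^{s/2}\|_{L^p(\mathbb R^3)}$ and $L^p_s=\{g \text{ measurable}:\|g\|_{p,s}<\infty\}$. A solution is a nonnegative measurable $f\in C([0,\infty);L^1_2)\cap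 L^1_{loc}((0,\infty);L^1_3)$ such that, for every $t\ge0$, $f(t,v)=f_0(v)+\int_0^tQ(f,f)(\tau,v)\,d\tau$ for almost every $v$. **Theorem 1.1.** There is a universal constant $C_2>0$, and for every $s>2$ there are positive constants $C_1(\|f_0\|_{\infty,s})$ and $C_3(\|f_0\|_{\infty,s})$, depending only on $s$ and on $\|f_0\|_{\infty,s}$ (not on $\alpha$), such that the following holds. Let $0<\alpha\le1$, let $f_0\ge0$ satisfy $$\int_{\mathbb R^3} f_0\,dv=1,\qquad \int_{\mathbb R^3} f_0\,v\,dv=0,\qquad \int_{\mathbb R^3} f_0|v|^2\,dv=1,\qquad f_0\in L^\infty_s,$$ and let $f$ be a solution with initial datum $f_0$. Then: (i) for every $t>0$ and almost every $v\in\mathbb R^3$, $$f(t,v)\le C_1(\|f_0\|_{\infty,s})\min\left\{\frac{(1+t)^3}{1+|v|},\ \frac{e^{C_2\left(\frac1{\alpha^2}-1\right)t}}{(1+|v|)^2}\right\};$$ (ii) for every $t>0$ and almost every $v\ne0$, $$f(t,v)\le C_3(\|f_0\|_{\infty,s})\min\left\{\frac{1+t}{|v|^2},\ \frac{e^{C_2\left(\frac1{\alpha^2}-1\right)t}}{(1+|v|)^2}\right\}.$$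 -/

import Mathlib

open MeasureTheory Filter Topology Set
open scoped ENNReal

noncomputable section

namespace InelasticBoltzmann

/-- Velocity space `ℝ³` with its Euclidean norm. -/
abbrev Vel : Type := EuclideanSpace ℝ (Fin 3)

/-- The unit sphere `𝕊²`. -/
abbrev UnitSphere : Type := Metric.sphere (0 : Vel) 1

/-- The surface measure on `𝕊²`, of total mass `4π`. -/
def surface : Measure UnitSphere := (volume : Measure Vel).toSphere

/-- The weighted norm `‖f‖_{p,s}`, that is the `L^p(ℝ³)` norm of `f(v) (1 + |v|²)^{s/2}`. -/
def weightedNorm (p : ℝ≥0∞) (s : ℝ) (f : Vel → ℝ) : ℝ≥0∞ :=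
  eLpNorm (fun v : Vel => f v * (1 + ‖v‖ ^ 2) ^ (s / 2)) p volume

/-- Membership in the weighted space `L^p_s(ℝ³)`. -/
def MemWeightedLp (p : ℝ≥0∞) (s : ℝ) (f : Vel → ℝ) : Prop :=
  MemLp (fun v : Vel => f v * (1 + ‖v‖ ^ 2) ^ (s / 2)) p volume

/-- The half sphere `𝕊²₊` of impact directions `n` with `(v_* - v) · n ≥ 0`. -/
def hemisphere (v vs : Vel) : Set UnitSphere :=
  {n | 0 ≤ inner ℝ (vs - v) (n : Vel)}

/-- The pre-collisional velocity `'v = v - γ ((v - v_*) · n) n` with `γ = (1 + 1/α)/2`.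
A collision with restitution coefficient `α` and impact direction `n` turns the pair
`('v, 'v_*)` into `(v, v_*)`: it keeps the momentum and the tangential relative velocity,
and `(v - v_*) · n = -α ('v - 'v_*) · n`. -/
def pre (α : ℝ) (v vs n : Vel) : Vel :=
  v - ((1 + 1 / α) / 2 * inner ℝ (v - vs) n) • n

/-- The pre-collisional velocity `'v_* = v_* + γ ((v - v_*) · n) n` of the partner. -/
def preStar (α : ℝ) (v vs n : Vel) : Vel :=
  vs + ((1 + 1 / α) / 2 * inner ℝ (v - vs) n) • n

/-- The gain term for hard spheres,
`Q⁺(f,f)(v) = α⁻² ∫_{ℝ³} ∫_{𝕊²₊} |(v - v_*) · n| f('v_*) f('v) dn dv_*`. -/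
def gain (α : ℝ) (f : Vel → ℝ) (v : Vel) : ℝ :=
  1 / α ^ 2 * ∫ vs : Vel, ∫ n in hemisphere v vs,
    |inner ℝ (v - vs) (n : Vel)| * f (preStar α v vs n) * f (pre α v vs n) ∂surface

/-- The loss frequency `Lf(v) = ∫_{ℝ³} ∫_{𝕊²₊} |(v - v_*) · n| f(v_*) dn dv_*`. -/
def lossRate (f : Vel → ℝ) (v : Vel) : ℝ :=
  ∫ vs : Vel, ∫ n in hemisphere v vs, |inner ℝ (v - vs) (n : Vel)| * f vs ∂surface

/-- The inelastic hard-sphere collision operator `Q(f,f) = Q⁺(f,f) - f Lf`. -/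
def collision (α : ℝ) (f : Vel → ℝ) (v : Vel) : ℝ :=
  gain α f v - f v * lossRate f v

/-- A nonnegative density with unit mass, zero momentum and unit energy. The values `1`
force integrability of the density and of the energy density, hence of the momentum. -/
structure IsNormalized (f₀ : Vel → ℝ) : Prop where
  nonneg : ∀ᵐ v, 0 ≤ f₀ v
  mass : ∫ v, f₀ v = 1
  momentum : ∀ i : Fin 3, ∫ v, f₀ v * v i = 0
  energy : ∫ v, f₀ v * ‖v‖ ^ 2 = 1

/-- `f = f(t,v)` is a (mild) solution for times `t ≥ 0` of `∂ₜ f = Q(f,f)`, `f(0,·) = f₀`: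
a nonnegative function in `C([0,∞); L^1_2) ∩ L^1_loc((0,∞); L^1_3)` which satisfies
`f(t,v) = f₀(v) + ∫₀ᵗ Q(f,f)(τ,v) dτ`. In this class `Q⁺(f,f)` and `f Lf` belong to
`L^1((0,t) × ℝ³)` for all `t`, so all the integrals converge for almost every `v`. -/
structure IsSolution (α : ℝ) (f₀ : Vel → ℝ) (f : ℝ → Vel → ℝ) : Prop where
  measurable : Measurable (Function.uncurry f)
  nonneg : ∀ t, 0 ≤ t → ∀ᵐ v, 0 ≤ f t v
  memL12 : ∀ t, 0 ≤ t → MemWeightedLp 1 2 (f t)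
  continuousL12 : ∀ t, 0 ≤ t →
    Tendsto (fun τ => weightedNorm 1 2 (f τ - f t)) (𝓝[Ici 0] t) (𝓝 0)
  locIntegrableL13 : ∀ a b, 0 < a → a ≤ b → ∫⁻ t in Icc a b, weightedNorm 1 3 (f t) < ∞
  equation : ∀ t, 0 ≤ t → ∀ᵐ v, f t v = f₀ v + ∫ τ in (0 : ℝ)..t, collision α (f τ) v

end InelasticBoltzmann

end

/-!
# Pointwise bounds for the inelastic hard-sphere Boltzmann equation

Along almost every velocity `v` a solution satisfies `y' = G - D y` with the gain `G = Q⁺(f,f)` and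
the loss frequency `D = Lf` (`IsSolution.isTrajectory`), so Duhamel's formula applies. If the loss
frequency is at least `r ≥ 0`, the gain accumulates during a time `T` only, with `T = t` or, if
`r > 0`, `T = 1/r` (`memory`, `AccumulationBound`). Gain and loss are treated as integrals with
values in `[0,∞]`, which need no integrability.

The gain term is bounded pointwise by `4 P U(v)`, where `P` bounds the integrals of `f` over
planes and `U` is the Newtonian potential of `f` (`gainL_le_of_marginalLE`): for a fixed impact
direction `n`, the velocity `'v` lies on the line through `v` in the direction `n`, and for a
given `'v` the velocity `'v_*` ranges over a plane orthogonal to `n`. Both `P` and `U` are moments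
of `f` whose test functions have bounded averages over post-collisional velocities. Indeed, with
the weight `((v - v_*) · n)₊`, these velocities are distributed on a sphere of radius proportional
to `|v - v_*|` with at most a uniform density (`lintegral_post_le`), so the averages of `φ(v' ·
e)` and of `1/|v' - w|` are bounded by multiples of `∫ φ` and of `1`, whatever the colliding
velocities are. Hence plane integrals and potential grow at most linearly in `T`
(`IsSolution.marginalLE`, `IsSolution.potential_le`).

Decay in `v` comes from the loss term. Since the momentum vanishes and the energy does not
increase, the loss frequency at `v` is at least `π |v|` (`IsSolution.le_lossL`). The gain at `v`
therefore accumulates during a time of order `1/|v|`, and the part of the potential that comes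
from the vicinity of `v` is of order `1/|v|`, uniformly in time (`IsSolution.potential_le_div`).
In total the density is bounded by constants times `(1 + T)³` and `(1 + T)/|v|²`
(`exists_pointwise_bound`).

With `T = t` these are the algebraic bounds of the theorem. The exponential bounds need a lower
bound of the loss frequency near `v = 0`, which fails only if the mass concentrates. Concentration
is controlled by the entropy relative to a Gaussian `δ e^{-|v|²}`, whose product over the two
particles does not decrease in a collision. As a collision changes the volume in the space of
velocity pairs by the factor `α`, this entropy grows at a rate proportional to `1/α² - 1`, up to a
contribution of the Gaussian that is small with `δ` (`entropy_production_le`,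
`IsSolution.lintegral_entropy_le`). So a ball has to have radius at least
`c e^{-(4π/3)(1/α² - 1)t}` to carry more than half of the mass, which bounds the loss frequency
from below (`exists_le_lossL`). The pointwise bound with the inverse of this frequency as `T`
finishes the proof; the third power of `T` yields the constant `C₂ = 4π`.
-/

namespace InelasticBoltzmann

/-! ### Integration over the sphere -/

instance : IsFiniteMeasure surface := by unfold surface; infer_instance

theorem norm_coe_unitSphere (n : UnitSphere) : ‖(n : Vel)‖ = 1 := by
  simp

theorem lintegral_Ioi_pow_indicator (k : ℕ) :
    ∫⁻ r in Ioi (0 : ℝ), ENNReal.ofReal (r ^ k) * (Iio (1 : ℝ)).indicator 1 r =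
      ENNReal.ofReal (1 / (k + 1)) := by
  have : ∫⁻ r in Ioi (0 : ℝ), ENNReal.ofReal (r ^ k) * (Iio (1 : ℝ)).indicator 1 r =
      ∫⁻ r in Ioc (0 : ℝ) 1, ENNReal.ofReal (r ^ k) := by
    rw [restrict_Ioo_eq_restrict_Ioc.symm, ← Ioi_inter_Iio, inter_comm,
      ← Measure.restrict_restrict measurableSet_Iio, ← lintegral_indicator measurableSet_Iio]
    refine lintegral_congr fun r => ?_
    by_cases hr : r < 1 <;> simp [indicator, hr]
  rw [this, ← ofReal_integral_eq_lintegral_ofReal, ← intervalIntegral.integral_of_le zero_le_one]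
  · norm_num
  · exact (intervalIntegral.intervalIntegrable_pow k).1
  · filter_upwards [ae_restrict_mem measurableSet_Ioc] with r hr
    exact pow_nonneg hr.1.le k

/-- Integration in polar coordinates. -/
theorem lintegral_polar {F : Vel → ℝ≥0∞} (hF : Measurable F) :
    ∫⁻ x, F x = ∫⁻ n : UnitSphere, (∫⁻ r in Ioi (0 : ℝ),
      ENNReal.ofReal (r ^ 2) * F (r • (n : Vel))) ∂surface := by
  have h := (volume : Measure Vel).measurePreserving_homeomorphUnitSphereProd
  have hdim : Module.finrank ℝ Vel - 1 = 2 := by simp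
  rw [hdim] at h
  let e := (homeomorphUnitSphereProd Vel)
  have hG : Measurable fun p : UnitSphere × Ioi (0 : ℝ) => F (p.2.1 • (p.1 : Vel)) := by fun_prop
  have h1 : ∫⁻ x, F x = ∫⁻ x : ({(0)}ᶜ : Set Vel), F x ∂(Measure.comap Subtype.val volume) := by
    rw [lintegral_subtype_comap (measurableSet_singleton _).compl (fun x => F x),
      restrict_compl_singleton]
  have h2 : ∫⁻ x : ({(0)}ᶜ : Set Vel), F x ∂(Measure.comap Subtype.val volume) =
      ∫⁻ p, F (p.2.1 • (p.1 : Vel)) ∂(surface.prod (Measure.volumeIoiPow 2)) := by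
    rw [surface, ← h.lintegral_comp hG]
    refine lintegral_congr fun x => ?_
    congr 1
    have hx : ‖(x : Vel)‖ ≠ 0 := norm_ne_zero_iff.2 x.2
    simp [smul_smul, hx]
  rw [h1, h2, lintegral_prod _ hG.aemeasurable]
  refine lintegral_congr fun n => ?_
  unfold Measure.volumeIoiPow
  rw [lintegral_withDensity_eq_lintegral_mul _ (by fun_prop) (by fun_prop)]
  exact lintegral_subtype_comap measurableSet_Ioi
    (fun r : ℝ => ENNReal.ofReal (r ^ 2) * F (r • (n : Vel)))

/-- Orthonormal coordinates adapted to a unit vector `n`. -/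
theorem exists_lintegral_slice {n : Vel} (hn : ‖n‖ = 1) :
    ∃ b c : Vel, inner ℝ b n = 0 ∧ inner ℝ c n = 0 ∧
      (∀ a y z : ℝ, ‖a • n + y • b + z • c‖ ^ 2 = a ^ 2 + y ^ 2 + z ^ 2) ∧
      (∀ x : Vel, ∃ y z : ℝ, x = inner ℝ x n • n + y • b + z • c) ∧
      ∀ F : Vel → ℝ≥0∞, Measurable F →
        ∫⁻ x, F x = ∫⁻ a : ℝ, ∫⁻ y : ℝ, ∫⁻ z : ℝ, F (a • n + y • b + z • c) := by
  obtain ⟨e, he⟩ := Orthonormal.exists_orthonormalBasis_extension_of_card_eq (𝕜 := ℝ) (E := Vel)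
    (ι := Fin 3) (by simp) (v := fun _ => n) (s := {0}) (by
      refine ⟨fun i => by simpa using hn, fun i j hij => (hij (Subsingleton.elim _ _)).elim⟩)
  have he0 : e 0 = n := he 0 rfl
  have ho := fun i j => orthonormal_iff_ite.1 e.orthonormal i j
  refine ⟨e 1, e 2, ?_, ?_, ?_, ?_, ?_⟩
  · rw [← he0]; simp
  · rw [← he0]; simp
  · intro a y z
    rw [← he0, ← real_inner_self_eq_norm_sq]
    simp only [inner_add_left, inner_add_right, inner_smul_left, inner_smul_right, ho]
    simp
    ring
  · intro x
    refine ⟨inner ℝ (e 1) x, inner ℝ (e 2) x, ?_⟩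
    conv_lhs => rw [← e.sum_repr' x, Fin.sum_univ_three]
    rw [← he0, real_inner_comm]
  · intro F hF
    have m1 := (e.measurePreserving_repr_symm).lintegral_comp hF
    have m2 := (PiLp.volume_preserving_toLp (Fin 3)).lintegral_comp
      (f := fun x => F (e.repr.symm x)) (by fun_prop)
    have m3 := ((volume_preserving_piFinSuccAbove (fun _ : Fin 3 => ℝ) 0).symm).lintegral_comp
      (f := fun x => F (e.repr.symm (WithLp.toLp 2 x))) (by fun_prop)
    have m4 := ((volume_preserving_finTwoArrow ℝ).symm)
    rw [← m1, ← m2, ← m3, Measure.volume_eq_prod, lintegral_prod _ (by fun_prop)]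
    refine lintegral_congr fun a => ?_
    rw [← m4.lintegral_comp (by fun_prop), Measure.volume_eq_prod, lintegral_prod _ (by fun_prop)]
    refine lintegral_congr fun y => lintegral_congr fun z => ?_
    congr 1
    rw [← he0]
    have : ∀ w : EuclideanSpace ℝ (Fin 3), e.repr.symm w = w 0 • e 0 + w 1 • e 1 + w 2 • e 2 := by
      intro w
      rw [← e.sum_repr_symm w, Fin.sum_univ_three]
    rw [this]
    rfl

/-- The law of a component of a uniform random point on the sphere. -/
theorem lintegral_surface_inner {e : Vel} (he : ‖e‖ = 1) {φ : ℝ → ℝ≥0∞} (hφ : Measurable φ) :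
    ∫⁻ n : UnitSphere, φ (inner ℝ (n : Vel) e) ∂surface =
      ENNReal.ofReal (2 * Real.pi) *
        ∫⁻ θ in Ioo 0 Real.pi, ENNReal.ofReal (Real.sin θ) * φ (Real.cos θ) := by
  obtain ⟨b, c, hb, hc, hnorm, -, hslice⟩ := exists_lintegral_slice he
  -- both sides, multiplied by `∫₀¹ r² dr`, are integrals over the unit ball
  set h : ℝ → ℝ≥0∞ := (Iio (1 : ℝ)).indicator 1 with hh
  have hm : Measurable h := measurable_one.indicator measurableSet_Iio
  set I : ℝ≥0∞ := ∫⁻ r in Ioi (0 : ℝ), ENNReal.ofReal (r ^ 2) * h r with hI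
  have hIval : I = ENNReal.ofReal (1 / 3) := by
    have := lintegral_Ioi_pow_indicator 2
    norm_num at this ⊢
    exact this
  have key1 : ∫⁻ x : Vel, φ (‖x‖⁻¹ * inner ℝ x e) * h ‖x‖ =
      (∫⁻ n : UnitSphere, φ (inner ℝ (n : Vel) e) ∂surface) * I := by
    rw [lintegral_polar (by fun_prop), ← lintegral_mul_const'' _ (by fun_prop)]
    refine lintegral_congr fun n => ?_
    rw [hI, ← lintegral_const_mul _ (by fun_prop)]
    refine setLIntegral_congr_fun measurableSet_Ioi fun r hr => ?_
    have hr' : (0 : ℝ) < r := hr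
    simp only [norm_smul, norm_coe_unitSphere, inner_smul_left, Real.norm_eq_abs, abs_of_pos hr']
    have : (r * 1)⁻¹ * ((starRingEnd ℝ) r * inner ℝ (n : Vel) e) = inner ℝ (n : Vel) e := by
      simp; field_simp
    rw [this, mul_one]
    ring
  have key2 : ∫⁻ x : Vel, φ (‖x‖⁻¹ * inner ℝ x e) * h ‖x‖ =
      (ENNReal.ofReal (2 * Real.pi) *
        ∫⁻ θ in Ioo 0 Real.pi, ENNReal.ofReal (Real.sin θ) * φ (Real.cos θ)) * I := by
    rw [hslice _ (by fun_prop)]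
    set H : ℝ → ℝ → ℝ≥0∞ := fun a ρ => φ ((√(a ^ 2 + ρ ^ 2))⁻¹ * a) * h (√(a ^ 2 + ρ ^ 2)) with hH
    have hHm : Measurable (Function.uncurry H) := by
      simp only [hH, Function.uncurry_def]; fun_prop
    have s1 : ∀ a y z : ℝ, φ (‖a • e + y • b + z • c‖⁻¹ * inner ℝ (a • e + y • b + z • c) e) *
        h ‖a • e + y • b + z • c‖ = H a (√(y ^ 2 + z ^ 2)) := by
      intro a y z
      have : ‖a • e + y • b + z • c‖ = √(a ^ 2 + √(y ^ 2 + z ^ 2) ^ 2) := by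
        rw [Real.sq_sqrt (by positivity), ← add_assoc, ← hnorm a y z, Real.sqrt_sq (norm_nonneg _)]
      rw [hH]
      simp only [this, inner_add_left, inner_smul_left, hb, hc, real_inner_self_eq_norm_sq, he]
      simp
    simp only [s1]
    have s2 : ∀ a : ℝ, ∫⁻ y : ℝ, ∫⁻ z : ℝ, H a (√(y ^ 2 + z ^ 2)) =
        ENNReal.ofReal (2 * Real.pi) * ∫⁻ ρ in Ioi (0 : ℝ), ENNReal.ofReal ρ * H a ρ := by
      intro a
      have hHa : Measurable (H a) := hHm.of_uncurry_left
      rw [← lintegral_prod (fun p : ℝ × ℝ => H a (√(p.1 ^ 2 + p.2 ^ 2))) (by fun_prop),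
        ← Measure.volume_eq_prod, ← lintegral_comp_polarCoord_symm, polarCoord_target,
        Measure.volume_eq_prod, ← Measure.prod_restrict, lintegral_prod _ (by fun_prop),
        ← lintegral_const_mul _ (by fun_prop)]
      refine setLIntegral_congr_fun measurableSet_Ioi fun ρ hρ => ?_
      have hρ' : (0 : ℝ) < ρ := hρ
      have : ∀ θ : ℝ, √((polarCoord.symm (ρ, θ)).1 ^ 2 + (polarCoord.symm (ρ, θ)).2 ^ 2) = ρ := by
        intro θ
        simp only [polarCoord_symm_apply]
        rw [show (ρ * Real.cos θ) ^ 2 + (ρ * Real.sin θ) ^ 2 = ρ ^ 2 by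
          linear_combination ρ ^ 2 * Real.sin_sq_add_cos_sq θ, Real.sqrt_sq hρ'.le]
      simp only [this, smul_eq_mul, lintegral_const, Measure.restrict_apply_univ, Real.volume_Ioo]
      rw [mul_comm]
      congr 2
      ring
    simp only [s2]
    rw [lintegral_const_mul _ (by fun_prop), mul_assoc]
    congr 1
    -- polar coordinates in the half plane `ρ > 0`
    have s3 : ∫⁻ a : ℝ, ∫⁻ ρ in Ioi (0 : ℝ), ENNReal.ofReal ρ * H a ρ =
        ∫⁻ p : ℝ × ℝ, ENNReal.ofReal p.2 * H p.1 p.2 := by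
      rw [Measure.volume_eq_prod, lintegral_prod _ (by fun_prop)]
      refine lintegral_congr fun a => ?_
      rw [← lintegral_indicator measurableSet_Ioi]
      refine lintegral_congr fun ρ => ?_
      by_cases hρ : 0 < ρ
      · simp [indicator, hρ]
      · simp [indicator, hρ, ENNReal.ofReal_of_nonpos (not_lt.1 hρ)]
    rw [s3, ← lintegral_comp_polarCoord_symm, polarCoord_target,
        Measure.volume_eq_prod, ← Measure.prod_restrict, lintegral_prod_symm _ (by fun_prop)]
    have s4 : ∀ θ : ℝ, ∫⁻ r in Ioi (0 : ℝ), ENNReal.ofReal r • (ENNReal.ofReal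
        (polarCoord.symm (r, θ)).2 * H (polarCoord.symm (r, θ)).1 (polarCoord.symm (r, θ)).2) =
        ENNReal.ofReal (Real.sin θ) * φ (Real.cos θ) * I := by
      intro θ
      rw [hI, ← lintegral_const_mul _ (by fun_prop)]
      refine setLIntegral_congr_fun measurableSet_Ioi fun r hr => ?_
      have hr' : (0 : ℝ) < r := hr
      simp only [polarCoord_symm_apply, hH, smul_eq_mul]
      rw [show (r * Real.cos θ) ^ 2 + (r * Real.sin θ) ^ 2 = r ^ 2 by
        linear_combination r ^ 2 * Real.sin_sq_add_cos_sq θ, Real.sqrt_sq hr'.le,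
        inv_mul_cancel_left₀ hr'.ne', ENNReal.ofReal_mul hr'.le, ENNReal.ofReal_pow hr'.le]
      ring
    simp only [s4]
    rw [lintegral_mul_const _ (by fun_prop)]
    congr 1
    rw [show Ioo 0 Real.pi = Ioi 0 ∩ Ioo (-Real.pi) Real.pi by
      ext x; constructor
      · exact fun hx => ⟨hx.1, by linarith [Real.pi_pos, hx.1], hx.2⟩
      · exact fun hx => ⟨hx.1, hx.2.2⟩, ← Measure.restrict_restrict measurableSet_Ioi,
      ← lintegral_indicator measurableSet_Ioi]
    refine setLIntegral_congr_fun measurableSet_Ioo fun θ hθ => ?_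
    by_cases h0 : 0 < θ
    · simp [indicator, h0]
    · have : Real.sin θ ≤ 0 := Real.sin_nonpos_of_nonpos_of_neg_pi_le (not_lt.1 h0) hθ.1.le
      simp [indicator, h0, ENNReal.ofReal_of_nonpos this]
  have hI0 : I ≠ 0 := by rw [hIval]; simp
  have hIt : I ≠ ∞ := by rw [hIval]; simp
  exact (ENNReal.mul_left_inj hI0 hIt).1 (key1.symm.trans key2)


/-! ### From impact directions to scattering directions -/

/-- The quadratic map `x ↦ 2 (x · u) x - |x|² u`, for a unit vector `u`. It squares lengths, and on
directions it is `n ↦ 2 (n · u) n - u`, which carries the impact direction to the direction of the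
relative velocity after an elastic collision. -/
noncomputable def sqMap (u x : Vel) : Vel := (2 * inner ℝ u x) • x - (‖x‖ ^ 2) • u

/-- The derivative of `sqMap u`. -/
noncomputable def sqMapDeriv (u x : Vel) : Vel →L[ℝ] Vel :=
  (2 * inner ℝ u x) • ContinuousLinearMap.id ℝ Vel + (innerSL ℝ u).smulRight ((2 : ℝ) • x) -
    (innerSL ℝ x).smulRight ((2 : ℝ) • u)

theorem hasFDerivAt_sqMap (u x : Vel) : HasFDerivAt (sqMap u) (sqMapDeriv u x) x := by
  have h1 : HasFDerivAt (fun x : Vel => 2 * inner ℝ u x) ((2 : ℝ) • innerSL ℝ u) x :=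
    ((innerSL ℝ u).hasFDerivAt).const_mul 2
  have h2 := h1.smul (hasFDerivAt_id x)
  have h3 := ((hasStrictFDerivAt_norm_sq x).hasFDerivAt).smul (hasFDerivAt_const u x)
  refine (h2.sub h3).congr_fderiv ?_
  ext1 y
  simp only [sqMapDeriv, id_eq, sub_apply, add_apply,
    smul_apply, ContinuousLinearMap.smulRight_apply, innerSL_apply_apply,
    ContinuousLinearMap.id_apply, smul_zero, zero_add, smul_eq_mul,
    nsmul_eq_mul]
  module

theorem det_sqMapDeriv {u : Vel} (hu : ‖u‖ = 1) (x : Vel) :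
    (sqMapDeriv u x).det = 8 * inner ℝ u x * ‖x‖ ^ 2 := by
  have hu' : u 0 ^ 2 + u 1 ^ 2 + u 2 ^ 2 = 1 := by
    have := EuclideanSpace.norm_sq_eq u
    rw [hu, Fin.sum_univ_three] at this
    simpa using this.symm
  rw [ContinuousLinearMap.det, ← LinearMap.det_toMatrix (EuclideanSpace.basisFun (Fin 3) ℝ).toBasis,
    Matrix.det_fin_three, EuclideanSpace.norm_sq_eq x]
  simp [LinearMap.toMatrix_apply, sqMapDeriv, Fin.sum_univ_three, PiLp.inner_apply,
    EuclideanSpace.basisFun_repr]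
  linear_combination (8 * (x 0 * u 0 + x 1 * u 1 + x 2 * u 2) * (x 0 ^ 2 + x 1 ^ 2 + x 2 ^ 2)) * hu'

theorem norm_sqMap {u : Vel} (hu : ‖u‖ = 1) (x : Vel) : ‖sqMap u x‖ = ‖x‖ ^ 2 := by
  rw [← sq_eq_sq₀ (norm_nonneg _) (by positivity), sqMap, norm_sub_sq_real]
  simp only [norm_smul, inner_smul_left, inner_smul_right, hu, Real.norm_eq_abs, mul_pow, sq_abs,
    real_inner_comm u x]
  simp
  ring

theorem injOn_sqMap {u : Vel} (hu : ‖u‖ = 1) : InjOn (sqMap u) {x | 0 < inner ℝ u x} := by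
  intro x hx y hy hxy
  have hx' : 0 < inner ℝ u x := hx
  have hy' : 0 < inner ℝ u y := hy
  have h1 : ‖x‖ ^ 2 = ‖y‖ ^ 2 := by rw [← norm_sqMap hu, ← norm_sqMap hu, hxy]
  have h2 : inner ℝ u x = inner ℝ u y := by
    have := congrArg (fun w => inner ℝ u w) hxy
    simp only [sqMap, inner_sub_right, inner_smul_right, real_inner_self_eq_norm_sq, hu, h1] at this
    rw [← sq_eq_sq₀ hx'.le hy'.le]
    linarith
  have h3 : (2 * inner ℝ u x) • x = (2 * inner ℝ u x) • y := by
    have := hxy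
    simp only [sqMap, h1, h2] at this
    rw [h2]
    exact sub_left_injective this
  exact smul_right_injective Vel (by positivity : 2 * inner ℝ u x ≠ 0) h3

/-- Passage from the impact direction `n`, with weight `(n · u)₊`, to the direction
`σ = 2 (n · u) n - u` of the outgoing relative velocity: the image measure is at most a quarter of
the surface measure. -/
theorem lintegral_surface_reflect_le {u : Vel} (hu : ‖u‖ = 1) {g : Vel → ℝ≥0∞} (hg : Measurable g) :
    4 * ∫⁻ n : UnitSphere, ENNReal.ofReal (inner ℝ u (n : Vel)) *
        g ((2 * inner ℝ u (n : Vel)) • (n : Vel) - u) ∂surface ≤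
      ∫⁻ n : UnitSphere, g n ∂surface := by
  -- change of variables by `sqMap u` in integrals over the unit ball; in polar coordinates the
  -- radial factors `∫₀¹ r² dr = 1/3` and `8 ∫₀¹ r⁵ dr = 8/6` separate from the sphere integrals
  set h : ℝ → ℝ≥0∞ := (Iio (1 : ℝ)).indicator 1 with hh
  have hm : Measurable h := measurable_one.indicator measurableSet_Iio
  set F : Vel → ℝ≥0∞ := fun y => g (‖y‖⁻¹ • y) * h ‖y‖ with hF
  have hFm : Measurable F := by simp only [hF]; fun_prop
  set A : Set Vel := {x | 0 < inner ℝ u x} with hA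
  have hAm : MeasurableSet A := measurableSet_lt measurable_const (by fun_prop)
  have key1 : ∫⁻ y, F y = (∫⁻ n : UnitSphere, g n ∂surface) * ENNReal.ofReal (1 / 3) := by
    rw [lintegral_polar hFm, ← lintegral_mul_const'' _ (by fun_prop)]
    refine lintegral_congr fun n => ?_
    have h2 : ENNReal.ofReal (1 / 3) = ∫⁻ r in Ioi (0 : ℝ), ENNReal.ofReal (r ^ 2) * h r := by
      rw [lintegral_Ioi_pow_indicator]; norm_num
    rw [h2, ← lintegral_const_mul _ (by fun_prop)]
    refine setLIntegral_congr_fun measurableSet_Ioi fun r hr => ?_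
    have hr' : (0 : ℝ) < r := hr
    simp only [hF, norm_smul, norm_coe_unitSphere, Real.norm_eq_abs, abs_of_pos hr', smul_smul,
      mul_one, inv_mul_cancel₀ hr'.ne', one_smul]
    ring
  have key2 : ∫⁻ x in A, ENNReal.ofReal |(sqMapDeriv u x).det| * F (sqMap u x) ≤ ∫⁻ y, F y := by
    rw [← lintegral_image_eq_lintegral_abs_det_fderiv_mul volume hAm
      (fun x _ => (hasFDerivAt_sqMap u x).hasFDerivWithinAt) (injOn_sqMap hu)]
    exact setLIntegral_le_lintegral _ _
  have hsm : Measurable (sqMap u) := by unfold sqMap; fun_prop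
  have key3 : ∫⁻ x in A, ENNReal.ofReal |(sqMapDeriv u x).det| * F (sqMap u x) =
      ∫⁻ x, ENNReal.ofReal (8 * inner ℝ u x * ‖x‖ ^ 2) * F (sqMap u x) := by
    rw [← lintegral_indicator hAm]
    refine lintegral_congr fun x => ?_
    by_cases hx : 0 < inner ℝ u x
    · rw [indicator_of_mem (by exact hx), det_sqMapDeriv hu, abs_of_nonneg (by positivity)]
    · rw [indicator_of_notMem (by exact hx), ENNReal.ofReal_of_nonpos, zero_mul]
      have := not_lt.1 hx
      have h2 := sq_nonneg ‖x‖
      nlinarith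
  have key4 : ∫⁻ x, ENNReal.ofReal (8 * inner ℝ u x * ‖x‖ ^ 2) * F (sqMap u x) =
      (∫⁻ n : UnitSphere, ENNReal.ofReal (inner ℝ u (n : Vel)) *
        g ((2 * inner ℝ u (n : Vel)) • (n : Vel) - u) ∂surface) * ENNReal.ofReal (8 / 6) := by
    rw [lintegral_polar (by fun_prop), ← lintegral_mul_const'' _ (by fun_prop)]
    refine lintegral_congr fun n => ?_
    have h5 : ENNReal.ofReal (1 / 6) = ∫⁻ r in Ioi (0 : ℝ), ENNReal.ofReal (r ^ 5) * h r := by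
      rw [lintegral_Ioi_pow_indicator]; norm_num
    rw [show (8 / 6 : ℝ) = 8 * (1 / 6) by norm_num, ENNReal.ofReal_mul (by norm_num), h5,
      ← lintegral_const_mul _ (by fun_prop), ← lintegral_const_mul _ (by fun_prop)]
    refine setLIntegral_congr_fun measurableSet_Ioi fun r hr => ?_
    have hr' : (0 : ℝ) < r := hr
    have e1 : sqMap u (r • (n : Vel)) = (r ^ 2) • ((2 * inner ℝ u (n : Vel)) • (n : Vel) - u) := by
      simp only [sqMap, inner_smul_right, norm_smul, norm_coe_unitSphere, Real.norm_eq_abs, mul_pow,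
        sq_abs]
      module
    have e2 : ‖(2 * inner ℝ u (n : Vel)) • (n : Vel) - u‖ = 1 := by
      have := norm_sqMap hu n
      simpa [sqMap, norm_coe_unitSphere] using this
    have e3 : h (r ^ 2) = h r := by
      simp only [hh, indicator, mem_Iio, sq_lt_one_iff₀ hr'.le, Pi.one_apply]
    simp only [e1, hF, norm_smul, e2, inner_smul_right, norm_coe_unitSphere, Real.norm_eq_abs,
      abs_of_pos hr', abs_of_pos (pow_pos hr' 2), smul_smul, mul_one,
      inv_mul_cancel₀ (pow_pos hr' 2).ne', one_smul, e3]
    rw [show 8 * (r * inner ℝ u (n : Vel)) * r ^ 2 = (8 * r ^ 3) * inner ℝ u (n : Vel) by ring,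
      ENNReal.ofReal_mul (by positivity), ENNReal.ofReal_mul (by norm_num),
      show r ^ 5 = r ^ 2 * r ^ 3 by ring, ENNReal.ofReal_mul (by positivity)]
    ring
  rw [key3, key4, key1] at key2
  rw [show (8 / 6 : ℝ) = 4 * (1 / 3) by norm_num, ENNReal.ofReal_mul (by norm_num), ← mul_assoc,
    ENNReal.mul_le_mul_iff_left (by simp) (by simp)] at key2
  simpa [mul_comm] using key2

/-- `∫ (u · n)₊ dn = π |u|`. -/
theorem lintegral_surface_inner_pos (u : Vel) :
    ∫⁻ n : UnitSphere, ENNReal.ofReal (inner ℝ u (n : Vel)) ∂surface =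
      ENNReal.ofReal (Real.pi * ‖u‖) := by
  rcases eq_or_ne u 0 with rfl | hu
  · simp
  have hu' : 0 < ‖u‖ := norm_pos_iff.2 hu
  have he : ‖‖u‖⁻¹ • u‖ = 1 := by simp [norm_smul, hu'.ne']
  have h1 : ∀ n : UnitSphere, ENNReal.ofReal (inner ℝ u (n : Vel)) =
      ENNReal.ofReal ‖u‖ * ENNReal.ofReal (inner ℝ (n : Vel) (‖u‖⁻¹ • u)) := by
    intro n
    rw [← ENNReal.ofReal_mul hu'.le, inner_smul_right, mul_inv_cancel_left₀ hu'.ne',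
      real_inner_comm]
  simp only [h1]
  rw [lintegral_const_mul _ (by fun_prop), lintegral_surface_inner he ENNReal.measurable_ofReal]
  have h2 : ∫⁻ θ in Ioo 0 Real.pi, ENNReal.ofReal (Real.sin θ) * ENNReal.ofReal (Real.cos θ) =
      ENNReal.ofReal (1 / 2) := by
    have : ∫⁻ θ in Ioo 0 Real.pi, ENNReal.ofReal (Real.sin θ) * ENNReal.ofReal (Real.cos θ) =
        ∫⁻ θ in Ioc 0 (Real.pi / 2), ENNReal.ofReal (Real.sin θ * Real.cos θ) := by
      rw [← lintegral_indicator measurableSet_Ioo, ← lintegral_indicator measurableSet_Ioc]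
      refine lintegral_congr fun θ => ?_
      by_cases h0 : 0 < θ
      · by_cases h1 : θ ≤ Real.pi / 2
        · rw [indicator_of_mem (s := Ioo 0 Real.pi) ⟨h0, by linarith [Real.pi_pos]⟩,
            indicator_of_mem (s := Ioc 0 (Real.pi / 2)) ⟨h0, h1⟩,
            ENNReal.ofReal_mul (Real.sin_nonneg_of_nonneg_of_le_pi h0.le
              (by linarith [Real.pi_pos]))]
        · rw [indicator_of_notMem (s := Ioc 0 (Real.pi / 2)) (fun h => h1 h.2)]
          by_cases h2 : θ < Real.pi
          · rw [indicator_of_mem (s := Ioo 0 Real.pi) ⟨h0, h2⟩,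
              ENNReal.ofReal_of_nonpos (p := Real.cos θ), mul_zero]
            exact Real.cos_nonpos_of_pi_div_two_le_of_le (not_le.1 h1).le (by linarith)
          · rw [indicator_of_notMem (s := Ioo 0 Real.pi) (fun h => h2 h.2)]
      · rw [indicator_of_notMem (s := Ioo 0 Real.pi) (fun h => h0 h.1),
          indicator_of_notMem (s := Ioc 0 (Real.pi / 2)) (fun h => h0 h.1)]
    rw [this, ← ofReal_integral_eq_lintegral_ofReal,
      ← intervalIntegral.integral_of_le (by positivity), integral_sin_mul_cos₁]
    · simp
    · exact ((by fun_prop : Continuous fun θ => Real.sin θ * Real.cos θ).intervalIntegrable _ _).1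
    · filter_upwards [ae_restrict_mem measurableSet_Ioc] with θ hθ
      exact mul_nonneg (Real.sin_nonneg_of_nonneg_of_le_pi hθ.1.le (by linarith [hθ.2, hθ.1]))
        (Real.cos_nonneg_of_mem_Icc ⟨by linarith [hθ.1, Real.pi_pos], hθ.2⟩)
  rw [h2, ← ENNReal.ofReal_mul (by positivity), ← ENNReal.ofReal_mul (by positivity)]
  congr 1
  ring


/-! ### Averages over post-collisional velocities -/

/-- The post-collisional velocity `v' = v - (1 + α)/2 ((v - v_*) · n) n`. -/
noncomputable def post (α : ℝ) (v vs n : Vel) : Vel :=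
  v - ((1 + α) / 2 * inner ℝ (v - vs) n) • n

/-- The post-collisional velocity `v_*' = v_* + (1 + α)/2 ((v - v_*) · n) n`. -/
noncomputable def postStar (α : ℝ) (v vs n : Vel) : Vel :=
  vs + ((1 + α) / 2 * inner ℝ (v - vs) n) • n

/-- Post-collisional velocities lie on the sphere with centre `v - R u/|u|` and radius
`R = (1 + α)|u|/4`, where `u = v - v_*`. -/
theorem lintegral_post_le (α : ℝ) {v vs : Vel} (huv : v - vs ≠ 0) {ψ : Vel → ℝ≥0∞}
    (hψ : Measurable ψ) :
    ∫⁻ n : UnitSphere, ENNReal.ofReal (inner ℝ (v - vs) (n : Vel)) * ψ (post α v vs n) ∂surface ≤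
      ENNReal.ofReal (‖v - vs‖ / 4) * ∫⁻ n : UnitSphere,
        ψ (v - ((1 + α) / 4) • (v - vs) - ((1 + α) / 4 * ‖v - vs‖) • (n : Vel)) ∂surface := by
  set u := v - vs with hu
  have hu' : 0 < ‖u‖ := norm_pos_iff.2 huv
  have he : ‖‖u‖⁻¹ • u‖ = 1 := by simp [norm_smul, hu'.ne']
  have key := lintegral_surface_reflect_le he
    (g := fun w => ψ (v - ((1 + α) / 4) • u - ((1 + α) / 4 * ‖u‖) • w)) (by fun_prop)
  have h1 : ∀ n : UnitSphere, ENNReal.ofReal (inner ℝ u (n : Vel)) * ψ (post α v vs n) =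
      ENNReal.ofReal (‖u‖ / 4) * (4 * (ENNReal.ofReal (inner ℝ (‖u‖⁻¹ • u) (n : Vel)) *
        ψ (v - ((1 + α) / 4) • u - ((1 + α) / 4 * ‖u‖) •
          ((2 * inner ℝ (‖u‖⁻¹ • u) (n : Vel)) • (n : Vel) - ‖u‖⁻¹ • u)))) := by
    intro n
    rw [← mul_assoc, ← mul_assoc, show (4 : ℝ≥0∞) = ENNReal.ofReal 4 by simp,
      ← ENNReal.ofReal_mul (by positivity), ← ENNReal.ofReal_mul (by positivity)]
    congr 2
    · rw [real_inner_smul_left]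
      field_simp
    · rw [real_inner_smul_left, post, ← hu]
      have e1 : (1 + α) / 4 * ‖u‖ * (2 * (‖u‖⁻¹ * inner ℝ u (n : Vel))) =
          (1 + α) / 2 * inner ℝ u (n : Vel) := by field_simp; ring
      have e2 : (1 + α) / 4 * ‖u‖ * ‖u‖⁻¹ = (1 + α) / 4 := by field_simp
      rw [smul_sub ((1 + α) / 4 * ‖u‖), smul_smul, smul_smul, e1, e2]
      abel
  simp only [h1]
  rw [lintegral_const_mul _ (by fun_prop), lintegral_const_mul _ (by fun_prop)]
  gcongr

/-- A component of a uniform point on a sphere of radius `R` has density at most `1/(2R)`. -/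
theorem lintegral_sphere_marginal_le {e : Vel} (he : ‖e‖ = 1) (c : ℝ) {R : ℝ} (hR : 0 < R)
    {φ : ℝ → ℝ≥0∞} (hφ : Measurable φ) :
    ∫⁻ n : UnitSphere, φ (c - R * inner ℝ (n : Vel) e) ∂surface ≤
      ENNReal.ofReal (2 * Real.pi / R) * ∫⁻ x, φ x := by
  rw [lintegral_surface_inner he (φ := fun τ => φ (c - R * τ)) (by fun_prop)]
  have h1 : ∫⁻ x in (fun θ => c - R * Real.cos θ) '' Ioo 0 Real.pi, φ x =
      ∫⁻ θ in Ioo 0 Real.pi, ENNReal.ofReal |R * Real.sin θ| * φ (c - R * Real.cos θ) := by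
    refine lintegral_image_eq_lintegral_abs_deriv_mul measurableSet_Ioo (fun θ _ => ?_) ?_ φ
    · have := ((Real.hasDerivAt_cos θ).const_mul R).const_sub c
      simpa using this.hasDerivWithinAt
    · intro x hx y hy hxy
      have hxy' : c - R * Real.cos x = c - R * Real.cos y := hxy
      have : Real.cos x = Real.cos y := by
        apply mul_left_cancel₀ hR.ne'
        linarith
      exact Real.injOn_cos ⟨hx.1.le, hx.2.le⟩ ⟨hy.1.le, hy.2.le⟩ this
  have h2 : ∫⁻ θ in Ioo 0 Real.pi, ENNReal.ofReal |R * Real.sin θ| * φ (c - R * Real.cos θ) =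
      ENNReal.ofReal R *
        ∫⁻ θ in Ioo 0 Real.pi, ENNReal.ofReal (Real.sin θ) * φ (c - R * Real.cos θ) := by
    rw [← lintegral_const_mul _ (by fun_prop)]
    refine setLIntegral_congr_fun measurableSet_Ioo fun θ hθ => ?_
    rw [abs_of_pos (mul_pos hR (Real.sin_pos_of_mem_Ioo hθ)), ENNReal.ofReal_mul hR.le, mul_assoc]
  rw [div_eq_mul_inv, ENNReal.ofReal_mul (p := 2 * Real.pi) (by positivity), mul_assoc]
  refine mul_le_mul_right ?_ _
  rw [ENNReal.ofReal_inv_of_pos hR, mul_comm, ← div_eq_mul_inv, ENNReal.le_div_iff_mul_le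
    (by simp [hR]) (by simp), mul_comm, ← h2, ← h1]
  exact setLIntegral_le_lintegral _ _

/-- The collision kernel maps densities on `ℝ` to bounded quantities: the weighted average of
`φ(v' · e)` over impact directions is bounded by the `L¹` norm of `φ`. -/
theorem lintegral_post_marginal_le {α : ℝ} (hα : 0 < α) (v vs : Vel) {e : Vel} (he : ‖e‖ = 1)
    {φ : ℝ → ℝ≥0∞} (hφ : Measurable φ) :
    ∫⁻ n : UnitSphere, ENNReal.ofReal (inner ℝ (v - vs) (n : Vel)) *
        φ (inner ℝ (post α v vs n) e) ∂surface ≤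
      ENNReal.ofReal (2 * Real.pi) * ∫⁻ x, φ x := by
  by_cases huv : v - vs = 0
  · simp [huv]
  have hu' : 0 < ‖v - vs‖ := norm_pos_iff.2 huv
  refine (lintegral_post_le α huv (ψ := fun w => φ (inner ℝ w e)) (by fun_prop)).trans ?_
  have hR : 0 < (1 + α) / 4 * ‖v - vs‖ := by positivity
  have := lintegral_sphere_marginal_le he (inner ℝ (v - ((1 + α) / 4) • (v - vs)) e) hR hφ
  simp only [inner_sub_left _ (((1 + α) / 4 * ‖v - vs‖) • _), real_inner_smul_left]
  simp only [real_inner_smul_left, inner_sub_left] at this ⊢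
  refine (mul_le_mul_right this _).trans ?_
  rw [← mul_assoc, ← ENNReal.ofReal_mul (by positivity)]
  refine mul_le_mul_left (ENNReal.ofReal_le_ofReal ?_) _
  rw [show ‖v - vs‖ / 4 * (2 * Real.pi / ((1 + α) / 4 * ‖v - vs‖)) = 2 * Real.pi / (1 + α) by
    field_simp]
  exact div_le_self (by positivity) (by linarith)

/-- The Newtonian potential of a sphere of radius `R` is bounded by a multiple of `1/R`: the
distance from `d` to `R n` is at least the distance from `R n` to the line spanned by `d`. -/
theorem lintegral_sphere_potential_le (d : Vel) {R : ℝ} (hR : 0 < R) :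
    ∫⁻ n : UnitSphere, ‖d - R • (n : Vel)‖ₑ⁻¹ ∂surface ≤
      ENNReal.ofReal (2 * Real.pi ^ 2 / R) := by
  obtain ⟨e, he, hd⟩ : ∃ e : Vel, ‖e‖ = 1 ∧ d = ‖d‖ • e := by
    by_cases h0 : d = 0
    · exact ⟨EuclideanSpace.single 0 1, by simp, by simp [h0]⟩
    · have : ‖d‖ ≠ 0 := norm_ne_zero_iff.2 h0
      exact ⟨‖d‖⁻¹ • d, by simp [norm_smul, this], by simp [smul_smul, this]⟩
  have h1 : ∀ n : UnitSphere, ‖d - R • (n : Vel)‖ₑ⁻¹ ≤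
      (ENNReal.ofReal (R * √(1 - inner ℝ (n : Vel) e ^ 2)))⁻¹ := by
    intro n
    rw [ENNReal.inv_le_inv, ← ofReal_norm]
    apply ENNReal.ofReal_le_ofReal
    -- the distance from `R n` to the line spanned by `d`
    have h2 : ‖d - R • (n : Vel)‖ ^ 2 = (‖d‖ - R * inner ℝ (n : Vel) e) ^ 2 +
        R ^ 2 * (1 - inner ℝ (n : Vel) e ^ 2) := by
      rw [norm_sub_sq_real]
      conv_lhs => rw [hd]
      simp only [norm_smul, he, norm_coe_unitSphere, real_inner_smul_left, inner_smul_right,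
        Real.norm_eq_abs, abs_norm, abs_of_pos hR, real_inner_comm e]
      ring
    have h3 : inner ℝ (n : Vel) e ^ 2 ≤ 1 := by
      have := abs_real_inner_le_norm (n : Vel) e
      rw [he, norm_coe_unitSphere] at this
      rw [← sq_abs]
      nlinarith [abs_nonneg (inner ℝ (n : Vel) e)]
    refine abs_le_of_sq_le_sq' ?_ (norm_nonneg _) |>.2
    rw [h2, mul_pow, Real.sq_sqrt (by linarith)]
    nlinarith [sq_nonneg (‖d‖ - R * inner ℝ (n : Vel) e)]
  refine (lintegral_mono h1).trans ?_
  rw [lintegral_surface_inner he (φ := fun τ => (ENNReal.ofReal (R * √(1 - τ ^ 2)))⁻¹)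
    (by fun_prop)]
  have h4 : ∫⁻ θ in Ioo 0 Real.pi, ENNReal.ofReal (Real.sin θ) *
      (ENNReal.ofReal (R * √(1 - Real.cos θ ^ 2)))⁻¹ = ENNReal.ofReal (Real.pi / R) := by
    have : ∀ θ ∈ Ioo 0 Real.pi, ENNReal.ofReal (Real.sin θ) *
        (ENNReal.ofReal (R * √(1 - Real.cos θ ^ 2)))⁻¹ = ENNReal.ofReal R⁻¹ := by
      intro θ hθ
      have hs := Real.sin_pos_of_mem_Ioo hθ
      rw [← Real.abs_sin_eq_sqrt_one_sub_cos_sq, abs_of_pos hs,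
        ← ENNReal.ofReal_inv_of_pos (by positivity), ← ENNReal.ofReal_mul hs.le]
      congr 1
      field_simp
    rw [setLIntegral_congr_fun measurableSet_Ioo this, setLIntegral_const, Real.volume_Ioo,
      ← ENNReal.ofReal_mul (by positivity)]
    congr 1
    ring
  rw [h4, ← ENNReal.ofReal_mul (by positivity)]
  apply le_of_eq
  congr 1
  ring

/-- The weighted average of `1/|v' - w|` over impact directions is bounded, uniformly in the
colliding velocities: the factor `|v - v_*|` of the kernel cancels the radius of the sphere of
outgoing velocities. -/
theorem lintegral_post_potential_le {α : ℝ} (hα : 0 < α) (v vs w : Vel) :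
    ∫⁻ n : UnitSphere, ENNReal.ofReal (inner ℝ (v - vs) (n : Vel)) *
        ‖post α v vs n - w‖ₑ⁻¹ ∂surface ≤ ENNReal.ofReal (2 * Real.pi ^ 2) := by
  by_cases huv : v - vs = 0
  · simp [huv]
  have hu' : 0 < ‖v - vs‖ := norm_pos_iff.2 huv
  refine (lintegral_post_le α huv (ψ := fun x => ‖x - w‖ₑ⁻¹) (by fun_prop)).trans ?_
  have hR : 0 < (1 + α) / 4 * ‖v - vs‖ := by positivity
  have := lintegral_sphere_potential_le (v - ((1 + α) / 4) • (v - vs) - w) hR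
  simp only [sub_right_comm _ _ w]
  simp only [sub_right_comm _ _ w] at this
  refine (mul_le_mul_right this _).trans ?_
  rw [← ENNReal.ofReal_mul (by positivity)]
  apply ENNReal.ofReal_le_ofReal
  rw [show ‖v - vs‖ / 4 * (2 * Real.pi ^ 2 / ((1 + α) / 4 * ‖v - vs‖)) =
    2 * Real.pi ^ 2 / (1 + α) by field_simp]
  exact div_le_self (by positivity) (by linarith)


/-! ### Weak form of the collision operator -/

section Measurability

variable {X : Type*} [MeasurableSpace X] {a b c : X → Vel}

@[fun_prop]
theorem measurable_pre (α : ℝ) (ha : Measurable a) (hb : Measurable b) (hc : Measurable c) :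
    Measurable fun x => pre α (a x) (b x) (c x) := by
  unfold pre; fun_prop

@[fun_prop]
theorem measurable_preStar (α : ℝ) (ha : Measurable a) (hb : Measurable b) (hc : Measurable c) :
    Measurable fun x => preStar α (a x) (b x) (c x) := by
  unfold preStar; fun_prop

@[fun_prop]
theorem measurable_post (α : ℝ) (ha : Measurable a) (hb : Measurable b) (hc : Measurable c) :
    Measurable fun x => post α (a x) (b x) (c x) := by
  unfold post; fun_prop

@[fun_prop]
theorem measurable_postStar (α : ℝ) (ha : Measurable a) (hb : Measurable b) (hc : Measurable c) :
    Measurable fun x => postStar α (a x) (b x) (c x) := by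
  unfold postStar; fun_prop

end Measurability

/-- The gain term as a `[0,∞]`-valued integral, bilinear in the two colliding densities. The factor
`((v_* - v) · n)₊` restricts the integral to the half sphere. -/
noncomputable def gainL (α : ℝ) (f g : Vel → ℝ≥0∞) (v : Vel) : ℝ≥0∞ :=
  ENNReal.ofReal (1 / α ^ 2) * ∫⁻ vs : Vel, ∫⁻ n : UnitSphere,
    ENNReal.ofReal (inner ℝ (vs - v) (n : Vel)) *
      (g (preStar α v vs n) * f (pre α v vs n)) ∂surface

/-- The loss frequency `π ∫ |v - v_*| g(v_*) dv_*`. -/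
noncomputable def lossL (g : Vel → ℝ≥0∞) (v : Vel) : ℝ≥0∞ :=
  ∫⁻ vs : Vel, ENNReal.ofReal (Real.pi * ‖v - vs‖) * g vs

/-- The average of `ψ` over the post-collisional velocities, with the collision kernel. -/
noncomputable def postAvg (α : ℝ) (ψ : Vel → ℝ≥0∞) (v vs : Vel) : ℝ≥0∞ :=
  ∫⁻ n : UnitSphere, ENNReal.ofReal (inner ℝ (v - vs) (n : Vel)) * ψ (post α v vs n) ∂surface

theorem inner_pre_sub_preStar {α : ℝ} (hα : 0 < α) (v vs : Vel) {n : Vel} (hn : ‖n‖ = 1) :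
    inner ℝ (pre α v vs n - preStar α v vs n) n = α⁻¹ * inner ℝ (vs - v) n := by
  simp only [pre, preStar, inner_sub_left, inner_add_left, real_inner_smul_left,
    real_inner_self_eq_norm_sq, hn]
  field_simp
  ring

theorem post_pre {α : ℝ} (hα : 0 < α) (v vs : Vel) {n : Vel} (hn : ‖n‖ = 1) :
    post α (pre α v vs n) (preStar α v vs n) n = v := by
  rw [post, inner_pre_sub_preStar hα v vs hn, pre, sub_sub, ← add_smul]
  convert sub_zero v using 2
  convert zero_smul ℝ n using 2
  rw [← neg_sub v vs, inner_neg_left]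
  field_simp
  ring

theorem postStar_pre {α : ℝ} (hα : 0 < α) (v vs : Vel) {n : Vel} (hn : ‖n‖ = 1) :
    postStar α (pre α v vs n) (preStar α v vs n) n = vs := by
  rw [postStar, inner_pre_sub_preStar hα v vs hn, preStar, add_assoc, ← add_smul]
  convert add_zero vs using 2
  convert zero_smul ℝ n using 2
  rw [← neg_sub v vs, inner_neg_left]
  field_simp
  ring

/-- For a fixed impact direction the map to pre-collisional velocities is linear, with
determinant `-1/α`. -/
theorem map_pre_preStar {α : ℝ} (hα : 0 < α) {n : Vel} (hn : ‖n‖ = 1) :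
    Measure.map (fun p : Vel × Vel => (pre α p.1 p.2 n, preStar α p.1 p.2 n)) volume =
      ENNReal.ofReal α • (volume : Measure (Vel × Vel)) := by
  set ℓ : Module.Dual ℝ (Vel × Vel) :=
    (((innerSL ℝ n).comp (ContinuousLinearMap.fst ℝ Vel Vel) -
      (innerSL ℝ n).comp (ContinuousLinearMap.snd ℝ Vel Vel) : Vel × Vel →L[ℝ] ℝ) :
        Vel × Vel →ₗ[ℝ] ℝ) with hℓ
  set w : Vel × Vel := (-((1 + 1 / α) / 2)) • (n, -n) with hw
  have hfun : (fun p : Vel × Vel => (pre α p.1 p.2 n, preStar α p.1 p.2 n)) =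
      LinearMap.transvection ℓ w := by
    funext p
    simp only [LinearMap.transvection, hℓ, hw, pre, preStar, LinearMap.coe_mk, AddHom.coe_mk,
      real_inner_comm n, inner_sub_right]
    ext1 <;> simp <;> module
  have hdet : LinearMap.det (LinearMap.transvection ℓ w) = -α⁻¹ := by
    have : ℓ w = -((1 + 1 / α) / 2) * 2 := by
      rw [hw, map_smul, smul_eq_mul]
      congr 1
      simp [hℓ, hn]
      norm_num
    rw [LinearMap.transvection.det, this]
    field_simp
    ring
  have : (volume : Measure (Vel × Vel)).IsAddHaarMeasure := by
    rw [Measure.volume_eq_prod]; infer_instance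
  rw [hfun, Measure.map_linearMap_addHaar_eq_smul_addHaar _ (by rw [hdet]; simp [hα.ne']), hdet]
  simp [abs_of_pos hα]

/-- The change of variables from pre-collisional velocities, for a fixed impact direction. -/
theorem lintegral_pre_preStar {α : ℝ} (hα : 0 < α) {n : Vel} (hn : ‖n‖ = 1)
    {H : Vel × Vel → ℝ≥0∞} (hH : Measurable H) :
    ∫⁻ p : Vel × Vel, H (pre α p.1 p.2 n, preStar α p.1 p.2 n) =
      ENNReal.ofReal α * ∫⁻ p, H p := by
  rw [← lintegral_map (f := H) (g := fun p : Vel × Vel => (pre α p.1 p.2 n, preStar α p.1 p.2 n))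
    hH (by fun_prop), map_pre_preStar hα hn, lintegral_smul_measure, smul_eq_mul]

/-- The three-fold integral with the impact direction outermost. -/
theorem lintegral_surface_outer {F : Vel → Vel → Vel → ℝ≥0∞}
    (hF : Measurable fun x : Vel × Vel × Vel => F x.1 x.2.1 x.2.2) :
    ∫⁻ v, ∫⁻ vs, ∫⁻ n : UnitSphere, F v vs n ∂surface =
      ∫⁻ n : UnitSphere, (∫⁻ p : Vel × Vel, F p.1 p.2 n) ∂surface := by
  have hm : Measurable fun q : (Vel × Vel) × UnitSphere => F q.1.1 q.1.2 q.2 :=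
    hF.comp (by fun_prop : Measurable fun q : (Vel × Vel) × UnitSphere =>
      (q.1.1, q.1.2, (q.2 : Vel)))
  have h := lintegral_prod (μ := (volume : Measure Vel)) (ν := (volume : Measure Vel))
    (fun p : Vel × Vel => ∫⁻ n : UnitSphere, F p.1 p.2 n ∂surface)
    (hm.lintegral_prod_right').aemeasurable
  rw [← h, ← Measure.volume_eq_prod]
  exact lintegral_lintegral_swap hm.aemeasurable

theorem measurable_postAvg (α : ℝ) {ψ : Vel → ℝ≥0∞} (hψ : Measurable ψ) :
    Measurable (Function.uncurry (postAvg α ψ)) := by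
  refine Measurable.lintegral_prod_right' (f := fun q : (Vel × Vel) × UnitSphere =>
    ENNReal.ofReal (inner ℝ (q.1.1 - q.1.2) (q.2 : Vel)) * ψ (post α q.1.1 q.1.2 q.2)) ?_
  fun_prop

/-- The weak form of the gain term. -/
theorem lintegral_gainL_mul {α : ℝ} (hα : 0 < α) {f g ψ : Vel → ℝ≥0∞} (hf : Measurable f)
    (hg : Measurable g) (hψ : Measurable ψ) :
    ∫⁻ v, gainL α f g v * ψ v = ∫⁻ v, ∫⁻ vs, f v * g vs * postAvg α ψ v vs := by
  have h1 : ∀ v, gainL α f g v * ψ v = ENNReal.ofReal (1 / α ^ 2) * ∫⁻ vs : Vel,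
      ∫⁻ n : UnitSphere, ENNReal.ofReal (inner ℝ (vs - v) (n : Vel)) *
        (g (preStar α v vs n) * f (pre α v vs n)) * ψ v ∂surface := by
    intro v
    rw [gainL, mul_assoc]
    congr 1
    rw [← lintegral_mul_const'' _]
    · refine lintegral_congr fun vs => ?_
      rw [← lintegral_mul_const'' _ (by fun_prop)]
    · refine (Measurable.lintegral_prod_right' (f := fun q : Vel × UnitSphere =>
        ENNReal.ofReal (inner ℝ (q.1 - v) (q.2 : Vel)) *
          (g (preStar α v q.1 q.2) * f (pre α v q.1 q.2))) ?_).aemeasurable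
      fun_prop
  simp only [h1]
  have hm3 : Measurable fun x : Vel × Vel × Vel => ENNReal.ofReal (inner ℝ (x.2.1 - x.1) x.2.2) *
      (g (preStar α x.1 x.2.1 x.2.2) * f (pre α x.1 x.2.1 x.2.2)) * ψ x.1 := by fun_prop
  rw [lintegral_const_mul]
  swap
  · refine Measurable.lintegral_prod_right' (f := fun p : Vel × Vel => ∫⁻ n : UnitSphere,
      ENNReal.ofReal (inner ℝ (p.2 - p.1) (n : Vel)) *
        (g (preStar α p.1 p.2 n) * f (pre α p.1 p.2 n)) * ψ p.1 ∂surface) ?_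
    refine Measurable.lintegral_prod_right' (f := fun q : (Vel × Vel) × UnitSphere =>
      ENNReal.ofReal (inner ℝ (q.1.2 - q.1.1) (q.2 : Vel)) *
        (g (preStar α q.1.1 q.1.2 q.2) * f (pre α q.1.1 q.1.2 q.2)) * ψ q.1.1) ?_
    fun_prop
  rw [lintegral_surface_outer (F := fun v vs n => ENNReal.ofReal (inner ℝ (vs - v) n) *
        (g (preStar α v vs n) * f (pre α v vs n)) * ψ v) hm3]
  have h2 : ∀ v vs, f v * g vs * postAvg α ψ v vs = ∫⁻ n : UnitSphere, f v * g vs *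
      (ENNReal.ofReal (inner ℝ (v - vs) (n : Vel)) * ψ (post α v vs n)) ∂surface := by
    intro v vs
    rw [postAvg, ← lintegral_const_mul'' _ (by fun_prop)]
  simp only [h2]
  rw [lintegral_surface_outer (F := fun v vs n => f v * g vs *
      (ENNReal.ofReal (inner ℝ (v - vs) n) * ψ (post α v vs n))) (by fun_prop)]
  rw [← lintegral_const_mul]
  swap
  · refine Measurable.lintegral_prod_right' (f := fun q : UnitSphere × (Vel × Vel) =>
      ENNReal.ofReal (inner ℝ (q.2.2 - q.2.1) (q.1 : Vel)) *
        (g (preStar α q.2.1 q.2.2 q.1) * f (pre α q.2.1 q.2.2 q.1)) * ψ q.2.1) ?_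
    fun_prop
  refine lintegral_congr fun n => ?_
  have hn := norm_coe_unitSphere n
  have h3 := lintegral_pre_preStar hα hn (H := fun p => f p.1 * g p.2 *
      (ENNReal.ofReal (inner ℝ (p.1 - p.2) (n : Vel)) * ψ (post α p.1 p.2 n))) (by fun_prop)
  simp only [inner_pre_sub_preStar hα _ _ hn, post_pre hα _ _ hn] at h3
  have h4 : ∀ p : Vel × Vel, f (pre α p.1 p.2 n) * g (preStar α p.1 p.2 n) *
      (ENNReal.ofReal (α⁻¹ * inner ℝ (p.2 - p.1) (n : Vel)) * ψ p.1) = ENNReal.ofReal α⁻¹ *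
      (ENNReal.ofReal (inner ℝ (p.2 - p.1) (n : Vel)) *
        (g (preStar α p.1 p.2 n) * f (pre α p.1 p.2 n)) * ψ p.1) := by
    intro p
    rw [ENNReal.ofReal_mul (by positivity)]
    ring
  simp only [h4] at h3
  rw [lintegral_const_mul _ (by fun_prop)] at h3
  rw [show 1 / α ^ 2 = α⁻¹ * α⁻¹ by field_simp, ENNReal.ofReal_mul (by positivity), mul_assoc, h3,
    ← mul_assoc, ← ENNReal.ofReal_mul (by positivity), inv_mul_cancel₀ hα.ne']
  simp

/-- The surface measure is invariant under `n ↦ -n`. -/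
theorem lintegral_surface_neg {φ : Vel → ℝ≥0∞} (hφ : Measurable φ) :
    ∫⁻ n : UnitSphere, φ (-(n : Vel)) ∂surface = ∫⁻ n : UnitSphere, φ n ∂surface := by
  have h0 := lintegral_Ioi_pow_indicator 2
  set h : ℝ → ℝ≥0∞ := (Iio (1 : ℝ)).indicator 1 with hh
  have hm : Measurable h := measurable_one.indicator measurableSet_Iio
  have key : ∀ χ : Vel → ℝ≥0∞, Measurable χ → ∫⁻ x : Vel, χ (‖x‖⁻¹ • x) * h ‖x‖ =
      (∫⁻ n : UnitSphere, χ n ∂surface) * ENNReal.ofReal (1 / (((2 : ℕ) : ℝ) + 1)) := by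
    intro χ hχ
    rw [lintegral_polar (by fun_prop), ← lintegral_mul_const'' _ (by fun_prop)]
    refine lintegral_congr fun n => ?_
    rw [← h0, ← lintegral_const_mul _ (by fun_prop)]
    refine setLIntegral_congr_fun measurableSet_Ioi fun r hr => ?_
    have hr' : (0 : ℝ) < r := hr
    simp only [norm_smul, norm_coe_unitSphere, Real.norm_eq_abs, abs_of_pos hr', smul_smul,
      mul_one, inv_mul_cancel₀ hr'.ne', one_smul]
    ring
  have k1 := key φ hφ
  have k2 := key (fun x => φ (-x)) (by fun_prop)
  have k3 : ∫⁻ x : Vel, φ (-(‖x‖⁻¹ • x)) * h ‖x‖ = ∫⁻ x : Vel, φ (‖x‖⁻¹ • x) * h ‖x‖ := by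
    rw [← lintegral_neg_eq_self (μ := (volume : Measure Vel))]
    simp
  rw [k3, k1] at k2
  refine ((ENNReal.mul_left_inj ?_ ENNReal.ofReal_ne_top).1 k2).symm
  norm_num

/-- Exchanging the two particles amounts to averaging over the velocity `v_*'` of the partner. -/
theorem postAvg_swap (α : ℝ) {ψ : Vel → ℝ≥0∞} (hψ : Measurable ψ) (v vs : Vel) :
    postAvg α ψ vs v = ∫⁻ n : UnitSphere, ENNReal.ofReal (inner ℝ (v - vs) (n : Vel)) *
      ψ (postStar α v vs n) ∂surface := by
  rw [postAvg, ← lintegral_surface_neg (φ := fun n => ENNReal.ofReal (inner ℝ (vs - v) n) *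
    ψ (post α vs v n)) (by fun_prop)]
  refine lintegral_congr fun n => ?_
  have : inner ℝ (vs - v) (-(n : Vel)) = inner ℝ (v - vs) (n : Vel) := by
    rw [← neg_sub v vs, inner_neg_neg]
  rw [post, postStar, this]
  simp

/-- Symmetrisation of the weak form under exchange of the two particles. -/
theorem two_mul_lintegral_gainL_mul {α : ℝ} (hα : 0 < α) {g ψ : Vel → ℝ≥0∞} (hg : Measurable g)
    (hψ : Measurable ψ) :
    2 * ∫⁻ v, gainL α g g v * ψ v = ∫⁻ v, ∫⁻ vs, ∫⁻ n : UnitSphere, g v * g vs *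
      (ENNReal.ofReal (inner ℝ (v - vs) (n : Vel)) *
        (ψ (post α v vs n) + ψ (postStar α v vs n))) ∂surface := by
  have hA : Measurable fun p : Vel × Vel => g p.1 * g p.2 * postAvg α ψ p.1 p.2 := by
    have := measurable_postAvg α hψ
    exact ((hg.comp measurable_fst).mul (hg.comp measurable_snd)).mul this
  have h1 := lintegral_gainL_mul hα hg hg hψ
  have h2 : ∫⁻ v, gainL α g g v * ψ v = ∫⁻ v, ∫⁻ vs, g v * g vs * postAvg α ψ vs v := by
    rw [h1, lintegral_lintegral_swap hA.aemeasurable]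
    refine lintegral_congr fun v => lintegral_congr fun vs => ?_
    rw [mul_comm (g v)]
  calc 2 * ∫⁻ v, gainL α g g v * ψ v
      = (∫⁻ v, ∫⁻ vs, g v * g vs * postAvg α ψ v vs) +
          ∫⁻ v, ∫⁻ vs, g v * g vs * postAvg α ψ vs v := by rw [two_mul, ← h2, ← h1]
    _ = ∫⁻ v, ((∫⁻ vs, g v * g vs * postAvg α ψ v vs) +
          ∫⁻ vs, g v * g vs * postAvg α ψ vs v) :=
        (lintegral_add_left hA.lintegral_prod_right' _).symm
    _ = _ := by
        refine lintegral_congr fun v => ?_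
        rw [← lintegral_add_left (f := fun vs => g v * g vs * postAvg α ψ v vs)
          (hA.comp measurable_prodMk_left)]
        refine lintegral_congr fun vs => ?_
        rw [postAvg_swap α hψ v vs, postAvg, ← mul_add, ← lintegral_add_left (by fun_prop),
          ← lintegral_const_mul _ (by fun_prop)]
        simp only [mul_add]

/-- The weak form of the loss term, symmetrised. -/
theorem two_mul_lintegral_lossL_mul {g ψ : Vel → ℝ≥0∞} (hg : Measurable g) (hψ : Measurable ψ) :
    2 * ∫⁻ v, g v * lossL g v * ψ v = ∫⁻ v, ∫⁻ vs, ∫⁻ n : UnitSphere, g v * g vs *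
      (ENNReal.ofReal (inner ℝ (v - vs) (n : Vel)) * (ψ v + ψ vs)) ∂surface := by
  have h0 : ∀ v vs, ∫⁻ n : UnitSphere, g v * g vs * (ENNReal.ofReal (inner ℝ (v - vs) (n : Vel)) *
      (ψ v + ψ vs)) ∂surface = g v * g vs * ENNReal.ofReal (Real.pi * ‖v - vs‖) * ψ v +
        g v * g vs * ENNReal.ofReal (Real.pi * ‖v - vs‖) * ψ vs := by
    intro v vs
    rw [lintegral_const_mul _ (by fun_prop), lintegral_mul_const _ (by fun_prop),
      lintegral_surface_inner_pos]
    ring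
  have h1 : ∫⁻ v, g v * lossL g v * ψ v =
      ∫⁻ v, ∫⁻ vs, g v * g vs * ENNReal.ofReal (Real.pi * ‖v - vs‖) * ψ v := by
    refine lintegral_congr fun v => ?_
    rw [lossL, ← lintegral_const_mul _ (by fun_prop), ← lintegral_mul_const _ (by fun_prop)]
    refine lintegral_congr fun vs => ?_
    ring
  have h2 : ∫⁻ v, g v * lossL g v * ψ v =
      ∫⁻ v, ∫⁻ vs, g v * g vs * ENNReal.ofReal (Real.pi * ‖v - vs‖) * ψ vs := by
    rw [h1, lintegral_lintegral_swap (by simp only [Function.uncurry_def]; fun_prop)]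
    refine lintegral_congr fun v => lintegral_congr fun vs => ?_
    rw [norm_sub_rev]
    ring
  simp only [h0]
  rw [two_mul]
  nth_rw 2 [h2]
  rw [h1, ← lintegral_add_left]
  swap
  · exact Measurable.lintegral_prod_right' (f := fun p : Vel × Vel =>
      g p.1 * g p.2 * ENNReal.ofReal (Real.pi * ‖p.1 - p.2‖) * ψ p.1) (by fun_prop)
  refine lintegral_congr fun v => ?_
  rw [← lintegral_add_left (by fun_prop)]


/-! ### Pointwise bound of the gain term -/

/-- The Newtonian potential `∫ g(w) / |w - v| dw`. -/
noncomputable def potential (g : Vel → ℝ≥0∞) (v : Vel) : ℝ≥0∞ :=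
  ∫⁻ w : Vel, g w * ‖w - v‖ₑ⁻¹

/-- All one-dimensional marginals of the density `g` are bounded by `P`; in other words, the
integrals of `g` over planes are at most `P`. The formulation by duality does not require the
plane integrals to be defined. -/
def MarginalLE (g : Vel → ℝ≥0∞) (P : ℝ≥0∞) : Prop :=
  ∀ e : Vel, ‖e‖ = 1 → ∀ φ : ℝ → ℝ≥0∞, Measurable φ →
    ∫⁻ z, g z * φ (inner ℝ z e) ≤ P * ∫⁻ x, φ x

/-- Pre-collisional velocities avoid null sets, for almost all `v`, `v_*` and `n`. -/
theorem ae_pre_preStar {α : ℝ} (hα : 0 < α) {p : Vel → Prop} (hp : ∀ᵐ x, p x) :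
    ∀ᵐ v : Vel, ∀ᵐ q : Vel × UnitSphere ∂((volume : Measure Vel).prod surface),
      p (pre α v q.1 q.2) ∧ p (preStar α v q.1 q.2) := by
  set N : Set Vel := toMeasurable volume {x | ¬ p x} with hN
  have hNm : MeasurableSet N := measurableSet_toMeasurable _ _
  have hN0 : volume N = 0 := by rw [hN, measure_toMeasurable]; exact hp
  have hpN : ∀ x, x ∉ N → p x := by
    intro x hx
    by_contra h
    exact hx (subset_toMeasurable _ _ h)
  set χ : Vel → ℝ≥0∞ := N.indicator 1 with hχ
  have hχm : Measurable χ := measurable_one.indicator hNm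
  have hχ0 : ∫⁻ x, χ x = 0 := by rw [hχ, lintegral_indicator_one hNm, hN0]
  have key : ∫⁻ v, ∫⁻ vs, ∫⁻ n : UnitSphere,
      (χ (pre α v vs n) + χ (preStar α v vs n)) ∂surface = 0 := by
    rw [lintegral_surface_outer (F := fun v vs n => χ (pre α v vs n) + χ (preStar α v vs n))
      (by fun_prop)]
    have : ∀ n : UnitSphere, ∫⁻ p : Vel × Vel, (χ (pre α p.1 p.2 n) + χ (preStar α p.1 p.2 n)) =
        0 := by
      intro n
      rw [lintegral_pre_preStar hα (norm_coe_unitSphere n) (H := fun p => χ p.1 + χ p.2)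
        (by fun_prop), lintegral_add_left (by fun_prop), Measure.volume_eq_prod,
        lintegral_prod _ (by fun_prop), lintegral_prod _ (by fun_prop)]
      simp [hχ0, lintegral_mul_const _ hχm]
    simp [this]
  have hm : Measurable fun r : Vel × (Vel × UnitSphere) =>
      χ (pre α r.1 r.2.1 r.2.2) + χ (preStar α r.1 r.2.1 r.2.2) := by fun_prop
  have key2 : ∫⁻ v, ∫⁻ q : Vel × UnitSphere, (χ (pre α v q.1 q.2) + χ (preStar α v q.1 q.2))
      ∂((volume : Measure Vel).prod surface) = 0 := by
    rw [← key]
    refine lintegral_congr fun v => ?_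
    exact lintegral_prod _ (hm.comp measurable_prodMk_left).aemeasurable
  rw [lintegral_eq_zero_iff hm.lintegral_prod_right'] at key2
  filter_upwards [key2] with v hv
  have hv' := (lintegral_eq_zero_iff (hm.comp measurable_prodMk_left)).1 hv
  filter_upwards [hv'] with q hq
  have hq' : χ (pre α v q.1 q.2) + χ (preStar α v q.1 q.2) = 0 := hq
  rw [add_eq_zero] at hq'
  constructor
  · apply hpN
    intro h
    simp [hχ, h] at hq'
  · apply hpN
    intro h
    simp [hχ, h] at hq'

theorem gainL_eq_prod (α : ℝ) {f g : Vel → ℝ≥0∞} (hf : Measurable f) (hg : Measurable g)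
    (v : Vel) : gainL α f g v = ENNReal.ofReal (1 / α ^ 2) * ∫⁻ q : Vel × UnitSphere,
      ENNReal.ofReal (inner ℝ (q.1 - v) (q.2 : Vel)) *
        (g (preStar α v q.1 q.2) * f (pre α v q.1 q.2)) ∂((volume : Measure Vel).prod surface) := by
  rw [gainL, lintegral_prod _ (by fun_prop)]

theorem potential_polar {f : Vel → ℝ≥0∞} (hf : Measurable f) (v : Vel) :
    potential f v = ∫⁻ n : UnitSphere, (∫⁻ r in Ioi (0 : ℝ),
      ENNReal.ofReal r * f (v + r • (n : Vel))) ∂surface := by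
  rw [potential, ← lintegral_add_left_eq_self _ v, lintegral_polar (by fun_prop)]
  refine lintegral_congr fun n => ?_
  refine setLIntegral_congr_fun measurableSet_Ioi fun r hr => ?_
  have hr' : (0 : ℝ) < r := hr
  have h1 : ‖v + r • (n : Vel) - v‖ₑ⁻¹ = ENNReal.ofReal r⁻¹ := by
    rw [add_sub_cancel_left, ← ofReal_norm, norm_smul, norm_coe_unitSphere, mul_one,
      Real.norm_eq_abs, abs_of_pos hr', ENNReal.ofReal_inv_of_pos hr']
  rw [h1, mul_comm (f _), ← mul_assoc, ← ENNReal.ofReal_mul (by positivity)]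
  congr 2
  field_simp

/-- Coordinates adapted to a unit vector `n`, together with the marginal `φ` of a density `ρ` in the
direction `n`: the integral of `ρ` over a plane orthogonal to `n`. -/
theorem exists_slice_marginal {n : Vel} (hn : ‖n‖ = 1) {ρ : Vel → ℝ≥0∞} (hρ : Measurable ρ) :
    ∃ b c : Vel, ∃ φ : ℝ → ℝ≥0∞, Measurable φ ∧ ∫⁻ s, φ s = ∫⁻ x, ρ x ∧
      (∀ x : Vel, ∫⁻ y : ℝ, ∫⁻ z : ℝ, ρ (x + (y • b + z • c)) = φ (inner ℝ x n)) ∧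
      (∀ a y z : ℝ, inner ℝ (a • n + y • b + z • c) n = a) ∧
      ∀ F : Vel → ℝ≥0∞, Measurable F →
        ∫⁻ x, F x = ∫⁻ a : ℝ, ∫⁻ y : ℝ, ∫⁻ z : ℝ, F (a • n + y • b + z • c) := by
  obtain ⟨b, c, hb, hc, -, hdec, hslice⟩ := exists_lintegral_slice hn
  refine ⟨b, c, fun s => ∫⁻ y : ℝ, ∫⁻ z : ℝ, ρ (s • n + y • b + z • c), ?_, ?_, ?_, ?_, hslice⟩
  · have h1 : Measurable fun q : (ℝ × ℝ) × ℝ => ρ (q.1.1 • n + q.1.2 • b + q.2 • c) := by fun_prop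
    exact h1.lintegral_prod_right'.lintegral_prod_right'
  · exact (hslice ρ hρ).symm
  · intro x
    obtain ⟨y₀, z₀, hx⟩ := hdec x
    have e1 : ∀ y z : ℝ, x + (y • b + z • c) =
        inner ℝ x n • n + (y₀ + y) • b + (z₀ + z) • c := by
      intro y z
      conv_lhs => rw [hx]
      module
    simp only [e1]
    rw [lintegral_add_left_eq_self (fun y => ∫⁻ z : ℝ, ρ (inner ℝ x n • n + y • b + (z₀ + z) • c))]
    refine lintegral_congr fun y => ?_
    rw [lintegral_add_left_eq_self (fun z => ρ (inner ℝ x n • n + y • b + z • c))]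
  · intro a y z
    simp [inner_add_left, real_inner_smul_left, hb, hc, hn]

theorem measurable_conv {g ρ : Vel → ℝ≥0∞} (hg : Measurable g) (hρ : Measurable ρ) :
    Measurable fun x => ∫⁻ z, g z * ρ (x - z) := by
  have : Measurable fun q : Vel × Vel => g q.2 * ρ (q.1 - q.2) := by fun_prop
  exact this.lintegral_prod_right'

/-- Plane integrals of a mollified density inherit the bound of the marginals of the density. -/
theorem lintegral_plane_conv_le {n b c : Vel} (hn : ‖n‖ = 1) {g ρ : Vel → ℝ≥0∞} {φ : ℝ → ℝ≥0∞}
    (hg : Measurable g) (hρ : Measurable ρ) (hφ : Measurable φ) (hφ1 : ∫⁻ s, φ s ≤ 1)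
    (hplane : ∀ x : Vel, ∫⁻ y : ℝ, ∫⁻ z : ℝ, ρ (x + (y • b + z • c)) = φ (inner ℝ x n))
    {P : ℝ≥0∞} (hP : MarginalLE g P) (x : Vel) :
    ∫⁻ y : ℝ, ∫⁻ z : ℝ, ∫⁻ w, g w * ρ (x + (y • b + z • c) - w) ≤ P := by
  have hC : Measurable fun q : (ℝ × ℝ) × Vel =>
      g q.2 * ρ (x + (q.1.1 • b + q.1.2 • c) - q.2) := by fun_prop
  have s1 : ∫⁻ y : ℝ, ∫⁻ z : ℝ, ∫⁻ w, g w * ρ (x + (y • b + z • c) - w) =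
      ∫⁻ w, g w * φ (inner ℝ x n - inner ℝ w n) := by
    have hC' : Measurable fun q : ℝ × ℝ => ∫⁻ w, g w * ρ (x + (q.1 • b + q.2 • c) - w) :=
      hC.lintegral_prod_right'
    have t1 := lintegral_prod (μ := (volume : Measure ℝ)) (ν := (volume : Measure ℝ)) _
      hC'.aemeasurable
    rw [← t1, lintegral_lintegral_swap hC.aemeasurable]
    refine lintegral_congr fun w => ?_
    rw [lintegral_const_mul _ (by fun_prop)]
    congr 1
    rw [lintegral_prod _ (by fun_prop), ← inner_sub_left, ← hplane]
    refine lintegral_congr fun y => lintegral_congr fun z => ?_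
    congr 1
    abel
  rw [s1]
  refine (hP n hn (fun s => φ (inner ℝ x n - s)) (by fun_prop)).trans ?_
  rw [lintegral_sub_left_eq_self]
  exact mul_le_of_le_one_right' hφ1

/-- For a fixed impact direction `n`, the gain integral of a mollified density only sees the
density through its marginal in the direction `n`. -/
theorem lintegral_preStar_conv_le (α : ℝ) {n : Vel} (hn : ‖n‖ = 1) {f g ρ : Vel → ℝ≥0∞}
    (hf : Measurable f) (hg : Measurable g) (hρ : Measurable ρ) (hρ1 : ∫⁻ x, ρ x ≤ 1)
    {P : ℝ≥0∞} (hP : MarginalLE g P) (v : Vel) :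
    ∫⁻ vs, ENNReal.ofReal (inner ℝ (vs - v) n) *
        ((∫⁻ z, g z * ρ (preStar α v vs n - z)) * f (pre α v vs n)) ≤
      P * ∫⁻ a : ℝ, ENNReal.ofReal a * f (v + ((1 + 1 / α) / 2 * a) • n) := by
  obtain ⟨b, c, φ, hφ, hφ1, hplane, hin, hslice⟩ := exists_slice_marginal hn hρ
  obtain ⟨h, hh⟩ : ∃ h, h = fun x => ∫⁻ z, g z * ρ (x - z) := ⟨_, rfl⟩
  have hhm : Measurable h := by rw [hh]; exact measurable_conv hg hρ
  have hh' : ∀ x, ∫⁻ z, g z * ρ (x - z) = h x := fun x => by rw [hh]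
  have e2 : ∀ x, ∫⁻ y : ℝ, ∫⁻ z : ℝ, h (x + (y • b + z • c)) ≤ P := by
    intro x
    have := lintegral_plane_conv_le hn hg hρ hφ (hφ1.trans_le hρ1) hplane hP x
    simpa only [hh'] using this
  simp only [hh']
  rw [← lintegral_add_left_eq_self _ v, hslice _ (by fun_prop)]
  have hpre : ∀ a y z : ℝ, pre α v (v + (a • n + y • b + z • c)) n =
      v + ((1 + 1 / α) / 2 * a) • n := by
    intro a y z
    rw [pre, sub_add_cancel_left, inner_neg_left, hin]
    module
  have hpreS : ∀ a y z : ℝ, preStar α v (v + (a • n + y • b + z • c)) n =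
      v + ((1 - (1 + 1 / α) / 2) * a) • n + (y • b + z • c) := by
    intro a y z
    rw [preStar, sub_add_cancel_left, inner_neg_left, hin]
    module
  simp only [add_sub_cancel_left, hin, hpre, hpreS]
  rw [← lintegral_const_mul _ (by fun_prop)]
  refine lintegral_mono fun a => ?_
  have hC : Measurable fun q : ℝ × ℝ =>
      h (v + ((1 - (1 + 1 / α) / 2) * a) • n + (q.1 • b + q.2 • c)) := by fun_prop
  calc ∫⁻ y : ℝ, ∫⁻ z : ℝ, ENNReal.ofReal a *
      (h (v + ((1 - (1 + 1 / α) / 2) * a) • n + (y • b + z • c)) *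
        f (v + ((1 + 1 / α) / 2 * a) • n))
      = ∫⁻ y : ℝ, (ENNReal.ofReal a * f (v + ((1 + 1 / α) / 2 * a) • n)) *
          ∫⁻ z : ℝ, h (v + ((1 - (1 + 1 / α) / 2) * a) • n + (y • b + z • c)) := by
        refine lintegral_congr fun y => ?_
        rw [← lintegral_const_mul _ (by fun_prop)]
        refine lintegral_congr fun z => ?_
        ring
    _ = (ENNReal.ofReal a * f (v + ((1 + 1 / α) / 2 * a) • n)) * ∫⁻ y : ℝ, ∫⁻ z : ℝ,
          h (v + ((1 - (1 + 1 / α) / 2) * a) • n + (y • b + z • c)) :=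
        lintegral_const_mul _ hC.lintegral_prod_right'
    _ ≤ (ENNReal.ofReal a * f (v + ((1 + 1 / α) / 2 * a) • n)) * P := mul_le_mul_right (e2 _) _
    _ = _ := mul_comm _ _

/-- Rescaling of an integral with the weight `a₊`; the factor `1/γ²` compensates the factor `1/α²`
in the gain term. -/
theorem lintegral_ofReal_mul_scale {γ : ℝ} (hγ : 0 < γ) {h : ℝ → ℝ≥0∞} (hh : Measurable h) :
    ∫⁻ a : ℝ, ENNReal.ofReal a * h (γ * a) =
      ENNReal.ofReal (1 / γ ^ 2) * ∫⁻ r in Ioi (0 : ℝ), ENNReal.ofReal r * h r := by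
  have h1 : ∫⁻ r in Ioi (0 : ℝ), ENNReal.ofReal r * h r = ∫⁻ r : ℝ, ENNReal.ofReal r * h r := by
    rw [← lintegral_indicator measurableSet_Ioi]
    refine lintegral_congr fun r => ?_
    by_cases hr : 0 < r
    · simp [indicator, hr]
    · simp [indicator, hr, ENNReal.ofReal_of_nonpos (not_lt.1 hr)]
  have h2 := Real.map_volume_mul_left hγ.ne'
  have h3 : ∫⁻ a : ℝ, ENNReal.ofReal (γ * a) * h (γ * a) =
      ENNReal.ofReal γ⁻¹ * ∫⁻ r : ℝ, ENNReal.ofReal r * h r := by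
    rw [← lintegral_map (f := fun r => ENNReal.ofReal r * h r) (g := fun a => γ * a) (by fun_prop)
      (by fun_prop), h2, lintegral_smul_measure, smul_eq_mul, abs_of_pos (by positivity)]
  simp only [ENNReal.ofReal_mul hγ.le, mul_assoc] at h3
  rw [lintegral_const_mul _ (by fun_prop)] at h3
  rw [h1, show 1 / γ ^ 2 = γ⁻¹ * γ⁻¹ by field_simp, ENNReal.ofReal_mul (by positivity), mul_assoc,
    ← h3, ← mul_assoc, ← ENNReal.ofReal_mul (by positivity), inv_mul_cancel₀ hγ.ne']
  simp

/-- The pointwise bound of the gain term when one of the densities is mollified, so that its plane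
integrals are defined everywhere. -/
theorem gainL_conv_le {α : ℝ} (hα : 0 < α) {f g ρ : Vel → ℝ≥0∞}
    (hf : Measurable f) (hg : Measurable g) (hρ : Measurable ρ) (hρ1 : ∫⁻ x, ρ x ≤ 1)
    {P : ℝ≥0∞} (hP : MarginalLE g P) (v : Vel) :
    gainL α f (fun x => ∫⁻ z, g z * ρ (x - z)) v ≤ 4 * P * potential f v := by
  have hconv := measurable_conv hg hρ
  have hγ : 0 < (1 + 1 / α) / 2 := by positivity
  rw [gainL_eq_prod α hf hconv, lintegral_prod_symm]
  swap
  · have : Measurable fun q : Vel × UnitSphere => ∫⁻ z, g z * ρ (preStar α v q.1 q.2 - z) :=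
      hconv.comp (g := fun x => ∫⁻ z, g z * ρ (x - z)) (by fun_prop :
        Measurable fun q : Vel × UnitSphere => preStar α v q.1 q.2)
    fun_prop
  have h1 : ∫⁻ n : UnitSphere, (∫⁻ vs, ENNReal.ofReal (inner ℝ (vs - v) (n : Vel)) *
      ((∫⁻ z, g z * ρ (preStar α v vs n - z)) * f (pre α v vs n))) ∂surface ≤
      ∫⁻ n : UnitSphere, P * (ENNReal.ofReal (1 / ((1 + 1 / α) / 2) ^ 2) *
        ∫⁻ r in Ioi (0 : ℝ), ENNReal.ofReal r * f (v + r • (n : Vel))) ∂surface := by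
    refine lintegral_mono fun n => ?_
    refine (lintegral_preStar_conv_le α (norm_coe_unitSphere n) hf hg hρ hρ1 hP v).trans ?_
    rw [lintegral_ofReal_mul_scale hγ (h := fun r => f (v + r • (n : Vel))) (by fun_prop)]
  refine (mul_le_mul_right h1 _).trans ?_
  have hm : Measurable fun n : UnitSphere => ∫⁻ r in Ioi (0 : ℝ),
      ENNReal.ofReal r * f (v + r • (n : Vel)) := by
    refine Measurable.lintegral_prod_right' (ν := volume.restrict (Ioi (0 : ℝ)))
      (f := fun q : UnitSphere × ℝ => ENNReal.ofReal q.2 * f (v + q.2 • (q.1 : Vel))) ?_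
    fun_prop
  rw [lintegral_const_mul _ (by fun_prop), lintegral_const_mul _ hm, ← potential_polar hf,
    mul_left_comm, ← mul_assoc (ENNReal.ofReal _) (ENNReal.ofReal _),
    ← ENNReal.ofReal_mul (by positivity), ← mul_assoc, mul_comm P]
  gcongr
  rw [show (4 : ℝ≥0∞) = ENNReal.ofReal 4 by simp]
  apply ENNReal.ofReal_le_ofReal
  rw [show 1 / α ^ 2 * (1 / ((1 + 1 / α) / 2) ^ 2) = 4 / (1 + α) ^ 2 by field_simp; ring]
  exact div_le_self (by norm_num) (by nlinarith)

/-- The pointwise bound of the gain term by the plane integrals of one density and the Newtonian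
potential of the other, which is what the Carleman representation of the gain term yields. -/
theorem gainL_le_of_marginalLE {α : ℝ} (hα : 0 < α) {f g : Vel → ℝ≥0∞}
    (hf : Measurable f) (hg : Measurable g) (hf1 : ∀ x, f x ≠ ∞)
    (hg1 : ∫⁻ x, g x ≠ ∞) {P : ℝ≥0∞} (hP : MarginalLE g P) :
    ∀ᵐ v, gainL α f g v ≤ 4 * P * potential f v := by
  -- mollify `g` by averages over balls; Lebesgue differentiation and Fatou's lemma yield the limit
  set r : ℕ → ℝ := fun k => 1 / ((k : ℝ) + 1) with hr
  have hr0 : Tendsto r atTop (𝓝[>] 0) :=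
    tendsto_nhdsWithin_iff.2 ⟨tendsto_one_div_add_atTop_nhds_zero_nat,
      Eventually.of_forall fun k => by simp only [hr, mem_Ioi]; positivity⟩
  have hrpos : ∀ k, 0 < r k := fun k => by simp only [hr]; positivity
  set ρ : ℕ → Vel → ℝ≥0∞ := fun k =>
    (Metric.closedBall (0 : Vel) (r k)).indicator
      fun _ => (volume (Metric.closedBall (0 : Vel) (r k)))⁻¹
    with hρ
  have hρm : ∀ k, Measurable (ρ k) := fun k =>
    measurable_const.indicator Metric.isClosed_closedBall.measurableSet
  have hρ1 : ∀ k, ∫⁻ x, ρ k x ≤ 1 := by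
    intro k
    rw [hρ, lintegral_indicator_const Metric.isClosed_closedBall.measurableSet]
    exact ENNReal.inv_mul_le_one _
  have hgk : ∀ k x, ∫⁻ z, g z * ρ k (x - z) =
      (∫⁻ y in Metric.closedBall x (r k), g y) / volume (Metric.closedBall x (r k)) := by
    intro k x
    rw [← lintegral_indicator Metric.isClosed_closedBall.measurableSet, div_eq_mul_inv,
      ← lintegral_mul_const _ (hg.indicator Metric.isClosed_closedBall.measurableSet)]
    refine lintegral_congr fun z => ?_
    rw [Measure.addHaar_closedBall_center (μ := volume) x]
    by_cases hz : z ∈ Metric.closedBall x (r k)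
    · have : x - z ∈ Metric.closedBall (0 : Vel) (r k) := by
        simpa [dist_eq_norm, norm_sub_rev] using hz
      simp only [hρ, indicator_of_mem this, indicator_of_mem hz]
    · have : x - z ∉ Metric.closedBall (0 : Vel) (r k) := by
        simpa [dist_eq_norm, norm_sub_rev] using hz
      simp only [hρ, indicator_of_notMem this, indicator_of_notMem hz, mul_zero, zero_mul]
  have hlim : ∀ᵐ x, Tendsto (fun k => ∫⁻ z, g z * ρ k (x - z)) atTop (𝓝 (g x)) := by
    have := (Besicovitch.vitaliFamily (volume : Measure Vel)).ae_tendsto_lintegral_div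
      hg.aemeasurable hg1
    filter_upwards [this] with x hx
    simp only [hgk]
    exact hx.comp ((Besicovitch.tendsto_filterAt volume x).comp hr0)
  have hconv : ∀ k, Measurable fun x => ∫⁻ z, g z * ρ k (x - z) :=
    fun k => measurable_conv hg (hρm k)
  filter_upwards [ae_pre_preStar hα hlim] with v hv
  have hb := fun k => gainL_conv_le hα hf hg (hρm k) (hρ1 k) hP v
  have hc0 : ENNReal.ofReal (1 / α ^ 2) ≠ 0 := by
    rw [Ne, ENNReal.ofReal_eq_zero, not_le]; positivity
  simp only [gainL_eq_prod α hf (hconv _), mul_comm (ENNReal.ofReal (1 / α ^ 2)),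
    ← ENNReal.le_div_iff_mul_le (Or.inl hc0) (Or.inl ENNReal.ofReal_ne_top)] at hb
  rw [gainL_eq_prod α hf hg, mul_comm (ENNReal.ofReal (1 / α ^ 2)),
    ← ENNReal.le_div_iff_mul_le (Or.inl hc0) (Or.inl ENNReal.ofReal_ne_top)]
  have hFm : ∀ k, Measurable fun q : Vel × UnitSphere =>
      ENNReal.ofReal (inner ℝ (q.1 - v) (q.2 : Vel)) *
        ((∫⁻ z, g z * ρ k (preStar α v q.1 q.2 - z)) * f (pre α v q.1 q.2)) := by
    intro k
    have : Measurable fun q : Vel × UnitSphere => ∫⁻ z, g z * ρ k (preStar α v q.1 q.2 - z) :=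
      (hconv k).comp (by fun_prop : Measurable fun q : Vel × UnitSphere => preStar α v q.1 q.2)
    fun_prop
  refine le_trans (lintegral_mono_ae ?_) ((lintegral_liminf_le (u := atTop) hFm).trans
    ((liminf_le_limsup).trans (limsup_le_of_le (by isBoundedDefault) (Eventually.of_forall hb))))
  filter_upwards [hv] with q hq
  refine (Tendsto.liminf_eq ?_).ge
  refine ENNReal.Tendsto.const_mul ?_ (Or.inr ENNReal.ofReal_ne_top)
  exact ENNReal.Tendsto.mul_const hq.2 (Or.inr (hf1 _))


/-! ### The differential equation along one velocity -/

/-- Composition of a Lipschitz function with an absolutely continuous function. -/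
theorem absolutelyContinuousOnInterval_lipschitz_comp {F Ψ : ℝ → ℝ} {a b : ℝ} {K : NNReal}
    {s : Set ℝ} (hΨ : LipschitzOnWith K Ψ s) (hF : AbsolutelyContinuousOnInterval F a b)
    (hs : ∀ x ∈ uIcc a b, F x ∈ s) : AbsolutelyContinuousOnInterval (fun x => Ψ (F x)) a b := by
  rw [absolutelyContinuousOnInterval_iff] at hF ⊢
  intro ε hε
  obtain ⟨δ, hδ, h⟩ := hF (ε / (K + 1)) (by positivity)
  refine ⟨δ, hδ, fun E hE hE' => ?_⟩
  have h1 := h E hE hE'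
  calc ∑ i ∈ Finset.range E.1, dist (Ψ (F (E.2 i).1)) (Ψ (F (E.2 i).2))
      ≤ ∑ i ∈ Finset.range E.1, K * dist (F (E.2 i).1) (F (E.2 i).2) :=
        Finset.sum_le_sum fun i hi =>
          hΨ.dist_le_mul _ (hs _ (hE.1 i hi).1) _ (hs _ (hE.1 i hi).2)
    _ = K * ∑ i ∈ Finset.range E.1, dist (F (E.2 i).1) (F (E.2 i).2) := by rw [Finset.mul_sum]
    _ ≤ K * (ε / (K + 1)) := by gcongr
    _ < (K + 1) * (ε / (K + 1)) := by gcongr; linarith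
    _ = ε := by field_simp

/-- Primitives of integrable functions are absolutely continuous. -/
theorem absolutelyContinuousOnInterval_const_add_integral {q : ℝ → ℝ} {b : ℝ} (c : ℝ)
    (hq : IntervalIntegrable q volume 0 b) :
    AbsolutelyContinuousOnInterval (fun τ => c + ∫ x in (0 : ℝ)..τ, q x) 0 b := by
  have h1 := hq.absolutelyContinuousOnInterval_intervalIntegral left_mem_uIcc
  have h2 : AbsolutelyContinuousOnInterval (fun _ : ℝ => c) 0 b :=
    ((LipschitzWith.const c).lipschitzOnWith (s := uIcc 0 b)).absolutelyContinuousOnInterval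
  exact h2.add h1

/-- The chain rule for absolutely continuous functions. -/
theorem integral_deriv_comp_primitive {q Ψ Λ : ℝ → ℝ} {a b c : ℝ} (ha : 0 ≤ a) (hab : a ≤ b)
    (hq : IntervalIntegrable q volume 0 b)
    (hF : ∀ τ ∈ Icc 0 b, 0 ≤ c + ∫ x in (0 : ℝ)..τ, q x)
    (hΨ : ∀ x, 0 ≤ x → HasDerivAt Ψ (Λ x) x) (hΛ : ContinuousOn Λ (Ici 0)) :
    ∫ τ in a..b, Λ (c + ∫ x in (0 : ℝ)..τ, q x) * q τ =
      Ψ (c + ∫ x in (0 : ℝ)..b, q x) - Ψ (c + ∫ x in (0 : ℝ)..a, q x) := by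
  set F : ℝ → ℝ := fun τ => c + ∫ x in (0 : ℝ)..τ, q x with hFdef
  have hb : 0 ≤ b := ha.trans hab
  have hsub : uIcc a b ⊆ uIcc 0 b := by
    rw [uIcc_of_le hab, uIcc_of_le hb]; exact Icc_subset_Icc_left ha
  have hFAC : AbsolutelyContinuousOnInterval F 0 b :=
    absolutelyContinuousOnInterval_const_add_integral c hq
  obtain ⟨R, hR⟩ := hFAC.exists_bound
  have hmem : ∀ τ ∈ uIcc 0 b, F τ ∈ Icc 0 R := by
    intro τ hτ
    have h1 := hR τ hτ
    rw [uIcc_of_le hb] at hτ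
    exact ⟨hF τ hτ, (le_abs_self _).trans h1⟩
  obtain ⟨K, hK⟩ := isCompact_Icc.exists_bound_of_continuousOn
    (hΛ.mono (fun x hx => hx.1 : Icc 0 R ⊆ Ici 0))
  have hLip : LipschitzOnWith (Real.toNNReal K) Ψ (Icc 0 R) := by
    refine Convex.lipschitzOnWith_of_nnnorm_hasDerivWithin_le (convex_Icc 0 R)
      (fun x hx => (hΨ x hx.1).hasDerivWithinAt) fun x hx => ?_
    rw [← NNReal.coe_le_coe, coe_nnnorm]
    exact (hK x hx).trans (Real.le_coe_toNNReal K)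
  have hAC := (absolutelyContinuousOnInterval_lipschitz_comp hLip hFAC hmem).mono hsub
  rw [← hAC.integral_deriv_eq_sub]
  refine intervalIntegral.integral_congr_ae ?_
  filter_upwards [hq.ae_hasDerivAt_integral] with τ hτ hτ'
  have hτ0 : τ ∈ uIcc 0 b := hsub (uIoc_subset_uIcc hτ')
  have h1 : HasDerivAt F (q τ) τ := (hτ hτ0 0 left_mem_uIcc).const_add c
  exact ((hΨ (F τ) (hmem τ hτ0).1).comp τ h1).deriv.symm

/-- Duhamel's inequality for absolutely continuous functions. -/
theorem primitive_le_duhamel {q p : ℝ → ℝ} {b c r : ℝ} (hb : 0 ≤ b)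
    (hq : IntervalIntegrable q volume 0 b) (hp : IntervalIntegrable p volume 0 b)
    (hle : ∀ᵐ τ, τ ∈ Ioc 0 b → q τ ≤ p τ - r * (c + ∫ x in (0 : ℝ)..τ, q x)) :
    c + ∫ x in (0 : ℝ)..b, q x ≤
      Real.exp (-(r * b)) * c + ∫ τ in (0 : ℝ)..b, Real.exp (-(r * (b - τ))) * p τ := by
  set F : ℝ → ℝ := fun τ => c + ∫ x in (0 : ℝ)..τ, q x with hFdef
  have hFAC : AbsolutelyContinuousOnInterval F 0 b :=
    absolutelyContinuousOnInterval_const_add_integral c hq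
  set E : ℝ → ℝ := fun τ => Real.exp (-(r * (b - τ))) with hE
  have hEd : ∀ τ, HasDerivAt E (r * E τ) τ := by
    intro τ
    have h1 : HasDerivAt (fun τ : ℝ => -(r * (b - τ))) r τ := by
      have := (((hasDerivAt_id τ).const_sub b).const_mul r).fun_neg
      simpa using this
    have := h1.exp
    rwa [mul_comm] at this
  have hEc : Continuous E := by simp only [hE]; fun_prop
  have hEAC : AbsolutelyContinuousOnInterval E 0 b := by
    have : ContDiff ℝ 1 E := by simp only [hE]; fun_prop
    exact this.contDiffOn.absolutelyContinuousOnInterval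
  have hAC := hEAC.mul hFAC
  have h1 := hAC.integral_deriv_eq_sub
  have h2 : ∫ τ in (0 : ℝ)..b, deriv (E * F) τ ≤ ∫ τ in (0 : ℝ)..b, E τ * p τ := by
    refine intervalIntegral.integral_mono_ae_restrict hb hAC.intervalIntegrable_deriv
      (hp.continuousOn_mul hEc.continuousOn) ?_
    rw [EventuallyLE, restrict_Ioc_eq_restrict_Icc.symm, ae_restrict_iff' measurableSet_Ioc]
    filter_upwards [hq.ae_hasDerivAt_integral, hle] with τ hτ hτ2 hτ'
    have hτ0 : τ ∈ uIcc 0 b := by rw [uIcc_of_le hb]; exact Ioc_subset_Icc_self hτ'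
    have hF1 : HasDerivAt F (q τ) τ := (hτ hτ0 0 left_mem_uIcc).const_add c
    rw [((hEd τ).mul hF1).deriv]
    have h3 := hτ2 hτ'
    have h4 : 0 < E τ := Real.exp_pos _
    nlinarith
  rw [h1] at h2
  simp only [Pi.mul_apply, hE, hFdef, sub_self, mul_zero, neg_zero, Real.exp_zero, one_mul,
    intervalIntegral.integral_same, add_zero, sub_zero] at h2
  linarith

/-- The data along one velocity: `y` is a nonnegative solution of `y' = G - D`, in integrated form,
where the gain `G` and the loss `D` are integrable in time and `q` is a real-valued version of
`G - D`. The equation is required for almost every time only. -/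
structure IsTrajectory (y : ℝ → ℝ) (G D : ℝ → ℝ≥0∞) (q : ℝ → ℝ) : Prop where
  measurable_gain : Measurable G
  measurable_loss : Measurable D
  gain_ne_top : ∀ b, ∫⁻ τ in Ioc 0 b, G τ ≠ ∞
  loss_ne_top : ∀ b, ∫⁻ τ in Ioc 0 b, D τ ≠ ∞
  nonneg_zero : 0 ≤ y 0
  nonneg : ∀ᵐ τ, 0 < τ → 0 ≤ y τ
  rate : ∀ᵐ τ, 0 < τ → q τ = (G τ).toReal - (D τ).toReal
  eq : ∀ᵐ τ, 0 < τ → y τ = y 0 + ∫ x in (0 : ℝ)..τ, q x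

namespace IsTrajectory

variable {y : ℝ → ℝ} {G D : ℝ → ℝ≥0∞} {q : ℝ → ℝ}

theorem gain_integrable (h : IsTrajectory y G D q) {b : ℝ} (hb : 0 ≤ b) :
    IntervalIntegrable (fun τ => (G τ).toReal) volume 0 b := by
  rw [intervalIntegrable_iff_integrableOn_Ioc_of_le hb]
  exact integrable_toReal_of_lintegral_ne_top h.measurable_gain.aemeasurable (h.gain_ne_top b)

theorem loss_integrable (h : IsTrajectory y G D q) {b : ℝ} (hb : 0 ≤ b) :
    IntervalIntegrable (fun τ => (D τ).toReal) volume 0 b := by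
  rw [intervalIntegrable_iff_integrableOn_Ioc_of_le hb]
  exact integrable_toReal_of_lintegral_ne_top h.measurable_loss.aemeasurable (h.loss_ne_top b)

theorem rate_integrable (h : IsTrajectory y G D q) {b : ℝ} (hb : 0 ≤ b) :
    IntervalIntegrable q volume 0 b := by
  refine ((h.gain_integrable hb).sub (h.loss_integrable hb)).congr_ae ?_
  rw [uIoc_of_le hb, EventuallyEq, ae_restrict_iff' measurableSet_Ioc]
  filter_upwards [h.rate] with τ hτ hτ'
  exact (hτ hτ'.1).symm

theorem primitive_nonneg (h : IsTrajectory y G D q) {τ : ℝ} (hτ : 0 ≤ τ) :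
    0 ≤ y 0 + ∫ x in (0 : ℝ)..τ, q x := by
  rcases hτ.eq_or_lt with rfl | hτ
  · simpa using h.nonneg_zero
  by_contra! hneg
  have hb : (0 : ℝ) ≤ τ + 1 := by linarith
  have hc := (absolutelyContinuousOnInterval_const_add_integral (y 0)
    (h.rate_integrable hb)).continuousOn
  rw [uIcc_of_le hb] at hc
  have hca : ContinuousAt (fun τ => y 0 + ∫ x in (0 : ℝ)..τ, q x) τ :=
    hc.continuousAt (Icc_mem_nhds hτ (by linarith))
  have hev : ∀ᶠ x in 𝓝 τ, (y 0 + ∫ x in (0 : ℝ)..x, q x) < 0 ∧ 0 < x :=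
    (hca.eventually (gt_mem_nhds hneg)).and (lt_mem_nhds hτ)
  have hd : Dense {x : ℝ | (0 < x → 0 ≤ y x) ∧ (0 < x → y x = y 0 + ∫ x in (0 : ℝ)..x, q x)} :=
    Measure.dense_of_ae (μ := volume) (h.nonneg.and h.eq)
  obtain ⟨U, hU, hUo, hτU⟩ := eventually_nhds_iff.1 hev
  obtain ⟨x, hxU, hx⟩ := hd.inter_open_nonempty U hUo ⟨τ, hτU⟩
  have h1 := hU x hxU
  have h2 := hx.1 h1.2
  rw [hx.2 h1.2] at h2
  linarith

theorem lintegral_mul_ofReal {H : ℝ → ℝ≥0∞} {k : ℝ → ℝ} {a b : ℝ} (hab : a ≤ b)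
    (hH : Measurable H) (hH1 : ∫⁻ τ in Ioc a b, H τ ≠ ∞)
    (hk : ∀ᵐ τ ∂volume.restrict (Ioc a b), 0 ≤ k τ)
    (hi : IntervalIntegrable (fun τ => k τ * (H τ).toReal) volume a b) :
    ∫⁻ τ in Ioc a b, H τ * ENNReal.ofReal (k τ) =
      ENNReal.ofReal (∫ τ in a..b, k τ * (H τ).toReal) := by
  rw [intervalIntegral.integral_of_le hab, ofReal_integral_eq_lintegral_ofReal]
  · refine lintegral_congr_ae ?_
    filter_upwards [hk, ae_lt_top hH hH1] with τ h1 h2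
    rw [ENNReal.ofReal_mul h1, ENNReal.ofReal_toReal h2.ne, mul_comm]
  · exact (intervalIntegrable_iff_integrableOn_Ioc_of_le hab).1 hi
  · filter_upwards [hk] with τ h1
    exact mul_nonneg h1 ENNReal.toReal_nonneg

/-- The renormalised balance law: for a `C¹` function `Ψ ≥ 0` with derivative `Λ ≥ 0`, the change
of `Ψ(y)` is the gain minus the loss, both weighted with `Λ(y)`. -/
theorem balance (h : IsTrajectory y G D q) {a b : ℝ} (ha : 0 ≤ a) (hab : a ≤ b)
    (hya : y a = y 0 + ∫ x in (0 : ℝ)..a, q x) (hyb : y b = y 0 + ∫ x in (0 : ℝ)..b, q x)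
    {Ψ Λ : ℝ → ℝ} (hΨ : ∀ x, 0 ≤ x → HasDerivAt Ψ (Λ x) x) (hΛ : ContinuousOn Λ (Ici 0))
    (hΨ0 : ∀ x, 0 ≤ x → 0 ≤ Ψ x) (hΛ0 : ∀ x, 0 ≤ x → 0 ≤ Λ x) :
    ENNReal.ofReal (Ψ (y b)) + ∫⁻ τ in Ioc a b, D τ * ENNReal.ofReal (Λ (y τ)) =
      ENNReal.ofReal (Ψ (y a)) + ∫⁻ τ in Ioc a b, G τ * ENNReal.ofReal (Λ (y τ)) := by
  have hb : 0 ≤ b := ha.trans hab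
  have hq := h.rate_integrable hb
  have hchain := integral_deriv_comp_primitive ha hab hq
    (fun τ hτ => h.primitive_nonneg hτ.1) hΨ hΛ
  rw [← hya, ← hyb] at hchain
  set F : ℝ → ℝ := fun τ => y 0 + ∫ x in (0 : ℝ)..τ, q x with hF
  have hsub : uIcc a b ⊆ uIcc 0 b := by
    rw [uIcc_of_le hab, uIcc_of_le hb]; exact Icc_subset_Icc_left ha
  have hFc : ContinuousOn F (uIcc a b) :=
    (absolutelyContinuousOnInterval_const_add_integral (y 0) hq).continuousOn.mono hsub
  have hΛF : ContinuousOn (fun τ => Λ (F τ)) (uIcc a b) := by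
    refine hΛ.comp hFc fun τ hτ => h.primitive_nonneg ?_
    rw [uIcc_of_le hab] at hτ
    exact ha.trans hτ.1
  have hGi : IntervalIntegrable (fun τ => Λ (F τ) * (G τ).toReal) volume a b :=
    ((h.gain_integrable hb).mono_set hsub).continuousOn_mul hΛF
  have hDi : IntervalIntegrable (fun τ => Λ (F τ) * (D τ).toReal) volume a b :=
    ((h.loss_integrable hb).mono_set hsub).continuousOn_mul hΛF
  have hI : Ioc a b ⊆ Ioc 0 b := Ioc_subset_Ioc_left ha
  have hpos : ∀ᵐ τ ∂volume.restrict (Ioc a b), 0 ≤ Λ (F τ) := by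
    filter_upwards [ae_restrict_mem measurableSet_Ioc] with τ hτ
    exact hΛ0 _ (h.primitive_nonneg (ha.trans hτ.1.le))
  have hcongr : ∀ H : ℝ → ℝ≥0∞, ∫⁻ τ in Ioc a b, H τ * ENNReal.ofReal (Λ (y τ)) =
      ∫⁻ τ in Ioc a b, H τ * ENNReal.ofReal (Λ (F τ)) := by
    intro H
    refine lintegral_congr_ae ?_
    rw [EventuallyEq, ae_restrict_iff' measurableSet_Ioc]
    filter_upwards [h.eq] with τ hτ hτ'
    rw [hτ (ha.trans_lt hτ'.1)]
  rw [hcongr, hcongr,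
    lintegral_mul_ofReal hab h.measurable_gain
      (ne_top_of_le_ne_top (h.gain_ne_top b) (lintegral_mono_set hI)) hpos hGi,
    lintegral_mul_ofReal hab h.measurable_loss
      (ne_top_of_le_ne_top (h.loss_ne_top b) (lintegral_mono_set hI)) hpos hDi]
  have hGn : 0 ≤ ∫ τ in a..b, Λ (F τ) * (G τ).toReal := by
    refine intervalIntegral.integral_nonneg hab fun τ hτ => ?_
    exact mul_nonneg (hΛ0 _ (h.primitive_nonneg (ha.trans hτ.1))) ENNReal.toReal_nonneg
  have hDn : 0 ≤ ∫ τ in a..b, Λ (F τ) * (D τ).toReal := by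
    refine intervalIntegral.integral_nonneg hab fun τ hτ => ?_
    exact mul_nonneg (hΛ0 _ (h.primitive_nonneg (ha.trans hτ.1))) ENNReal.toReal_nonneg
  have hya0 : 0 ≤ y a := by rw [hya]; exact h.primitive_nonneg ha
  have hyb0 : 0 ≤ y b := by rw [hyb]; exact h.primitive_nonneg hb
  rw [← ENNReal.ofReal_add (hΨ0 _ hyb0) hDn, ← ENNReal.ofReal_add (hΨ0 _ hya0) hGn]
  congr 1
  have hsplit : ∫ τ in a..b, Λ (F τ) * q τ =
      (∫ τ in a..b, Λ (F τ) * (G τ).toReal) - ∫ τ in a..b, Λ (F τ) * (D τ).toReal := by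
    rw [← intervalIntegral.integral_sub hGi hDi]
    refine intervalIntegral.integral_congr_ae ?_
    rw [uIoc_of_le hab]
    filter_upwards [h.rate] with τ hτ hτ'
    rw [hτ (ha.trans_lt hτ'.1)]
    ring
  have : (∫ τ in a..b, Λ (F τ) * q τ) = Ψ (y b) - Ψ (y a) := hchain
  linarith

/-- Duhamel's inequality along a trajectory whose loss rate is at least `r`. -/
theorem le_duhamel (h : IsTrajectory y G D q) {b r : ℝ} (hb : 0 ≤ b)
    (hyb : y b = y 0 + ∫ x in (0 : ℝ)..b, q x)
    (hr : 0 ≤ r) (hD : ∀ᵐ τ, τ ∈ Ioc 0 b → ENNReal.ofReal (r * y τ) ≤ D τ) :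
    ENNReal.ofReal (y b) ≤ ENNReal.ofReal (y 0) +
      ∫⁻ τ in Ioc 0 b, G τ * ENNReal.ofReal (Real.exp (-(r * (b - τ)))) := by
  have hp := h.gain_integrable hb
  have hq := h.rate_integrable hb
  have key := primitive_le_duhamel (c := y 0) (r := r) hb hq hp ?_
  · have hi : IntervalIntegrable (fun τ => Real.exp (-(r * (b - τ))) * (G τ).toReal) volume 0 b :=
      hp.continuousOn_mul (by fun_prop)
    rw [lintegral_mul_ofReal hb h.measurable_gain (h.gain_ne_top b)
      (Eventually.of_forall fun τ => (Real.exp_pos _).le) hi,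
      ← ENNReal.ofReal_add h.nonneg_zero
        (intervalIntegral.integral_nonneg hb fun τ _ =>
          mul_nonneg (Real.exp_pos _).le ENNReal.toReal_nonneg)]
    apply ENNReal.ofReal_le_ofReal
    rw [hyb]
    refine key.trans ?_
    gcongr
    refine mul_le_of_le_one_left h.nonneg_zero ?_
    rw [Real.exp_le_one_iff]
    have := mul_nonneg hr hb
    linarith
  · have hfin : ∀ᵐ τ, τ ∈ Ioc 0 b → D τ < ∞ := by
      rw [← ae_restrict_iff' measurableSet_Ioc]
      exact ae_lt_top h.measurable_loss (h.loss_ne_top b)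
    filter_upwards [h.rate, h.eq, hD, hfin] with τ h1 h2 h3 h4 hτ
    rw [← h2 hτ.1, h1 hτ.1]
    have := (ENNReal.ofReal_le_iff_le_toReal (h4 hτ).ne).1 (h3 hτ)
    linarith

end IsTrajectory


/-! ### Solutions as families of trajectories -/

/-- The density at time `t` as a `[0,∞]`-valued function. -/
noncomputable def dens (f : ℝ → Vel → ℝ) (t : ℝ) (v : Vel) : ℝ≥0∞ := ENNReal.ofReal (f t v)

section JointMeasurability

variable {X : Type*} [MeasurableSpace X]

theorem measurable_gainL_param {g : X → Vel → ℝ≥0∞} (hg : Measurable (Function.uncurry g))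
    (α : ℝ) : Measurable fun p : X × Vel => gainL α (g p.1) (g p.1) p.2 := by
  have h1 : Measurable fun r : ((X × Vel) × Vel) × UnitSphere =>
      ENNReal.ofReal (inner ℝ (r.1.2 - r.1.1.2) (r.2 : Vel)) *
        (g r.1.1.1 (preStar α r.1.1.2 r.1.2 r.2) * g r.1.1.1 (pre α r.1.1.2 r.1.2 r.2)) := by
    refine Measurable.mul (by fun_prop) (Measurable.mul ?_ ?_)
    · exact hg.comp (by fun_prop : Measurable fun r : ((X × Vel) × Vel) × UnitSphere =>
        (r.1.1.1, preStar α r.1.1.2 r.1.2 r.2))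
    · exact hg.comp (by fun_prop : Measurable fun r : ((X × Vel) × Vel) × UnitSphere =>
        (r.1.1.1, pre α r.1.1.2 r.1.2 r.2))
  have h2 : Measurable fun r : (X × Vel) × Vel => ∫⁻ n : UnitSphere,
      ENNReal.ofReal (inner ℝ (r.2 - r.1.2) (n : Vel)) *
        (g r.1.1 (preStar α r.1.2 r.2 n) * g r.1.1 (pre α r.1.2 r.2 n)) ∂surface :=
    h1.lintegral_prod_right'
  exact (h2.lintegral_prod_right').const_mul _

theorem measurable_lossL_param {g : X → Vel → ℝ≥0∞} (hg : Measurable (Function.uncurry g)) :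
    Measurable fun p : X × Vel => lossL (g p.1) p.2 := by
  have h1 : Measurable fun r : (X × Vel) × Vel =>
      ENNReal.ofReal (Real.pi * ‖r.1.2 - r.2‖) * g r.1.1 r.2 :=
    Measurable.mul (by fun_prop)
      (hg.comp (by fun_prop : Measurable fun r : (X × Vel) × Vel => (r.1.1, r.2)))
  exact h1.lintegral_prod_right'

theorem measurableSet_hemisphere_param :
    MeasurableSet {r : ((X × Vel) × Vel) × UnitSphere | r.2 ∈ hemisphere r.1.1.2 r.1.2} := by
  have : Measurable fun r : ((X × Vel) × Vel) × UnitSphere =>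
      inner ℝ (r.1.2 - r.1.1.2) (r.2 : Vel) := by fun_prop
  exact measurableSet_le measurable_const this

theorem measurableSet_hemisphere (v vs : Vel) : MeasurableSet (hemisphere v vs) := by
  have : Measurable fun n : UnitSphere => inner ℝ (vs - v) (n : Vel) := by fun_prop
  exact measurableSet_le measurable_const this

theorem measurable_collision_param {f : X → Vel → ℝ} (hf : Measurable (Function.uncurry f))
    (α : ℝ) : Measurable fun p : X × Vel => collision α (f p.1) p.2 := by
  have hin : ∀ (k : ((X × Vel) × Vel) × UnitSphere → ℝ), Measurable k →
      Measurable fun r : X × Vel => ∫ vs : Vel, ∫ n in hemisphere r.2 vs, k ((r, vs), n)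
        ∂surface := by
    intro k hk
    have h1 : StronglyMeasurable
        ({r : ((X × Vel) × Vel) × UnitSphere | r.2 ∈ hemisphere r.1.1.2 r.1.2}.indicator k) :=
      (hk.indicator measurableSet_hemisphere_param).stronglyMeasurable
    have h2 := (h1.integral_prod_right' (ν := surface)).integral_prod_right'
      (ν := (volume : Measure Vel))
    convert h2.measurable using 4 with r vs
    rw [← integral_indicator (measurableSet_hemisphere _ _)]
    rfl
  have hgain : Measurable fun p : X × Vel => gain α (f p.1) p.2 := by
    refine (hin (fun r => |inner ℝ (r.1.1.2 - r.1.2) (r.2 : Vel)| *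
      f r.1.1.1 (preStar α r.1.1.2 r.1.2 r.2) * f r.1.1.1 (pre α r.1.1.2 r.1.2 r.2)) ?_).const_mul _
    refine Measurable.mul (Measurable.mul (by fun_prop) ?_) ?_
    · exact hf.comp (by fun_prop : Measurable fun r : ((X × Vel) × Vel) × UnitSphere =>
        (r.1.1.1, preStar α r.1.1.2 r.1.2 r.2))
    · exact hf.comp (by fun_prop : Measurable fun r : ((X × Vel) × Vel) × UnitSphere =>
        (r.1.1.1, pre α r.1.1.2 r.1.2 r.2))
  have hloss : Measurable fun p : X × Vel => lossRate (f p.1) p.2 := by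
    refine hin (fun r => |inner ℝ (r.1.1.2 - r.1.2) (r.2 : Vel)| * f r.1.1.1 r.1.2) ?_
    refine Measurable.mul (by fun_prop) ?_
    exact hf.comp (by fun_prop : Measurable fun r : ((X × Vel) × Vel) × UnitSphere =>
        (r.1.1.1, r.1.2))
  exact hgain.sub (hf.mul hloss)

end JointMeasurability

/-- The integral over the half sphere as an integral over the sphere with the positive part of the
kernel. -/
theorem setLIntegral_hemisphere (v vs : Vel) (F : UnitSphere → ℝ≥0∞) :
    ∫⁻ n in hemisphere v vs, ENNReal.ofReal |inner ℝ (v - vs) (n : Vel)| * F n ∂surface =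
      ∫⁻ n : UnitSphere, ENNReal.ofReal (inner ℝ (vs - v) (n : Vel)) * F n ∂surface := by
  rw [← lintegral_indicator (measurableSet_hemisphere v vs)]
  refine lintegral_congr fun n => ?_
  by_cases hn : n ∈ hemisphere v vs
  · have h0 : 0 ≤ inner ℝ (vs - v) (n : Vel) := hn
    rw [indicator_of_mem hn, ← neg_sub vs v, inner_neg_left, abs_neg, abs_of_nonneg h0]
  · have h0 : inner ℝ (vs - v) (n : Vel) ≤ 0 := (not_le.1 hn).le
    rw [indicator_of_notMem hn, ENNReal.ofReal_of_nonpos h0, zero_mul]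

/-- The loss frequency agrees with its `[0,∞]`-valued version. -/
theorem lossRate_eq_toReal {φ : Vel → ℝ} (hφ : Measurable φ) (h0 : ∀ᵐ v, 0 ≤ φ v) {v : Vel}
    (hfin : lossL (fun w => ENNReal.ofReal (φ w)) v ≠ ∞) :
    lossRate φ v = (lossL (fun w => ENNReal.ofReal (φ w)) v).toReal := by
  have h1 : ∀ vs, 0 ≤ φ vs → ∫ n in hemisphere v vs, |inner ℝ (v - vs) (n : Vel)| * φ vs ∂surface =
      (ENNReal.ofReal (Real.pi * ‖v - vs‖) * ENNReal.ofReal (φ vs)).toReal := by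
    intro vs hvs
    rw [integral_eq_lintegral_of_nonneg_ae (Eventually.of_forall fun n => by
      exact mul_nonneg (abs_nonneg _) hvs) (by
        exact (by fun_prop : Measurable fun n : UnitSphere =>
          |inner ℝ (v - vs) (n : Vel)| * φ vs).aestronglyMeasurable)]
    congr 1
    simp only [ENNReal.ofReal_mul (abs_nonneg _)]
    rw [setLIntegral_hemisphere v vs (fun _ => ENNReal.ofReal (φ vs)),
      lintegral_mul_const _ (by fun_prop), lintegral_surface_inner_pos, norm_sub_rev]
  rw [lossRate, lossL]
  have hm : Measurable fun vs => ENNReal.ofReal (Real.pi * ‖v - vs‖) * ENNReal.ofReal (φ vs) := by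
    fun_prop
  rw [← integral_toReal hm.aemeasurable (ae_lt_top hm hfin)]
  refine integral_congr_ae ?_
  filter_upwards [h0] with vs hvs
  exact h1 vs hvs

/-- The gain term agrees with its `[0,∞]`-valued version. -/
theorem gain_eq_toReal {α : ℝ} (hα : 0 < α) {φ : Vel → ℝ} (hφ : Measurable φ)
    (h0 : ∀ᵐ v, 0 ≤ φ v) :
    ∀ᵐ v, gainL α (fun w => ENNReal.ofReal (φ w)) (fun w => ENNReal.ofReal (φ w)) v ≠ ∞ →
      gain α φ v =
        (gainL α (fun w => ENNReal.ofReal (φ w)) (fun w => ENNReal.ofReal (φ w)) v).toReal := by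
  filter_upwards [ae_pre_preStar hα h0] with v hv hfin
  have hv' := Measure.ae_ae_of_ae_prod hv
  set H : Vel → ℝ≥0∞ := fun vs => ∫⁻ n : UnitSphere, ENNReal.ofReal (inner ℝ (vs - v) (n : Vel)) *
      (ENNReal.ofReal (φ (preStar α v vs n)) * ENNReal.ofReal (φ (pre α v vs n))) ∂surface with hH
  have hHm : Measurable H := by
    have : Measurable fun q : Vel × UnitSphere => ENNReal.ofReal (inner ℝ (q.1 - v) (q.2 : Vel)) *
      (ENNReal.ofReal (φ (preStar α v q.1 q.2)) * ENNReal.ofReal (φ (pre α v q.1 q.2))) := by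
      fun_prop
    exact this.lintegral_prod_right'
  have hdef : gainL α (fun w => ENNReal.ofReal (φ w)) (fun w => ENNReal.ofReal (φ w)) v =
      ENNReal.ofReal (1 / α ^ 2) * ∫⁻ vs, H vs := rfl
  rw [hdef] at hfin ⊢
  have hc : ENNReal.ofReal (1 / α ^ 2) ≠ 0 := by
    rw [Ne, ENNReal.ofReal_eq_zero, not_le]; positivity
  have hHfin : ∫⁻ vs, H vs ≠ ∞ := fun h => hfin (by rw [h, ENNReal.mul_top hc])
  rw [ENNReal.toReal_mul, ENNReal.toReal_ofReal (by positivity), gain,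
    ← integral_toReal hHm.aemeasurable (ae_lt_top hHm hHfin)]
  congr 1
  refine integral_congr_ae ?_
  filter_upwards [hv'] with vs hvs
  have hnn : 0 ≤ᵐ[surface.restrict (hemisphere v vs)] fun n : UnitSphere =>
      |inner ℝ (v - vs) (n : Vel)| * φ (preStar α v vs n) * φ (pre α v vs n) := by
    refine ae_restrict_of_ae ?_
    filter_upwards [hvs] with n hn
    exact mul_nonneg (mul_nonneg (abs_nonneg _) hn.2) hn.1
  rw [integral_eq_lintegral_of_nonneg_ae hnn
    (by fun_prop : Measurable fun n : UnitSphere => |inner ℝ (v - vs) (n : Vel)| *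
      φ (preStar α v vs n) * φ (pre α v vs n)).aestronglyMeasurable]
  congr 1
  simp only [hH]
  rw [← setLIntegral_hemisphere v vs (fun n : UnitSphere => ENNReal.ofReal (φ (preStar α v vs n)) *
    ENNReal.ofReal (φ (pre α v vs n)))]
  refine lintegral_congr_ae (ae_restrict_of_ae ?_)
  filter_upwards [hvs] with n hn
  rw [ENNReal.ofReal_mul (mul_nonneg (abs_nonneg _) hn.2), ENNReal.ofReal_mul (abs_nonneg _),
    mul_assoc]

theorem lintegral_mul_le_weightedNorm (f : ℝ → Vel → ℝ) (t s : ℝ) :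
    ∫⁻ v, dens f t v * ENNReal.ofReal ((1 + ‖v‖ ^ 2) ^ (s / 2)) ≤ weightedNorm 1 s (f t) := by
  rw [weightedNorm, eLpNorm_one_eq_lintegral_enorm]
  refine lintegral_mono fun v => ?_
  rw [enorm_mul, dens]
  gcongr
  · exact Real.ofReal_le_enorm _
  · exact Real.ofReal_le_enorm _

/-- Collision rates are bounded by the product of the second moments. -/
theorem lintegral_mul_lossL_le {g k : Vel → ℝ≥0∞} (hg : Measurable g) (hk : Measurable k) :
    ∫⁻ v, g v * lossL k v ≤ ENNReal.ofReal Real.pi *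
      ((∫⁻ v, g v * ENNReal.ofReal (1 + ‖v‖ ^ 2)) * ∫⁻ v, k v * ENNReal.ofReal (1 + ‖v‖ ^ 2)) := by
  set M := ∫⁻ v, k v * ENNReal.ofReal (1 + ‖v‖ ^ 2) with hM
  have h1 : ∀ v, lossL k v ≤ ENNReal.ofReal Real.pi * (ENNReal.ofReal (1 + ‖v‖ ^ 2) * M) := by
    intro v
    rw [lossL, hM, ← lintegral_const_mul _ (by fun_prop), ← lintegral_const_mul _ (by fun_prop)]
    refine lintegral_mono fun w => ?_
    rw [ENNReal.ofReal_mul Real.pi_pos.le, mul_assoc]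
    refine mul_le_mul_right ?_ _
    rw [mul_left_comm, ← ENNReal.ofReal_mul (by positivity), mul_comm]
    refine mul_le_mul_right (ENNReal.ofReal_le_ofReal ?_) _
    have := norm_sub_le v w
    nlinarith [sq_nonneg (‖v‖ - 1), sq_nonneg (‖w‖ - 1), sq_nonneg (‖v‖ * ‖w‖),
      norm_nonneg v, norm_nonneg w]
  calc ∫⁻ v, g v * lossL k v
      ≤ ∫⁻ v, ENNReal.ofReal Real.pi * (M * (g v * ENNReal.ofReal (1 + ‖v‖ ^ 2))) := by
        refine lintegral_mono fun v => ?_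
        refine (mul_le_mul_right (h1 v) _).trans (le_of_eq ?_)
        ring
    _ = _ := by
        rw [lintegral_const_mul _ (by fun_prop), lintegral_const_mul _ (by fun_prop), mul_comm M]

/-- The total collision frequency is bounded by the square of the second moment. -/
theorem lintegral_lossL_le {g : Vel → ℝ≥0∞} (hg : Measurable g) :
    ∫⁻ v, g v * lossL g v ≤
      ENNReal.ofReal Real.pi * (∫⁻ v, g v * ENNReal.ofReal (1 + ‖v‖ ^ 2)) ^ 2 := by
  rw [sq]
  exact lintegral_mul_lossL_le hg hg

/-- Gain and loss have the same total mass. -/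
theorem lintegral_gainL_eq {α : ℝ} (hα : 0 < α) {g : Vel → ℝ≥0∞} (hg : Measurable g) :
    ∫⁻ v, gainL α g g v = ∫⁻ v, g v * lossL g v := by
  have h1 := two_mul_lintegral_gainL_mul hα hg (ψ := fun _ => 1) measurable_const
  have h2 := two_mul_lintegral_lossL_mul hg (ψ := fun _ => 1) measurable_const
  rw [← h2] at h1
  simp only [mul_one] at h1
  exact (ENNReal.mul_right_inj (by norm_num) (by norm_num)).1 h1

/-- Exchange of quantifiers: a property that holds at each time for almost every velocity holds
along almost every velocity for almost every time. -/
theorem ae_ae_of_forall_pos {p : ℝ → Vel → Prop} (hm : MeasurableSet {x : ℝ × Vel | p x.1 x.2})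
    (h : ∀ t, 0 ≤ t → ∀ᵐ v, p t v) : ∀ᵐ v, ∀ᵐ t, 0 < t → p t v := by
  have h1 : ∀ᵐ t ∂(volume.restrict (Ioi (0 : ℝ))), ∀ᵐ v, p t v := by
    filter_upwards [ae_restrict_mem measurableSet_Ioi] with t ht
    exact h t (le_of_lt ht)
  filter_upwards [(Measure.ae_ae_comm hm).1 h1] with v hv
  exact (ae_restrict_iff' measurableSet_Ioi).1 hv

namespace IsSolution

variable {α : ℝ} {f₀ : Vel → ℝ} {f : ℝ → Vel → ℝ}

theorem measurable_dens_uncurry (h : IsSolution α f₀ f) :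
    Measurable (Function.uncurry (dens f)) := h.measurable.ennreal_ofReal

theorem measurable_slice (h : IsSolution α f₀ f) (t : ℝ) : Measurable (f t) :=
  h.measurable.of_uncurry_left

theorem measurable_dens (h : IsSolution α f₀ f) (t : ℝ) : Measurable (dens f t) :=
  (h.measurable_slice t).ennreal_ofReal

/-- The second moment is bounded on bounded time intervals. -/
theorem exists_moment_bound (h : IsSolution α f₀ f) (T : ℝ) : ∃ C : ℝ≥0∞, C ≠ ∞ ∧
    ∀ t ∈ Icc 0 T, ∫⁻ v, dens f t v * ENNReal.ofReal (1 + ‖v‖ ^ 2) ≤ C := by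
  suffices H : ∃ C : ℝ≥0∞, C ≠ ∞ ∧ ∀ t ∈ Icc 0 T, weightedNorm 1 2 (f t) ≤ C by
    obtain ⟨C, hC, hC'⟩ := H
    refine ⟨C, hC, fun t ht => le_trans ?_ (hC' t ht)⟩
    have := lintegral_mul_le_weightedNorm f t 2
    simpa using this
  refine isCompact_Icc.induction_on (p := fun s => ∃ C : ℝ≥0∞, C ≠ ∞ ∧ ∀ t ∈ s,
    weightedNorm 1 2 (f t) ≤ C) ⟨0, by simp, by simp⟩ ?_ ?_ ?_
  · rintro s t hst ⟨C, hC, hC'⟩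
    exact ⟨C, hC, fun x hx => hC' x (hst hx)⟩
  · rintro s t ⟨C, hC, hC'⟩ ⟨D, hD, hD'⟩
    refine ⟨C + D, ENNReal.add_ne_top.2 ⟨hC, hD⟩, ?_⟩
    rintro x (hx | hx)
    · exact (hC' x hx).trans le_self_add
    · exact (hD' x hx).trans le_add_self
  · intro t ht
    have h1 := (h.continuousL12 t ht.1).eventually (gt_mem_nhds (zero_lt_one' ℝ≥0∞))
    refine ⟨{τ | weightedNorm 1 2 (f τ - f t) < 1}, nhdsWithin_mono t Icc_subset_Ici_self h1,
      1 + weightedNorm 1 2 (f t), ?_, ?_⟩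
    · exact ENNReal.add_ne_top.2 ⟨by simp, (h.memL12 t ht.1).2.ne⟩
    · intro τ hτ
      have hτ' : weightedNorm 1 2 (f τ - f t) < 1 := hτ
      have hmτ := h.measurable_slice τ
      have hmt := h.measurable_slice t
      have key : weightedNorm 1 2 (f τ) ≤
          weightedNorm 1 2 (f τ - f t) + weightedNorm 1 2 (f t) := by
        have := eLpNorm_add_le (μ := (volume : Measure Vel)) (p := 1)
          (f := fun v : Vel => (f τ - f t) v * (1 + ‖v‖ ^ 2) ^ ((2 : ℝ) / 2))
          (g := fun v : Vel => f t v * (1 + ‖v‖ ^ 2) ^ ((2 : ℝ) / 2))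
          (by exact (by fun_prop : Measurable fun v : Vel =>
            (f τ v - f t v) * (1 + ‖v‖ ^ 2) ^ ((2 : ℝ) / 2)).aestronglyMeasurable)
          (by exact (by fun_prop : Measurable fun v : Vel =>
            f t v * (1 + ‖v‖ ^ 2) ^ ((2 : ℝ) / 2)).aestronglyMeasurable) le_rfl
        refine le_trans (le_of_eq ?_) this
        rw [weightedNorm]
        congr 1
        funext v
        simp only [Pi.add_apply, Pi.sub_apply]
        ring
      exact key.trans (add_le_add_left hτ'.le _)

theorem moment_ne_top (h : IsSolution α f₀ f) {t : ℝ} (ht : 0 ≤ t) :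
    ∫⁻ v, dens f t v * ENNReal.ofReal (1 + ‖v‖ ^ 2) ≠ ∞ := by
  obtain ⟨C, hC, hC'⟩ := h.exists_moment_bound t
  exact ne_top_of_le_ne_top hC (hC' t ⟨ht, le_rfl⟩)

theorem lossL_le (h : IsSolution α f₀ f) (t : ℝ) (v : Vel) :
    lossL (dens f t) v ≤ ENNReal.ofReal (Real.pi * (1 + ‖v‖)) *
      ∫⁻ v, dens f t v * ENNReal.ofReal (1 + ‖v‖ ^ 2) := by
  have hm := h.measurable_dens t
  rw [lossL, ← lintegral_const_mul _ (by fun_prop)]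
  refine lintegral_mono fun w => ?_
  rw [mul_left_comm, ← ENNReal.ofReal_mul (by positivity), mul_comm]
  refine mul_le_mul_right (ENNReal.ofReal_le_ofReal ?_) _
  have h1 := norm_sub_le v w
  rw [mul_assoc]
  refine mul_le_mul_of_nonneg_left ?_ Real.pi_pos.le
  nlinarith [sq_nonneg (‖w‖ - 1), norm_nonneg v, norm_nonneg w,
    mul_nonneg (norm_nonneg v) (sq_nonneg ‖w‖)]

theorem lossL_ne_top (h : IsSolution α f₀ f) {t : ℝ} (ht : 0 ≤ t) (v : Vel) :
    lossL (dens f t) v ≠ ∞ :=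
  ne_top_of_le_ne_top (ENNReal.mul_ne_top ENNReal.ofReal_ne_top (h.moment_ne_top ht))
    (h.lossL_le t v)

theorem lintegral_time_loss_ne_top (h : IsSolution α f₀ f) (T : ℝ) :
    ∫⁻ t in Ioc 0 T, ∫⁻ v, dens f t v * lossL (dens f t) v ≠ ∞ := by
  obtain ⟨C, hC, hC'⟩ := h.exists_moment_bound T
  have : ∫⁻ t in Ioc 0 T, ∫⁻ v, dens f t v * lossL (dens f t) v ≤
      ∫⁻ t in Ioc 0 T, ENNReal.ofReal Real.pi * C ^ 2 := by
    refine setLIntegral_mono measurable_const fun t ht => ?_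
    refine (lintegral_lossL_le (h.measurable_dens t)).trans ?_
    gcongr
    exact hC' t (Ioc_subset_Icc_self ht)
  refine ne_top_of_le_ne_top ?_ this
  rw [setLIntegral_const]
  exact ENNReal.mul_ne_top (ENNReal.mul_ne_top ENNReal.ofReal_ne_top (ENNReal.pow_ne_top hC))
    (by simp)

theorem ae_lintegral_time_ne_top {H : ℝ → Vel → ℝ≥0∞} (hH : Measurable (Function.uncurry H))
    (hfin : ∀ T : ℝ, ∫⁻ t in Ioc 0 T, ∫⁻ v, H t v ≠ ∞) :
    ∀ᵐ v, ∀ b : ℝ, ∫⁻ t in Ioc 0 b, H t v ≠ ∞ := by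
  have h1 : ∀ k : ℕ, ∀ᵐ v, ∫⁻ t in Ioc 0 (k : ℝ), H t v < ∞ := by
    intro k
    have h2 := hfin k
    rw [lintegral_lintegral_swap hH.aemeasurable] at h2
    have hm : Measurable fun v => ∫⁻ t in Ioc 0 (k : ℝ), H t v := hH.lintegral_prod_left'
    exact ae_lt_top hm h2
  filter_upwards [ae_all_iff.2 h1] with v hv b
  obtain ⟨k, hk⟩ := exists_nat_ge b
  exact ne_top_of_le_ne_top (hv k).ne (lintegral_mono_set (Ioc_subset_Ioc_right hk))

theorem eq_zero_add (h : IsSolution α f₀ f) {t : ℝ} (ht : 0 ≤ t) :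
    ∀ᵐ v, f t v = f 0 v + ∫ τ in (0 : ℝ)..t, collision α (f τ) v := by
  filter_upwards [h.equation t ht, h.equation 0 le_rfl] with v h1 h2
  rw [h1, h2]
  simp

theorem measurable_gainL_dens_uncurry (h : IsSolution α f₀ f) :
    Measurable fun p : ℝ × Vel => gainL α (dens f p.1) (dens f p.1) p.2 :=
  measurable_gainL_param h.measurable_dens_uncurry α

theorem measurable_lossL_dens_uncurry (h : IsSolution α f₀ f) :
    Measurable fun p : ℝ × Vel => lossL (dens f p.1) p.2 :=
  measurable_lossL_param h.measurable_dens_uncurry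

theorem measurable_gainL_dens (h : IsSolution α f₀ f) (t : ℝ) :
    Measurable fun v => gainL α (dens f t) (dens f t) v :=
  (measurable_gainL_dens_uncurry h).comp (f := fun v => (t, v)) measurable_prodMk_left

theorem lintegral_time_gain_ne_top (h : IsSolution α f₀ f) (hα : 0 < α) (T : ℝ) :
    ∫⁻ t in Ioc 0 T, ∫⁻ v, gainL α (dens f t) (dens f t) v ≠ ∞ := by
  have : ∀ t, ∫⁻ v, gainL α (dens f t) (dens f t) v = ∫⁻ v, dens f t v * lossL (dens f t) v :=
    fun t => lintegral_gainL_eq hα (h.measurable_dens t)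
  simp only [this]
  exact h.lintegral_time_loss_ne_top T

theorem gainL_dens_lt_top (h : IsSolution α f₀ f) (hα : 0 < α) {t : ℝ} (ht : 0 ≤ t) :
    ∀ᵐ v, gainL α (dens f t) (dens f t) v < ∞ := by
  have hm := h.measurable_dens t
  refine ae_lt_top (h.measurable_gainL_dens t) ?_
  refine ne_top_of_le_ne_top ?_ ((lintegral_gainL_eq hα hm).trans_le (lintegral_lossL_le hm))
  exact ENNReal.mul_ne_top ENNReal.ofReal_ne_top (ENNReal.pow_ne_top (h.moment_ne_top ht))

theorem collision_eq (h : IsSolution α f₀ f) (hα : 0 < α) {t : ℝ} (ht : 0 ≤ t) :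
    ∀ᵐ v, collision α (f t) v =
      (gainL α (dens f t) (dens f t) v).toReal - (dens f t v * lossL (dens f t) v).toReal := by
  filter_upwards [h.nonneg t ht, gain_eq_toReal hα (h.measurable_slice t) (h.nonneg t ht),
    h.gainL_dens_lt_top hα ht] with v h1 h2 h3
  have h4 : gain α (f t) v = (gainL α (dens f t) (dens f t) v).toReal := h2 h3.ne
  have h5 : lossRate (f t) v = (lossL (dens f t) v).toReal :=
    lossRate_eq_toReal (h.measurable_slice t) (h.nonneg t ht) (h.lossL_ne_top ht v)
  have h6 : (dens f t v).toReal = f t v := ENNReal.toReal_ofReal h1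
  rw [collision, h4, h5, ENNReal.toReal_mul, h6]

theorem measurable_time_integral {k : ℝ × Vel → ℝ} (hk : Measurable k) :
    Measurable fun p : ℝ × Vel => ∫ τ, (Ioc 0 p.1).indicator (fun τ => k (τ, p.2)) τ := by
  have hs : MeasurableSet {r : (ℝ × Vel) × ℝ | r.2 ∈ Ioc 0 r.1.1} := by
    have h1 : MeasurableSet {r : (ℝ × Vel) × ℝ | 0 < r.2} :=
      measurableSet_lt measurable_const measurable_snd
    have h2 : MeasurableSet {r : (ℝ × Vel) × ℝ | r.2 ≤ r.1.1} :=
      measurableSet_le measurable_snd measurable_fst.fst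
    exact h1.inter h2
  have h1 : StronglyMeasurable ({r : (ℝ × Vel) × ℝ | r.2 ∈ Ioc 0 r.1.1}.indicator
      fun r => k (r.2, r.1.2)) :=
    ((hk.comp (by fun_prop : Measurable fun r : (ℝ × Vel) × ℝ => (r.2, r.1.2))).indicator
      hs).stronglyMeasurable
  exact (h1.integral_prod_right' (ν := (volume : Measure ℝ))).measurable

/-- For almost every velocity a solution is a trajectory of the corresponding ordinary differential
equation. -/
theorem isTrajectory (h : IsSolution α f₀ f) (hα : 0 < α) :
    ∀ᵐ v, IsTrajectory (fun τ => f τ v) (fun τ => gainL α (dens f τ) (dens f τ) v)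
      (fun τ => dens f τ v * lossL (dens f τ) v) (fun τ => collision α (f τ) v) := by
  have hgm := h.measurable_gainL_dens_uncurry
  have hlm : Measurable fun p : ℝ × Vel => dens f p.1 p.2 * lossL (dens f p.1) p.2 :=
    h.measurable_dens_uncurry.mul h.measurable_lossL_dens_uncurry
  have hcm : Measurable fun p : ℝ × Vel => collision α (f p.1) p.2 :=
    measurable_collision_param h.measurable α
  have hloss := ae_lintegral_time_ne_top (H := fun t v => dens f t v * lossL (dens f t) v) hlm
    h.lintegral_time_loss_ne_top
  have hgain := ae_lintegral_time_ne_top (H := fun t v => gainL α (dens f t) (dens f t) v) hgm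
    (h.lintegral_time_gain_ne_top hα)
  have hnn := ae_ae_of_forall_pos (p := fun t v => 0 ≤ f t v)
    (measurableSet_le measurable_const h.measurable) h.nonneg
  have hrate := ae_ae_of_forall_pos (p := fun t v => collision α (f t) v =
      (gainL α (dens f t) (dens f t) v).toReal - (dens f t v * lossL (dens f t) v).toReal)
    (measurableSet_eq_fun hcm (hgm.ennreal_toReal.sub hlm.ennreal_toReal))
    (fun t ht => h.collision_eq hα ht)
  have heq := ae_ae_of_forall_pos
    (p := fun t v => f t v = f 0 v + ∫ τ, (Ioc 0 t).indicator (fun τ => collision α (f τ) v) τ)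
    (measurableSet_eq_fun h.measurable
      (((h.measurable_slice 0).comp measurable_snd).add (measurable_time_integral hcm))) (by
      intro t ht
      filter_upwards [h.eq_zero_add ht] with v hv
      rw [hv, integral_indicator measurableSet_Ioc, intervalIntegral.integral_of_le ht])
  filter_upwards [hloss, hgain, hnn, hrate, heq, h.nonneg 0 le_rfl] with v h1 h2 h3 h4 h5 h6
  refine ⟨hgm.comp (f := fun τ => (τ, v)) measurable_prodMk_right,
    hlm.comp (f := fun τ => (τ, v)) measurable_prodMk_right, h2, h1, h6, h3, h4, ?_⟩
  filter_upwards [h5] with t ht ht0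
  rw [ht ht0, integral_indicator measurableSet_Ioc, intervalIntegral.integral_of_le ht0.le]

end IsSolution


/-! ### Conservation of mass and momentum, dissipation of energy -/

namespace IsNormalized

variable {f₀ : Vel → ℝ}

theorem integrable (hn : IsNormalized f₀) : Integrable f₀ :=
  Integrable.of_integral_ne_zero (by rw [hn.mass]; exact one_ne_zero)

theorem integrable_energy (hn : IsNormalized f₀) : Integrable fun v => f₀ v * ‖v‖ ^ 2 :=
  Integrable.of_integral_ne_zero (by rw [hn.energy]; exact one_ne_zero)

theorem lintegral_mass (hn : IsNormalized f₀) : ∫⁻ v, ENNReal.ofReal (f₀ v) = 1 := by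
  rw [← ofReal_integral_eq_lintegral_ofReal hn.integrable hn.nonneg, hn.mass, ENNReal.ofReal_one]

theorem integrable_inner (hn : IsNormalized f₀) (c : Vel) :
    Integrable fun v => f₀ v * inner ℝ v c := by
  refine ((hn.integrable.add hn.integrable_energy).mul_const ‖c‖).mono'
    (hn.integrable.aestronglyMeasurable.mul (by fun_prop)) ?_
  filter_upwards [hn.nonneg] with v hv
  rw [norm_mul, Real.norm_of_nonneg hv, Pi.add_apply, ← mul_one_add, mul_assoc]
  refine mul_le_mul_of_nonneg_left ((norm_inner_le_norm v c).trans ?_) hv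
  refine mul_le_mul_of_nonneg_right ?_ (norm_nonneg c)
  nlinarith [sq_nonneg (‖v‖ - 1)]

theorem integral_inner (hn : IsNormalized f₀) (c : Vel) : ∫ v, f₀ v * inner ℝ v c = 0 := by
  have hi : ∀ i : Fin 3, Integrable fun v : Vel => f₀ v * v i := fun i => by
    simpa [EuclideanSpace.inner_single_right] using
      hn.integrable_inner (EuclideanSpace.single i (1 : ℝ))
  have : ∀ v : Vel, f₀ v * inner ℝ v c = ∑ i : Fin 3, c i * (f₀ v * v i) := by
    intro v
    rw [PiLp.inner_apply, Finset.mul_sum]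
    refine Finset.sum_congr rfl fun i _ => ?_
    simp
    ring
  simp only [this]
  rw [integral_finsetSum _ fun i _ => (hi i).const_mul _]
  simp only [integral_const_mul, hn.momentum, mul_zero, Finset.sum_const_zero]

theorem lintegral_dist_sq (hn : IsNormalized f₀) (c : Vel) :
    ∫⁻ v, ENNReal.ofReal (f₀ v) * ENNReal.ofReal (‖v - c‖ ^ 2) = ENNReal.ofReal (1 + ‖c‖ ^ 2) := by
  have he : (fun v => f₀ v * ‖v - c‖ ^ 2) =
      fun v => f₀ v * ‖v‖ ^ 2 - 2 * (f₀ v * inner ℝ v c) + ‖c‖ ^ 2 * f₀ v := by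
    funext v
    rw [norm_sub_sq_real]
    ring
  have hi1 : Integrable fun v => f₀ v * ‖v‖ ^ 2 - 2 * (f₀ v * inner ℝ v c) :=
    hn.integrable_energy.sub ((hn.integrable_inner c).const_mul 2)
  have hi2 := hn.integrable.const_mul (‖c‖ ^ 2)
  have hi : Integrable fun v => f₀ v * ‖v - c‖ ^ 2 := by
    rw [he]; exact hi1.add hi2
  have hval : ∫ v, f₀ v * ‖v - c‖ ^ 2 = 1 + ‖c‖ ^ 2 := by
    rw [he, integral_add hi1 hi2, integral_sub hn.integrable_energy
      ((hn.integrable_inner c).const_mul 2), integral_const_mul, integral_const_mul, hn.energy,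
      hn.mass, hn.integral_inner]
    ring
  rw [← hval, ofReal_integral_eq_lintegral_ofReal hi]
  · refine lintegral_congr_ae ?_
    filter_upwards [hn.nonneg] with v hv
    rw [ENNReal.ofReal_mul hv]
  · filter_upwards [hn.nonneg] with v hv
    positivity

end IsNormalized

/-- A collision does not increase the sum of the squared distances to any given velocity. -/
theorem norm_post_sq_add_le {α : ℝ} (hα : 0 < α) (hα1 : α ≤ 1) (v vs c : Vel) {n : Vel}
    (hn : ‖n‖ = 1) :
    ‖post α v vs n - c‖ ^ 2 + ‖postStar α v vs n - c‖ ^ 2 ≤ ‖v - c‖ ^ 2 + ‖vs - c‖ ^ 2 := by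
  have e1 : post α v vs n - c = (v - c) - ((1 + α) / 2 * inner ℝ (v - vs) n) • n := by
    rw [post]; abel
  have e2 : postStar α v vs n - c = (vs - c) + ((1 + α) / 2 * inner ℝ (v - vs) n) • n := by
    rw [postStar]; abel
  have e3 : inner ℝ (v - vs) n = inner ℝ (v - c) n - inner ℝ (vs - c) n := by
    rw [← inner_sub_left]; congr 1; abel
  rw [e1, e2, norm_sub_sq_real, norm_add_sq_real, real_inner_smul_right, real_inner_smul_right,
    norm_smul, hn, e3, mul_one, Real.norm_eq_abs, sq_abs]
  nlinarith [mul_nonneg (mul_nonneg (by linarith : 0 ≤ 1 + α) (by linarith : 0 ≤ 1 - α))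
    (sq_nonneg (inner ℝ (v - c) n - inner ℝ (vs - c) n))]

theorem lintegral_gainL_dist_sq_le {α : ℝ} (hα : 0 < α) (hα1 : α ≤ 1) {g : Vel → ℝ≥0∞}
    (hg : Measurable g) (c : Vel) :
    ∫⁻ v, gainL α g g v * ENNReal.ofReal (‖v - c‖ ^ 2) ≤
      ∫⁻ v, g v * lossL g v * ENNReal.ofReal (‖v - c‖ ^ 2) := by
  have hψ : Measurable fun v : Vel => ENNReal.ofReal (‖v - c‖ ^ 2) := by fun_prop
  refine (ENNReal.mul_le_mul_iff_right (a := 2) (by norm_num) (by norm_num)).1 ?_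
  rw [two_mul_lintegral_gainL_mul hα hg hψ, two_mul_lintegral_lossL_mul hg hψ]
  refine lintegral_mono fun v => lintegral_mono fun vs => lintegral_mono fun n => ?_
  refine mul_le_mul_right (mul_le_mul_right ?_ _) _
  rw [← ENNReal.ofReal_add (by positivity) (by positivity),
    ← ENNReal.ofReal_add (by positivity) (by positivity)]
  exact ENNReal.ofReal_le_ofReal (norm_post_sq_add_le hα hα1 v vs c (norm_coe_unitSphere n))

namespace IsSolution

variable {α : ℝ} {f₀ : Vel → ℝ} {f : ℝ → Vel → ℝ}

/-- The renormalised balance law, integrated over all velocities. -/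
theorem lintegral_balance (h : IsSolution α f₀ f) (hα : 0 < α) {a b : ℝ} (ha : 0 ≤ a) (hab : a ≤ b)
    {Ψ Λ : Vel → ℝ → ℝ} (hΨ : ∀ v x, 0 ≤ x → HasDerivAt (Ψ v) (Λ v x) x)
    (hΛ : ∀ v, ContinuousOn (Λ v) (Ici 0)) (hΨ0 : ∀ v x, 0 ≤ x → 0 ≤ Ψ v x)
    (hΛ0 : ∀ v x, 0 ≤ x → 0 ≤ Λ v x) (hΨm : Measurable (Function.uncurry Ψ))
    (hΛm : Measurable (Function.uncurry Λ)) :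
    (∫⁻ v, ENNReal.ofReal (Ψ v (f b v))) +
        ∫⁻ τ in Ioc a b, ∫⁻ v, dens f τ v * lossL (dens f τ) v * ENNReal.ofReal (Λ v (f τ v)) =
      (∫⁻ v, ENNReal.ofReal (Ψ v (f a v))) +
        ∫⁻ τ in Ioc a b, ∫⁻ v, gainL α (dens f τ) (dens f τ) v *
          ENNReal.ofReal (Λ v (f τ v)) := by
  have hw : Measurable fun p : ℝ × Vel => ENNReal.ofReal (Λ p.2 (f p.1 p.2)) :=
    (hΛm.comp (measurable_snd.prodMk h.measurable)).ennreal_ofReal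
  have hD : Measurable fun p : ℝ × Vel => dens f p.1 p.2 * lossL (dens f p.1) p.2 *
      ENNReal.ofReal (Λ p.2 (f p.1 p.2)) :=
    (h.measurable_dens_uncurry.mul h.measurable_lossL_dens_uncurry).mul hw
  have hG : Measurable fun p : ℝ × Vel => gainL α (dens f p.1) (dens f p.1) p.2 *
      ENNReal.ofReal (Λ p.2 (f p.1 p.2)) := h.measurable_gainL_dens_uncurry.mul hw
  have hΨt : ∀ t, Measurable fun v => ENNReal.ofReal (Ψ v (f t v)) := fun t =>
    (hΨm.comp (measurable_id.prodMk (h.measurable_slice t))).ennreal_ofReal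
  rw [lintegral_lintegral_swap (f := fun τ v => dens f τ v * lossL (dens f τ) v *
      ENNReal.ofReal (Λ v (f τ v))) hD.aemeasurable,
    lintegral_lintegral_swap (f := fun τ v => gainL α (dens f τ) (dens f τ) v *
      ENNReal.ofReal (Λ v (f τ v))) hG.aemeasurable,
    ← lintegral_add_left (hΨt b), ← lintegral_add_left (hΨt a)]
  refine lintegral_congr_ae ?_
  filter_upwards [h.isTrajectory hα, h.eq_zero_add ha, h.eq_zero_add (ha.trans hab)]
    with v hv hva hvb
  exact hv.balance ha hab hva hvb (hΨ v) (hΛ v) (hΨ0 v) (hΛ0 v)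

/-- The balance law for a weighted integral of a solution. -/
theorem lintegral_weight_balance (h : IsSolution α f₀ f) (hα : 0 < α) {a b : ℝ} (ha : 0 ≤ a)
    (hab : a ≤ b) {w : Vel → ℝ} (hw : Measurable w) (hw0 : ∀ v, 0 ≤ w v) :
    (∫⁻ v, dens f b v * ENNReal.ofReal (w v)) +
        ∫⁻ τ in Ioc a b, ∫⁻ v, dens f τ v * lossL (dens f τ) v * ENNReal.ofReal (w v) =
      (∫⁻ v, dens f a v * ENNReal.ofReal (w v)) +
        ∫⁻ τ in Ioc a b, ∫⁻ v, gainL α (dens f τ) (dens f τ) v * ENNReal.ofReal (w v) := by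
  have key := h.lintegral_balance hα ha hab (Ψ := fun v x => w v * x) (Λ := fun v _ => w v)
    (fun v x _ => by simpa using (hasDerivAt_id x).const_mul (w v))
    (fun v => continuousOn_const) (fun v x hx => mul_nonneg (hw0 v) hx) (fun v _ _ => hw0 v)
    (by exact (hw.comp measurable_fst).mul measurable_snd) (by exact hw.comp measurable_fst)
  have e : ∀ t v, ENNReal.ofReal (w v * f t v) = dens f t v * ENNReal.ofReal (w v) := fun t v => by
    rw [ENNReal.ofReal_mul (hw0 v), mul_comm, dens]
  simpa only [e] using key

theorem dens_zero (h : IsSolution α f₀ f) : ∀ᵐ v, dens f 0 v = ENNReal.ofReal (f₀ v) := by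
  filter_upwards [h.equation 0 le_rfl] with v hv
  rw [dens, hv]
  simp

theorem lintegral_dens (h : IsSolution α f₀ f) (hα : 0 < α) (hn : IsNormalized f₀) {t : ℝ}
    (ht : 0 ≤ t) : ∫⁻ v, dens f t v = 1 := by
  have key := h.lintegral_weight_balance hα le_rfl ht (w := fun _ => 1) measurable_const
    (fun _ => zero_le_one)
  simp only [ENNReal.ofReal_one, mul_one] at key
  have h1 : ∀ τ, ∫⁻ v, gainL α (dens f τ) (dens f τ) v = ∫⁻ v, dens f τ v * lossL (dens f τ) v :=
    fun τ => lintegral_gainL_eq hα (h.measurable_dens τ)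
  simp only [h1] at key
  rw [(ENNReal.add_left_inj (h.lintegral_time_loss_ne_top t)).1 key,
    lintegral_congr_ae h.dens_zero, hn.lintegral_mass]

/-- The dissipation of second moments is finite away from the initial time, because third moments
are integrable in time there. -/
theorem lintegral_loss_dist_sq_ne_top (h : IsSolution α f₀ f) {a b : ℝ} (ha : 0 < a) (hab : a ≤ b)
    (c : Vel) : ∫⁻ τ in Ioc a b, ∫⁻ v, dens f τ v * lossL (dens f τ) v *
      ENNReal.ofReal (‖v - c‖ ^ 2) ≠ ∞ := by
  obtain ⟨C, hC, hC'⟩ := h.exists_moment_bound b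
  have hpt : ∀ v : Vel, (Real.pi * (1 + ‖v‖)) * ‖v - c‖ ^ 2 ≤
      (8 * Real.pi * (1 + ‖c‖) ^ 2) * (1 + ‖v‖ ^ 2) ^ ((3 : ℝ) / 2) := by
    intro v
    have e1 : (1 + ‖v‖ ^ 2) ^ ((3 : ℝ) / 2) = (√(1 + ‖v‖ ^ 2)) ^ 3 := by
      rw [Real.sqrt_eq_rpow, ← Real.rpow_mul_natCast (by positivity)]
      norm_num
    have h2 : 1 ≤ √(1 + ‖v‖ ^ 2) := by
      rw [Real.one_le_sqrt]; nlinarith [norm_nonneg v]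
    have h3 : ‖v‖ ≤ √(1 + ‖v‖ ^ 2) := Real.le_sqrt_of_sq_le (by linarith)
    have h4 : ‖v - c‖ ≤ (1 + ‖c‖) * (2 * √(1 + ‖v‖ ^ 2)) := by
      nlinarith [norm_sub_le v c, norm_nonneg v, norm_nonneg c]
    rw [e1]
    calc Real.pi * (1 + ‖v‖) * ‖v - c‖ ^ 2
        ≤ Real.pi * (2 * √(1 + ‖v‖ ^ 2)) * ((1 + ‖c‖) * (2 * √(1 + ‖v‖ ^ 2))) ^ 2 := by
          have := Real.pi_pos
          gcongr
          linarith
      _ = _ := by ring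
  have hle : ∫⁻ τ in Ioc a b, ∫⁻ v, dens f τ v * lossL (dens f τ) v *
      ENNReal.ofReal (‖v - c‖ ^ 2) ≤ ∫⁻ τ in Icc a b,
        C * ENNReal.ofReal (8 * Real.pi * (1 + ‖c‖) ^ 2) * weightedNorm 1 3 (f τ) := by
    refine (setLIntegral_mono_ae' measurableSet_Ioc (Eventually.of_forall fun τ hτ => ?_)).trans
      (lintegral_mono_set Ioc_subset_Icc_self)
    refine le_trans ?_ (mul_le_mul_right (lintegral_mul_le_weightedNorm f τ 3) _)
    have hm := h.measurable_dens τ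
    rw [← lintegral_const_mul _ (by fun_prop)]
    refine lintegral_mono fun v => ?_
    have h2 : lossL (dens f τ) v ≤ ENNReal.ofReal (Real.pi * (1 + ‖v‖)) * C :=
      (h.lossL_le τ v).trans (mul_le_mul_right (hC' τ ⟨ha.le.trans hτ.1.le, hτ.2⟩) _)
    calc dens f τ v * lossL (dens f τ) v * ENNReal.ofReal (‖v - c‖ ^ 2)
        ≤ dens f τ v * (ENNReal.ofReal (Real.pi * (1 + ‖v‖)) * C) *
            ENNReal.ofReal (‖v - c‖ ^ 2) := by gcongr
      _ = C * dens f τ v * (ENNReal.ofReal (Real.pi * (1 + ‖v‖)) *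
            ENNReal.ofReal (‖v - c‖ ^ 2)) := by ring
      _ ≤ C * dens f τ v * (ENNReal.ofReal (8 * Real.pi * (1 + ‖c‖) ^ 2) *
            ENNReal.ofReal ((1 + ‖v‖ ^ 2) ^ ((3 : ℝ) / 2))) := by
          have hpi := Real.pi_pos
          rw [← ENNReal.ofReal_mul (by positivity), ← ENNReal.ofReal_mul (by positivity)]
          exact mul_le_mul_right (ENNReal.ofReal_le_ofReal (hpt v)) _
      _ = _ := by ring
  refine ne_top_of_le_ne_top ?_ hle
  rw [lintegral_const_mul' _ _ (ENNReal.mul_ne_top hC ENNReal.ofReal_ne_top)]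
  exact ENNReal.mul_ne_top (ENNReal.mul_ne_top hC ENNReal.ofReal_ne_top)
    (h.locIntegrableL13 a b ha hab).ne

theorem lintegral_dist_sq_le_of_pos (h : IsSolution α f₀ f) (hα : 0 < α) (hα1 : α ≤ 1) {a b : ℝ}
    (ha : 0 < a) (hab : a ≤ b) (c : Vel) :
    ∫⁻ v, dens f b v * ENNReal.ofReal (‖v - c‖ ^ 2) ≤
      ∫⁻ v, dens f a v * ENNReal.ofReal (‖v - c‖ ^ 2) := by
  have key := h.lintegral_weight_balance hα ha.le hab (w := fun v => ‖v - c‖ ^ 2) (by fun_prop)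
    (fun _ => by positivity)
  have h1 : ∫⁻ τ in Ioc a b, ∫⁻ v, gainL α (dens f τ) (dens f τ) v * ENNReal.ofReal (‖v - c‖ ^ 2) ≤
      ∫⁻ τ in Ioc a b, ∫⁻ v, dens f τ v * lossL (dens f τ) v * ENNReal.ofReal (‖v - c‖ ^ 2) :=
    lintegral_mono fun τ => lintegral_gainL_dist_sq_le hα hα1 (h.measurable_dens τ) c
  have hfin := h.lintegral_loss_dist_sq_ne_top ha hab c
  refine (ENNReal.add_le_add_iff_right hfin).1 ?_
  rw [key]
  exact add_le_add_right h1 _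

/-- The second moment about any velocity is at most its initial value. For positive times the
dissipation is finite because third moments are; the initial time is reached by continuity. -/
theorem lintegral_dist_sq_le (h : IsSolution α f₀ f) (hα : 0 < α) (hα1 : α ≤ 1)
    (hn : IsNormalized f₀) {t : ℝ} (ht : 0 ≤ t) (c : Vel) :
    ∫⁻ v, dens f t v * ENNReal.ofReal (‖v - c‖ ^ 2) ≤ ENNReal.ofReal (1 + ‖c‖ ^ 2) := by
  have h0 : ∫⁻ v, dens f 0 v * ENNReal.ofReal (‖v - c‖ ^ 2) = ENNReal.ofReal (1 + ‖c‖ ^ 2) := by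
    rw [← hn.lintegral_dist_sq c]
    refine lintegral_congr_ae ?_
    filter_upwards [h.dens_zero] with v hv
    rw [hv]
  rcases ht.eq_or_lt with rfl | ht
  · exact h0.le
  have h1 : ∀ a, ∫⁻ v, dens f a v * ENNReal.ofReal (‖v - c‖ ^ 2) ≤ ENNReal.ofReal (1 + ‖c‖ ^ 2) +
      ENNReal.ofReal (2 * (1 + ‖c‖ ^ 2)) * weightedNorm 1 2 (f a - f 0) := by
    intro a
    have hm0 := h.measurable_dens 0
    have hma := h.measurable_slice a
    have hms := h.measurable_slice 0
    rw [← h0, weightedNorm, eLpNorm_one_eq_lintegral_enorm, ← lintegral_const_mul _ (by fun_prop),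
      ← lintegral_add_left (by fun_prop)]
    refine lintegral_mono fun v => ?_
    have e1 : dens f a v ≤ dens f 0 v + ‖f a v - f 0 v‖ₑ := by
      have : f a v ≤ f 0 v + |f a v - f 0 v| := by linarith [le_abs_self (f a v - f 0 v)]
      refine (ENNReal.ofReal_le_ofReal this).trans (ENNReal.ofReal_add_le.trans ?_)
      rw [← Real.norm_eq_abs, ofReal_norm]
      rfl
    refine (mul_le_mul_left e1 _).trans ?_
    rw [add_mul]
    refine add_le_add_right ?_ _
    rw [enorm_mul, mul_left_comm]
    refine mul_le_mul_right ?_ _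
    rw [show (2 : ℝ) / 2 = 1 by norm_num, Real.rpow_one, Real.enorm_of_nonneg (by positivity),
      ← ENNReal.ofReal_mul (by positivity)]
    refine ENNReal.ofReal_le_ofReal ?_
    have := norm_sub_le v c
    nlinarith [norm_nonneg (v - c), sq_nonneg (‖v‖ - ‖c‖), sq_nonneg (‖v‖ * ‖c‖), norm_nonneg v,
      norm_nonneg c]
  have hlim : Tendsto (fun a => ENNReal.ofReal (1 + ‖c‖ ^ 2) +
      ENNReal.ofReal (2 * (1 + ‖c‖ ^ 2)) * weightedNorm 1 2 (f a - f 0)) (𝓝[>] (0 : ℝ))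
      (𝓝 (ENNReal.ofReal (1 + ‖c‖ ^ 2) + ENNReal.ofReal (2 * (1 + ‖c‖ ^ 2)) * 0)) :=
    tendsto_const_nhds.add (ENNReal.Tendsto.const_mul ((h.continuousL12 0 le_rfl).mono_left
      (nhdsWithin_mono 0 Ioi_subset_Ici_self)) (Or.inr ENNReal.ofReal_ne_top))
  rw [mul_zero, add_zero] at hlim
  refine ge_of_tendsto hlim ?_
  filter_upwards [Ioc_mem_nhdsGT ht] with a ha
  exact (h.lintegral_dist_sq_le_of_pos hα hα1 ha.1 ha.2 c).trans (h1 a)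

theorem lintegral_energy_le (h : IsSolution α f₀ f) (hα : 0 < α) (hα1 : α ≤ 1)
    (hn : IsNormalized f₀) {t : ℝ} (ht : 0 ≤ t) :
    ∫⁻ v, dens f t v * ENNReal.ofReal (‖v‖ ^ 2) ≤ 1 := by
  simpa using h.lintegral_dist_sq_le hα hα1 hn ht 0

theorem lintegral_moment_le (h : IsSolution α f₀ f) (hα : 0 < α) (hα1 : α ≤ 1)
    (hn : IsNormalized f₀) {t : ℝ} (ht : 0 ≤ t) :
    ∫⁻ v, dens f t v * ENNReal.ofReal (1 + ‖v‖ ^ 2) ≤ 2 := by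
  have hm := h.measurable_dens t
  have e : ∀ v : Vel, dens f t v * ENNReal.ofReal (1 + ‖v‖ ^ 2) =
      dens f t v + dens f t v * ENNReal.ofReal (‖v‖ ^ 2) := fun v => by
    rw [ENNReal.ofReal_add zero_le_one (by positivity), ENNReal.ofReal_one, mul_add, mul_one]
  simp only [e]
  rw [lintegral_add_left hm, h.lintegral_dens hα hn ht]
  exact (add_le_add_right (h.lintegral_energy_le hα hα1 hn ht) _).trans one_add_one_eq_two.le

/-- Since the momentum vanishes, the loss frequency at `v` is at least `π |v|`. -/
theorem le_lossL (h : IsSolution α f₀ f) (hα : 0 < α) (hα1 : α ≤ 1) (hn : IsNormalized f₀) {t : ℝ}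
    (ht : 0 ≤ t) (v : Vel) : ENNReal.ofReal (Real.pi * ‖v‖) ≤ lossL (dens f t) v := by
  have hm := h.measurable_dens t
  have hms := h.measurable_slice t
  rcases eq_or_ne v 0 with rfl | hv
  · simp
  have hv' : 0 < ‖v‖ := norm_pos_iff.2 hv
  set I := ∫⁻ w, dens f t w * ENNReal.ofReal ‖v - w‖ with hI
  have hloss : lossL (dens f t) v = ENNReal.ofReal Real.pi * I := by
    rw [lossL, hI, ← lintegral_const_mul _ (by fun_prop)]
    refine lintegral_congr fun w => ?_
    rw [ENNReal.ofReal_mul Real.pi_pos.le]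
    ring
  rw [hloss, ENNReal.ofReal_mul Real.pi_pos.le]
  refine mul_le_mul_right ?_ _
  -- testing with the distance to `c = -R v` and `R → ∞` bounds the first moment along `v`
  have key : ∀ R : ℝ, 0 < R → ENNReal.ofReal (2 * R * ‖v‖ ^ 2) ≤
      ENNReal.ofReal 1 + ENNReal.ofReal (2 * R * ‖v‖) * I := by
    intro R hR
    have h1 := h.lintegral_dist_sq_le hα hα1 hn ht (-(R • v))
    have h2 : ENNReal.ofReal (2 * R * ‖v‖ ^ 2 + R ^ 2 * ‖v‖ ^ 2) ≤
        (∫⁻ w, dens f t w * ENNReal.ofReal (‖w - -(R • v)‖ ^ 2)) +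
          ENNReal.ofReal (2 * R * ‖v‖) * I := by
      have h3 : ENNReal.ofReal (2 * R * ‖v‖ ^ 2 + R ^ 2 * ‖v‖ ^ 2) =
          ∫⁻ w, dens f t w * ENNReal.ofReal (2 * R * ‖v‖ ^ 2 + R ^ 2 * ‖v‖ ^ 2) := by
        rw [lintegral_mul_const _ hm, h.lintegral_dens hα hn ht, one_mul]
      rw [h3, hI, ← lintegral_const_mul _ (by fun_prop), ← lintegral_add_left (by fun_prop)]
      refine lintegral_mono fun w => ?_
      rw [mul_left_comm, ← mul_add]
      refine mul_le_mul_right ?_ _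
      rw [← ENNReal.ofReal_mul (by positivity), ← ENNReal.ofReal_add (by positivity)
        (by positivity)]
      refine ENNReal.ofReal_le_ofReal ?_
      rw [sub_neg_eq_add, norm_add_sq_real, real_inner_smul_right, norm_smul, Real.norm_of_nonneg
        hR.le]
      have h4 : ‖v‖ ^ 2 - inner ℝ w v ≤ ‖v‖ * ‖v - w‖ := by
        have := real_inner_le_norm (v - w) v
        rw [inner_sub_left, real_inner_self_eq_norm_sq] at this
        linarith
      nlinarith [sq_nonneg ‖w‖]
    have h3 := h2.trans (add_le_add_left h1 _)
    rw [norm_neg, norm_smul, Real.norm_of_nonneg hR.le, mul_pow,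
      ENNReal.ofReal_add (by positivity) (by positivity),
      ENNReal.ofReal_add (by positivity) (by positivity), add_right_comm] at h3
    exact (ENNReal.add_le_add_iff_right ENNReal.ofReal_ne_top).1 h3
  rcases eq_or_ne I ∞ with hI' | hI'
  · rw [hI']; exact le_top
  rw [ENNReal.ofReal_le_iff_le_toReal hI']
  by_contra! hlt
  set J := I.toReal with hJ
  have hk := key (1 / (‖v‖ * (‖v‖ - J))) (by have := sub_pos.2 hlt; positivity)
  rw [← ENNReal.ofReal_toReal hI', ← hJ, ← ENNReal.ofReal_mul (by
      have := sub_pos.2 hlt; positivity), ← ENNReal.ofReal_add (by norm_num) (by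
      have := sub_pos.2 hlt
      have : 0 ≤ J := ENNReal.toReal_nonneg
      positivity), ENNReal.ofReal_le_ofReal_iff (by
      have := sub_pos.2 hlt
      have : 0 ≤ J := ENNReal.toReal_nonneg
      positivity)] at hk
  have hd : 0 < ‖v‖ - J := sub_pos.2 hlt
  have e : 2 * (1 / (‖v‖ * (‖v‖ - J))) * ‖v‖ ^ 2 - 2 * (1 / (‖v‖ * (‖v‖ - J))) * ‖v‖ * J = 2 := by
    field_simp
  linarith

end IsSolution


/-! ### Propagation of bounds on marginals and potentials -/

theorem MarginalLE.mono {g : Vel → ℝ≥0∞} {P P' : ℝ≥0∞} (h : MarginalLE g P) (hP : P ≤ P') :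
    MarginalLE g P' := fun e he φ hφ => (h e he φ hφ).trans (mul_le_mul_left hP _)

/-- A bound for the integrals of `(1 + |v|²)^(-s/2)` over planes. -/
noncomputable def planeBound (s : ℝ) : ℝ≥0∞ :=
  (∫⁻ y : ℝ, ENNReal.ofReal ((1 + y ^ 2) ^ (-(s / 2) / 2))) ^ 2

theorem planeBound_ne_top {s : ℝ} (hs : 2 < s) : planeBound s ≠ ∞ := by
  have h1 : Integrable fun y : ℝ => ((1 : ℝ) + ‖y‖ ^ 2) ^ (-(s / 2) / 2) :=
    integrable_rpow_neg_one_add_norm_sq (by simp; linarith)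
  have h2 := h1.lintegral_lt_top
  simp only [Real.norm_eq_abs, sq_abs] at h2
  exact ENNReal.pow_ne_top h2.ne

/-- Pointwise decay faster than `|v|⁻²` bounds the marginals. The weight is split as
`(1 + |v|²)^(-s/2) ≤ (1 + y²)^(-s/4) (1 + z²)^(-s/4)` in the coordinates `y`, `z` of the plane. -/
theorem marginalLE_of_le {g : Vel → ℝ≥0∞} {M s : ℝ} (hM : 0 ≤ M) (hs : 2 < s)
    (hg : ∀ᵐ v, g v ≤ ENNReal.ofReal (M * (1 + ‖v‖ ^ 2) ^ (-(s / 2)))) :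
    MarginalLE g (ENNReal.ofReal M * planeBound s) := by
  intro e he φ hφ
  obtain ⟨b, c, hb, hc, hnorm, -, hslice⟩ := exists_lintegral_slice he
  have hin : ∀ a y z : ℝ, inner ℝ (a • e + y • b + z • c) e = a := fun a y z => by
    simp [inner_add_left, real_inner_smul_left, hb, hc, he]
  have hJ : Measurable fun y : ℝ => ENNReal.ofReal ((1 + y ^ 2) ^ (-(s / 2) / 2)) := by fun_prop
  set J := ∫⁻ y : ℝ, ENNReal.ofReal ((1 + y ^ 2) ^ (-(s / 2) / 2)) with hJdef
  calc ∫⁻ z, g z * φ (inner ℝ z e)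
      ≤ ∫⁻ z : Vel, ENNReal.ofReal (M * (1 + ‖z‖ ^ 2) ^ (-(s / 2))) * φ (inner ℝ z e) := by
        refine lintegral_mono_ae ?_
        filter_upwards [hg] with z hz
        exact mul_le_mul_left hz _
    _ = ∫⁻ a : ℝ, ∫⁻ y : ℝ, ∫⁻ z : ℝ, ENNReal.ofReal
          (M * (1 + (a ^ 2 + y ^ 2 + z ^ 2)) ^ (-(s / 2))) * φ a := by
        rw [hslice _ (by fun_prop)]
        simp only [hnorm, hin]
    _ ≤ ∫⁻ a : ℝ, ∫⁻ y : ℝ, ∫⁻ z : ℝ, ENNReal.ofReal M * φ a *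
          (ENNReal.ofReal ((1 + y ^ 2) ^ (-(s / 2) / 2)) *
            ENNReal.ofReal ((1 + z ^ 2) ^ (-(s / 2) / 2))) := by
        refine lintegral_mono fun a => lintegral_mono fun y => lintegral_mono fun z => ?_
        rw [ENNReal.ofReal_mul hM, mul_right_comm, ← ENNReal.ofReal_mul (by positivity)]
        refine mul_le_mul_right (ENNReal.ofReal_le_ofReal ?_) _
        rw [← Real.mul_rpow (by positivity) (by positivity), neg_div, Real.rpow_neg (by positivity),
          Real.rpow_neg (by positivity)]
        refine inv_anti₀ (by positivity) ?_
        have e1 : (1 + (a ^ 2 + y ^ 2 + z ^ 2)) ^ (s / 2) =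
            ((1 + (a ^ 2 + y ^ 2 + z ^ 2)) ^ 2) ^ (s / 2 / 2) := by
          rw [← Real.rpow_natCast_mul (by positivity)]
          congr 1
          push_cast
          ring
        rw [e1]
        refine Real.rpow_le_rpow (by positivity) ?_ (by linarith)
        nlinarith [sq_nonneg a, sq_nonneg y, sq_nonneg z, mul_nonneg (sq_nonneg y) (sq_nonneg z),
          mul_nonneg (sq_nonneg a) (sq_nonneg z), mul_nonneg (sq_nonneg a) (sq_nonneg y),
          sq_nonneg (a ^ 2), sq_nonneg (y ^ 2), sq_nonneg (z ^ 2)]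
    _ = ∫⁻ a : ℝ, ENNReal.ofReal M * φ a * (J * J) := by
        refine lintegral_congr fun a => ?_
        have h1 : ∀ y : ℝ, ∫⁻ z : ℝ, ENNReal.ofReal M * φ a *
          (ENNReal.ofReal ((1 + y ^ 2) ^ (-(s / 2) / 2)) *
            ENNReal.ofReal ((1 + z ^ 2) ^ (-(s / 2) / 2))) = ENNReal.ofReal M * φ a *
            (ENNReal.ofReal ((1 + y ^ 2) ^ (-(s / 2) / 2)) * J) := fun y => by
          rw [lintegral_const_mul _ (by fun_prop), lintegral_const_mul _ hJ]
        simp only [h1]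
        rw [lintegral_const_mul _ (by fun_prop), lintegral_mul_const _ hJ]
    _ = ENNReal.ofReal M * planeBound s * ∫⁻ x, φ x := by
        rw [lintegral_mul_const _ (by fun_prop), lintegral_const_mul _ hφ, planeBound, ← hJdef]
        ring

/-- A density bounded by `A` has potential at most `A |𝕊²|` plus its mass. -/
theorem potential_le_of_le {g : Vel → ℝ≥0∞} {A : ℝ≥0∞} (hg : ∀ᵐ w, g w ≤ A) (v : Vel) :
    potential g v ≤ A * surface univ + ∫⁻ w, g w := by
  have hχ : Measurable fun w : Vel => (Metric.ball v 1).indicator (fun _ => A) w :=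
    measurable_const.indicator Metric.isOpen_ball.measurableSet
  have h1 : potential g v ≤ potential ((Metric.ball v 1).indicator fun _ => A) v + ∫⁻ w, g w := by
    rw [potential, potential, ← lintegral_add_left (by fun_prop)]
    refine lintegral_mono_ae ?_
    filter_upwards [hg] with w hw
    by_cases hwv : w ∈ Metric.ball v 1
    · rw [indicator_of_mem hwv]
      exact (mul_le_mul_left hw _).trans le_self_add
    · refine le_trans ?_ le_add_self
      rw [Metric.mem_ball, dist_eq_norm, not_lt] at hwv
      refine mul_le_of_le_one_right' (ENNReal.inv_le_one.2 ?_)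
      rw [← ofReal_norm]
      exact ENNReal.one_le_ofReal.2 hwv
  refine h1.trans (add_le_add_left ?_ _)
  rw [potential_polar hχ]
  have h2 : ∀ n : UnitSphere, ∫⁻ r in Ioi (0 : ℝ), ENNReal.ofReal r *
      (Metric.ball v 1).indicator (fun _ => A) (v + r • (n : Vel)) ≤ A := by
    intro n
    have h3 : ∀ r ∈ Ioi (0 : ℝ), ENNReal.ofReal r *
        (Metric.ball v 1).indicator (fun _ => A) (v + r • (n : Vel)) =
        ENNReal.ofReal (r ^ 1) * (Iio (1 : ℝ)).indicator 1 r * A := by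
      intro r hr
      have hr' : (0 : ℝ) < r := hr
      have h4 : v + r • (n : Vel) ∈ Metric.ball v 1 ↔ r ∈ Iio (1 : ℝ) := by
        rw [Metric.mem_ball, dist_eq_norm, add_sub_cancel_left, norm_smul, norm_coe_unitSphere,
          mul_one, Real.norm_of_nonneg hr'.le, mem_Iio]
      by_cases h5 : r ∈ Iio (1 : ℝ)
      · rw [indicator_of_mem (h4.2 h5), indicator_of_mem h5, pow_one, Pi.one_apply, mul_one]
      · rw [indicator_of_notMem (fun h => h5 (h4.1 h)), indicator_of_notMem h5]
        simp
    have h6 : Measurable fun r : ℝ => ENNReal.ofReal (r ^ 1) * (Iio (1 : ℝ)).indicator 1 r :=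
      Measurable.mul (by fun_prop) (measurable_one.indicator measurableSet_Iio)
    rw [setLIntegral_congr_fun measurableSet_Ioi h3, lintegral_mul_const _ h6,
      lintegral_Ioi_pow_indicator]
    refine mul_le_of_le_one_left' ?_
    rw [ENNReal.ofReal_le_one]
    norm_num
  refine (lintegral_mono h2).trans ?_
  rw [lintegral_const]

/-- The integral `∫₀ᵗ e^{-r(t-τ)} dτ`: the time during which the gain accumulates when the loss
frequency is `r`. -/
noncomputable def memory (r t : ℝ) : ℝ≥0∞ :=
  ∫⁻ τ in Ioc 0 t, ENNReal.ofReal (Real.exp (-(r * (t - τ))))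

theorem memory_le_time {r : ℝ} (hr : 0 ≤ r) (t : ℝ) : memory r t ≤ ENNReal.ofReal t := by
  have : memory r t ≤ ∫⁻ τ in Ioc 0 t, 1 := by
    refine setLIntegral_mono measurable_const fun τ hτ => ?_
    rw [ENNReal.ofReal_le_one, Real.exp_le_one_iff]
    have := mul_nonneg hr (sub_nonneg.2 hτ.2)
    linarith
  refine this.trans ?_
  rw [lintegral_one, Measure.restrict_apply_univ, Real.volume_Ioc, sub_zero]

theorem memory_le_inv {r : ℝ} (hr : 0 < r) (t : ℝ) : memory r t ≤ ENNReal.ofReal (1 / r) := by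
  rcases le_or_gt t 0 with ht | ht
  · rw [memory, Ioc_eq_empty (not_lt.2 ht)]; simp
  have hd : ∀ τ ∈ uIcc 0 t, HasDerivAt (fun τ => 1 / r * Real.exp (-(r * (t - τ))))
      (Real.exp (-(r * (t - τ)))) τ := by
    intro τ _
    have h1 : HasDerivAt (fun τ => -(r * (t - τ))) r τ := by
      have := (((hasDerivAt_id τ).const_sub t).const_mul r).fun_neg
      simpa using this
    have h2 := h1.exp.const_mul (1 / r)
    rwa [mul_comm (Real.exp _) r, ← mul_assoc, one_div_mul_cancel hr.ne', one_mul] at h2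
  have hc : IntervalIntegrable (fun τ => Real.exp (-(r * (t - τ)))) volume 0 t :=
    Continuous.intervalIntegrable (by fun_prop) _ _
  rw [memory, ← ofReal_integral_eq_lintegral_ofReal
    ((intervalIntegrable_iff_integrableOn_Ioc_of_le ht.le).1 hc)
    (Eventually.of_forall fun τ => (Real.exp_pos _).le), ← intervalIntegral.integral_of_le ht.le,
    intervalIntegral.integral_eq_sub_of_hasDerivAt hd hc]
  refine ENNReal.ofReal_le_ofReal ?_
  have := Real.exp_pos (-(r * (t - 0)))
  have h3 : 0 < 1 / r := by positivity
  simp only [sub_self, mul_zero, neg_zero, Real.exp_zero, mul_one]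
  nlinarith [mul_pos h3 this]

theorem measurable_potential_param {X : Type*} [MeasurableSpace X] {g : X → Vel → ℝ≥0∞}
    (hg : Measurable (Function.uncurry g)) :
    Measurable fun p : X × Vel => potential (g p.1) p.2 := by
  have h1 : Measurable fun r : (X × Vel) × Vel => g r.1.1 r.2 * ‖r.2 - r.1.2‖ₑ⁻¹ :=
    Measurable.mul (hg.comp (by fun_prop : Measurable fun r : (X × Vel) × Vel => (r.1.1, r.2)))
      (by fun_prop)
  exact h1.lintegral_prod_right'

namespace IsSolution

variable {α : ℝ} {f₀ : Vel → ℝ} {f : ℝ → Vel → ℝ}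

/-- Duhamel's inequality with a velocity-dependent lower bound for the loss frequency. -/
theorem dens_le_duhamel (h : IsSolution α f₀ f) (hα : 0 < α) {t : ℝ} (ht : 0 ≤ t) {r : Vel → ℝ}
    (hr : ∀ v, 0 ≤ r v) :
    ∀ᵐ v, (∀ τ ∈ Ioc 0 t, ENNReal.ofReal (r v) ≤ lossL (dens f τ) v) →
      dens f t v ≤ dens f 0 v + ∫⁻ τ in Ioc 0 t, gainL α (dens f τ) (dens f τ) v *
        ENNReal.ofReal (Real.exp (-(r v * (t - τ)))) := by
  filter_upwards [h.isTrajectory hα, h.eq_zero_add ht] with v hv hvt hl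
  refine hv.le_duhamel ht hvt (hr v) (Eventually.of_forall fun τ hτ => ?_)
  rw [ENNReal.ofReal_mul (hr v), mul_comm]
  exact mul_le_mul_right (hl τ hτ) _

/-- Against a test function whose averages over post-collisional velocities are bounded by `B`, the
gain term of a density of mass one is at most `B`. -/
theorem lintegral_gainL_mul_le (h : IsSolution α f₀ f) (hα : 0 < α) (hn : IsNormalized f₀) {t : ℝ}
    (ht : 0 ≤ t) {ψ : Vel → ℝ≥0∞} (hψ : Measurable ψ) {B : ℝ≥0∞}
    (hB : ∀ v vs, postAvg α ψ v vs ≤ B) :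
    ∫⁻ v, gainL α (dens f t) (dens f t) v * ψ v ≤ B := by
  have hm := h.measurable_dens t
  have hmass := h.lintegral_dens hα hn ht
  calc ∫⁻ v, gainL α (dens f t) (dens f t) v * ψ v
      = ∫⁻ v, ∫⁻ vs, dens f t v * dens f t vs * postAvg α ψ v vs := lintegral_gainL_mul hα hm hm hψ
    _ ≤ ∫⁻ v, ∫⁻ vs, dens f t v * (dens f t vs * B) := by
        refine lintegral_mono fun v => lintegral_mono fun vs => ?_
        rw [mul_assoc]
        exact mul_le_mul_right (mul_le_mul_right (hB v vs) _) _
    _ = B := by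
        have : ∀ v, ∫⁻ vs, dens f t v * (dens f t vs * B) = dens f t v * B := fun v => by
          rw [lintegral_const_mul _ (by fun_prop), lintegral_mul_const _ hm, hmass, one_mul]
        simp only [this]
        rw [lintegral_mul_const _ hm, hmass, one_mul]

/-- Moments of a solution against a test function whose averages over post-collisional velocities
are bounded by `B`, where `r` is a lower bound for the loss frequency on the support of the test
function. -/
theorem lintegral_dens_mul_le (h : IsSolution α f₀ f) (hα : 0 < α) (hn : IsNormalized f₀) {t : ℝ}
    (ht : 0 ≤ t) {ψ : Vel → ℝ≥0∞} (hψ : Measurable ψ) {B : ℝ≥0∞}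
    (hB : ∀ v vs, postAvg α ψ v vs ≤ B) {r : ℝ} (hr : 0 ≤ r)
    (hl : ∀ v, ψ v ≠ 0 → ∀ τ ∈ Ioc 0 t, ENNReal.ofReal r ≤ lossL (dens f τ) v) :
    ∫⁻ v, dens f t v * ψ v ≤ (∫⁻ v, dens f 0 v * ψ v) + B * memory r t := by
  have hm0 := h.measurable_dens 0
  have hG : Measurable fun p : ℝ × Vel => gainL α (dens f p.1) (dens f p.1) p.2 *
      ENNReal.ofReal (Real.exp (-(r * (t - p.1)))) * ψ p.2 :=
    (h.measurable_gainL_dens_uncurry.mul (by fun_prop)).mul (hψ.comp measurable_snd)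
  have hG1 : ∀ v, Measurable fun τ => gainL α (dens f τ) (dens f τ) v *
      ENNReal.ofReal (Real.exp (-(r * (t - τ)))) := fun v =>
    (h.measurable_gainL_dens_uncurry.comp (f := fun τ => (τ, v)) measurable_prodMk_right).mul
      (by fun_prop)
  calc ∫⁻ v, dens f t v * ψ v
      ≤ ∫⁻ v, (dens f 0 v * ψ v + ∫⁻ τ in Ioc 0 t, gainL α (dens f τ) (dens f τ) v *
          ENNReal.ofReal (Real.exp (-(r * (t - τ)))) * ψ v) := by
        refine lintegral_mono_ae ?_
        filter_upwards [h.dens_le_duhamel hα ht (r := fun _ => r) fun _ => hr] with v hv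
        rcases eq_or_ne (ψ v) 0 with h0 | h0
        · simp [h0]
        rw [lintegral_mul_const _ (hG1 v), ← add_mul]
        exact mul_le_mul_left (hv (hl v h0)) _
    _ = (∫⁻ v, dens f 0 v * ψ v) + ∫⁻ τ in Ioc 0 t, ∫⁻ v, gainL α (dens f τ) (dens f τ) v *
          ENNReal.ofReal (Real.exp (-(r * (t - τ)))) * ψ v := by
        rw [lintegral_add_left (by fun_prop), lintegral_lintegral_swap
          (f := fun τ v => gainL α (dens f τ) (dens f τ) v *
          ENNReal.ofReal (Real.exp (-(r * (t - τ)))) * ψ v) hG.aemeasurable]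
    _ ≤ (∫⁻ v, dens f 0 v * ψ v) +
          ∫⁻ τ in Ioc 0 t, B * ENNReal.ofReal (Real.exp (-(r * (t - τ)))) := by
        refine add_le_add_right (setLIntegral_mono' measurableSet_Ioc fun τ hτ => ?_) _
        have hmg := h.measurable_gainL_dens τ
        simp only [mul_right_comm]
        rw [lintegral_mul_const _ (by fun_prop)]
        exact mul_le_mul_left (h.lintegral_gainL_mul_le hα hn hτ.1.le hψ hB) _
    _ = _ := by
        rw [lintegral_const_mul _ (by fun_prop), memory]

end IsSolution


/-! ### Pointwise bounds in terms of the accumulation time of the gain -/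

/-- Up to time `t` the loss frequency is bounded below by some `r ≥ 0`, uniformly in the velocity,
in such a way that the gain accumulates during a time `T` at most. -/
def AccumulationBound (f : ℝ → Vel → ℝ) (t T : ℝ) : Prop :=
  ∃ r : ℝ, 0 ≤ r ∧ (∀ τ ∈ Ioc 0 t, ∀ v, ENNReal.ofReal r ≤ lossL (dens f τ) v) ∧
    ∀ τ ∈ Icc 0 t, memory r τ ≤ ENNReal.ofReal T

theorem accumulationBound_time (f : ℝ → Vel → ℝ) (t : ℝ) : AccumulationBound f t t :=
  ⟨0, le_rfl, fun _ _ _ => by simp, fun τ hτ =>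
    (memory_le_time le_rfl τ).trans (ENNReal.ofReal_le_ofReal hτ.2)⟩

theorem accumulationBound_inv {f : ℝ → Vel → ℝ} {t r : ℝ} (hr : 0 < r)
    (h : ∀ τ ∈ Ioc 0 t, ∀ v, ENNReal.ofReal r ≤ lossL (dens f τ) v) :
    AccumulationBound f t (1 / r) :=
  ⟨r, hr.le, h, fun τ _ => memory_le_inv hr τ⟩

theorem AccumulationBound.anti {f : ℝ → Vel → ℝ} {t t' T : ℝ} (h : AccumulationBound f t T)
    (ht : t' ≤ t) : AccumulationBound f t' T := by
  obtain ⟨r, h0, h1, h2⟩ := h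
  exact ⟨r, h0, fun τ hτ => h1 τ ⟨hτ.1, hτ.2.trans ht⟩, fun τ hτ => h2 τ ⟨hτ.1, hτ.2.trans ht⟩⟩

/-- The density `g` is bounded by `M (1 + |v|²)^(-s/2)`. -/
def DecayLE (g : Vel → ℝ≥0∞) (M s : ℝ) : Prop :=
  ∀ᵐ v, g v ≤ ENNReal.ofReal (M * (1 + ‖v‖ ^ 2) ^ (-(s / 2)))

theorem japanese_le_one {s : ℝ} (hs : 2 < s) (v : Vel) : (1 + ‖v‖ ^ 2) ^ (-(s / 2)) ≤ 1 :=
  Real.rpow_le_one_of_one_le_of_nonpos (by nlinarith [norm_nonneg v]) (by linarith)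

theorem japanese_le_inv {s : ℝ} (hs : 2 < s) (v : Vel) :
    (1 + ‖v‖ ^ 2) ^ (-(s / 2)) ≤ (1 + ‖v‖ ^ 2)⁻¹ := by
  rw [← Real.rpow_neg_one]
  exact Real.rpow_le_rpow_of_exponent_le (by nlinarith [norm_nonneg v]) (by linarith)

namespace IsSolution

variable {α : ℝ} {f₀ : Vel → ℝ} {f : ℝ → Vel → ℝ}

/-- The marginals grow at most linearly in the accumulation time. -/
theorem marginalLE (h : IsSolution α f₀ f) (hα : 0 < α) (hn : IsNormalized f₀) {M s : ℝ}
    (hM : 0 ≤ M) (hs : 2 < s) (hd : DecayLE (dens f 0) M s) {t T : ℝ} (ht : 0 ≤ t)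
    (hT : AccumulationBound f t T) : MarginalLE (dens f t)
      (ENNReal.ofReal M * planeBound s + ENNReal.ofReal (2 * Real.pi) * ENNReal.ofReal T) := by
  obtain ⟨r, hr, hl, hmem⟩ := hT
  intro e he φ hφ
  have key := h.lintegral_dens_mul_le hα hn ht (ψ := fun v => φ (inner ℝ v e)) (by fun_prop)
    (fun v vs => lintegral_post_marginal_le hα v vs he hφ) hr (fun v _ τ hτ => hl τ hτ v)
  refine key.trans ?_
  rw [add_mul]
  refine add_le_add (marginalLE_of_le hM hs hd e he φ hφ) ?_
  rw [mul_right_comm]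
  exact mul_le_mul_left (mul_le_mul_right (hmem t ⟨ht, le_rfl⟩) _) _

/-- The potential grows at most linearly in the accumulation time. -/
theorem potential_le (h : IsSolution α f₀ f) (hα : 0 < α) (hn : IsNormalized f₀) {M s : ℝ}
    (hM : 0 ≤ M) (hs : 2 < s) (hd : DecayLE (dens f 0) M s) {t T : ℝ} (ht : 0 ≤ t)
    (hT : AccumulationBound f t T) (v : Vel) : potential (dens f t) v ≤
      ENNReal.ofReal M * surface univ + 1 +
        ENNReal.ofReal (2 * Real.pi ^ 2) * ENNReal.ofReal T := by
  obtain ⟨r, hr, hl, hmem⟩ := hT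
  have key := h.lintegral_dens_mul_le hα hn ht (ψ := fun w => ‖w - v‖ₑ⁻¹) (by fun_prop)
    (fun w ws => lintegral_post_potential_le hα w ws v) hr (fun v _ τ hτ => hl τ hτ v)
  refine key.trans (add_le_add ?_ (mul_le_mul_right (hmem t ⟨ht, le_rfl⟩) _))
  rw [← h.lintegral_dens hα hn le_rfl]
  refine potential_le_of_le ?_ v
  filter_upwards [hd] with w hw
  refine hw.trans (ENNReal.ofReal_le_ofReal ?_)
  exact mul_le_of_le_one_right hM (japanese_le_one hs w)

/-- Decay of the potential, uniformly in time: near `v` the loss frequency is at least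
`π |v|/2`. -/
theorem potential_le_div (h : IsSolution α f₀ f) (hα : 0 < α) (hα1 : α ≤ 1) (hn : IsNormalized f₀)
    {M s : ℝ} (hM : 0 ≤ M) (hs : 2 < s) (hd : DecayLE (dens f 0) M s) {t : ℝ} (ht : 0 ≤ t) {v : Vel}
    (hv : v ≠ 0) : potential (dens f t) v ≤
      ENNReal.ofReal (1 / ‖v‖) * (ENNReal.ofReal (2 * M) * surface univ +
        ENNReal.ofReal (4 + 4 * Real.pi)) := by
  have hv' : 0 < ‖v‖ := norm_pos_iff.2 hv
  have hm := h.measurable_dens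
  set E : Set Vel := {w | ‖v‖ / 2 ≤ ‖w‖} with hE
  have hEm : MeasurableSet E := measurableSet_le measurable_const measurable_norm
  set ψ : Vel → ℝ≥0∞ := E.indicator fun w => ‖w - v‖ₑ⁻¹ with hψ
  have hψm : Measurable ψ := Measurable.indicator (by fun_prop) hEm
  -- outside `E` the distance to `v` is at least `|v|/2`
  have h1 : potential (dens f t) v ≤ ENNReal.ofReal (2 / ‖v‖) + ∫⁻ w, dens f t w * ψ w := by
    have e1 : ENNReal.ofReal (2 / ‖v‖) = ∫⁻ w, dens f t w * ENNReal.ofReal (2 / ‖v‖) := by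
      rw [lintegral_mul_const _ (hm t), h.lintegral_dens hα hn ht, one_mul]
    rw [e1, potential, ← lintegral_add_left (by have := hm t; fun_prop)]
    refine lintegral_mono fun w => ?_
    rw [← mul_add]
    refine mul_le_mul_right ?_ _
    by_cases hw : w ∈ E
    · rw [hψ, indicator_of_mem hw]; exact le_add_self
    · refine le_trans ?_ le_self_add
      have hw' : ‖w‖ < ‖v‖ / 2 := not_le.1 hw
      have h2 : ‖v‖ / 2 ≤ ‖w - v‖ := by
        have := norm_sub_norm_le v w
        rw [norm_sub_rev] at this
        linarith
      rw [← ofReal_norm, ← ENNReal.ofReal_inv_of_pos (by linarith)]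
      refine ENNReal.ofReal_le_ofReal ?_
      rw [← inv_div]
      exact inv_anti₀ (by positivity) h2
  have hB : ∀ w ws, postAvg α ψ w ws ≤ ENNReal.ofReal (2 * Real.pi ^ 2) := fun w ws => by
    refine le_trans ?_ (lintegral_post_potential_le hα w ws v)
    exact lintegral_mono fun n => mul_le_mul_right (indicator_le_self _ _ _) _
  have hr : 0 < Real.pi * (‖v‖ / 2) := by positivity
  have key := h.lintegral_dens_mul_le hα hn ht hψm hB hr.le (fun w hw τ hτ => by
    refine le_trans (ENNReal.ofReal_le_ofReal ?_) (h.le_lossL hα hα1 hn hτ.1.le w)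
    have hwE : w ∈ E := mem_of_indicator_ne_zero hw
    exact mul_le_mul_of_nonneg_left hwE Real.pi_pos.le)
  -- the initial datum restricted to `E` is bounded by `2M/|v|` and has mass at most `2/|v|`
  have h0 : ∫⁻ w, dens f 0 w * ψ w ≤
      ENNReal.ofReal (2 * M / ‖v‖) * surface univ + ENNReal.ofReal (2 / ‖v‖) := by
    have e1 : ∀ w, dens f 0 w * ψ w = E.indicator (dens f 0) w * ‖w - v‖ₑ⁻¹ := fun w => by
      by_cases hw : w ∈ E
      · rw [hψ, indicator_of_mem hw, indicator_of_mem hw]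
      · rw [hψ, indicator_of_notMem hw, indicator_of_notMem hw, mul_zero, zero_mul]
    simp only [e1]
    refine (potential_le_of_le (g := E.indicator (dens f 0)) (A := ENNReal.ofReal (2 * M / ‖v‖))
      ?_ v).trans (add_le_add_right ?_ _)
    · filter_upwards [hd] with w hw
      by_cases hwE : w ∈ E
      · rw [indicator_of_mem hwE]
        refine hw.trans (ENNReal.ofReal_le_ofReal ?_)
        have h3 : ‖v‖ / 2 ≤ ‖w‖ := hwE
        have h4 : (1 + ‖w‖ ^ 2)⁻¹ ≤ (‖v‖ / 2)⁻¹ :=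
          inv_anti₀ (by positivity) (by nlinarith [sq_nonneg (‖w‖ - 1)])
        refine (mul_le_mul_of_nonneg_left ((japanese_le_inv hs w).trans h4) hM).trans (le_of_eq ?_)
        field_simp
      · rw [indicator_of_notMem hwE]; exact zero_le
    · calc ∫⁻ w, E.indicator (dens f 0) w
          ≤ ∫⁻ w, dens f 0 w * ENNReal.ofReal (1 + ‖w‖ ^ 2) * ENNReal.ofReal (1 / ‖v‖) := by
            refine lintegral_mono fun w => ?_
            by_cases hwE : w ∈ E
            · rw [indicator_of_mem hwE, mul_assoc, ← ENNReal.ofReal_mul (by positivity)]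
              refine le_mul_of_one_le_right' (ENNReal.one_le_ofReal.2 ?_)
              have h3 : ‖v‖ / 2 ≤ ‖w‖ := hwE
              rw [mul_one_div, le_div_iff₀ hv']
              nlinarith [sq_nonneg (‖w‖ - 1)]
            · rw [indicator_of_notMem hwE]; exact zero_le
        _ ≤ 2 * ENNReal.ofReal (1 / ‖v‖) := by
            have := hm 0
            rw [lintegral_mul_const _ (by fun_prop)]
            exact mul_le_mul_left (h.lintegral_moment_le hα hα1 hn le_rfl) _
        _ = ENNReal.ofReal (2 / ‖v‖) := by
            rw [← mul_one_div 2 ‖v‖, ENNReal.ofReal_mul zero_le_two, ENNReal.ofReal_ofNat]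
  calc potential (dens f t) v
      ≤ ENNReal.ofReal (2 / ‖v‖) + (ENNReal.ofReal (2 * M / ‖v‖) * surface univ +
          ENNReal.ofReal (2 / ‖v‖) + ENNReal.ofReal (2 * Real.pi ^ 2) *
            ENNReal.ofReal (1 / (Real.pi * (‖v‖ / 2)))) :=
        h1.trans (add_le_add_right (key.trans (add_le_add h0
          (mul_le_mul_right (memory_le_inv hr t) _))) _)
    _ = ENNReal.ofReal (2 * M / ‖v‖) * surface univ + (ENNReal.ofReal (2 / ‖v‖) +
          ENNReal.ofReal (2 / ‖v‖) + ENNReal.ofReal (2 * Real.pi ^ 2) *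
            ENNReal.ofReal (1 / (Real.pi * (‖v‖ / 2)))) := by ring
    _ = _ := by
        rw [mul_add, ← mul_assoc, ← ENNReal.ofReal_mul (by positivity),
          ← ENNReal.ofReal_mul (by positivity), ← ENNReal.ofReal_mul (by positivity),
          ← ENNReal.ofReal_add (by positivity) (by positivity),
          ← ENNReal.ofReal_add (by positivity) (by positivity)]
        congr 3
        · ring
        · field_simp
          ring

/-- Pointwise bound by Duhamel's formula, where the gain term is estimated by the product of a bound
`P` for the marginals and a bound `V` for the potential. -/
theorem dens_le_of_marginal_potential (h : IsSolution α f₀ f) (hα : 0 < α) (hn : IsNormalized f₀)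
    {t : ℝ} (ht : 0 ≤ t) {P : ℝ≥0∞} (hP : ∀ τ ∈ Icc 0 t, MarginalLE (dens f τ) P)
    {r : Vel → ℝ} (hr : ∀ v, 0 ≤ r v) :
    ∀ᵐ v, ∀ V : ℝ≥0∞, (∀ τ ∈ Ioc 0 t, potential (dens f τ) v ≤ V) →
      (∀ τ ∈ Ioc 0 t, ENNReal.ofReal (r v) ≤ lossL (dens f τ) v) →
      dens f t v ≤ dens f 0 v + 4 * P * V * memory (r v) t := by
  have hgain : ∀ᵐ v, ∀ᵐ τ : ℝ, 0 < τ → (τ ≤ t → gainL α (dens f τ) (dens f τ) v ≤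
      4 * P * potential (dens f τ) v) := by
    refine ae_ae_of_forall_pos (p := fun τ v => τ ≤ t → gainL α (dens f τ) (dens f τ) v ≤
      4 * P * potential (dens f τ) v) ?_ ?_
    · have h1 : MeasurableSet {x : ℝ × Vel | gainL α (dens f x.1) (dens f x.1) x.2 ≤
          4 * P * potential (dens f x.1) x.2} :=
        measurableSet_le h.measurable_gainL_dens_uncurry
          ((measurable_potential_param h.measurable_dens_uncurry).const_mul _)
      have h2 : MeasurableSet {x : ℝ × Vel | x.1 ≤ t} :=
        measurableSet_le measurable_fst measurable_const
      convert h2.compl.union h1 using 1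
      ext x
      simp [imp_iff_not_or]
    · intro τ hτ
      by_cases hτt : τ ≤ t
      · filter_upwards [gainL_le_of_marginalLE hα (h.measurable_dens τ) (h.measurable_dens τ)
          (fun _ => ENNReal.ofReal_ne_top)
          (by rw [h.lintegral_dens hα hn hτ]; exact ENNReal.one_ne_top)
          (hP τ ⟨hτ, hτt⟩)] with v hv _ using hv
      · exact Eventually.of_forall fun v h' => absurd h' hτt
  filter_upwards [hgain, h.dens_le_duhamel hα ht hr] with v hg hduh V hV hl
  refine (hduh hl).trans (add_le_add_right ?_ _)
  calc ∫⁻ τ in Ioc 0 t, gainL α (dens f τ) (dens f τ) v *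
        ENNReal.ofReal (Real.exp (-(r v * (t - τ))))
      ≤ ∫⁻ τ in Ioc 0 t, 4 * P * V * ENNReal.ofReal (Real.exp (-(r v * (t - τ)))) := by
        refine setLIntegral_mono_ae' measurableSet_Ioc ?_
        filter_upwards [hg] with τ hτ hτ'
        exact mul_le_mul_left ((hτ hτ'.1 hτ'.2).trans (mul_le_mul_right (hV τ hτ') _)) _
    _ = _ := by rw [lintegral_const_mul _ (by fun_prop), memory]

theorem dens_zero_decay (h : IsSolution α f₀ f) {s : ℝ} (hw : MemWeightedLp ∞ s f₀) :
    DecayLE (dens f 0) (weightedNorm ∞ s f₀).toReal s := by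
  have h1 : ∀ᵐ v : Vel, ‖f₀ v * (1 + ‖v‖ ^ 2) ^ (s / 2)‖ₑ ≤ weightedNorm ∞ s f₀ := by
    rw [weightedNorm, eLpNorm_exponent_top]
    exact ae_le_eLpNormEssSup
  filter_upwards [h1, h.dens_zero] with v hv h0
  have hp : 0 < (1 + ‖v‖ ^ 2) ^ (s / 2) := by positivity
  rw [h0, Real.rpow_neg (by positivity)]
  refine ENNReal.ofReal_le_ofReal ?_
  rw [← div_eq_mul_inv, le_div_iff₀ hp]
  refine (le_abs_self _).trans ?_
  rw [← Real.norm_eq_abs, ← toReal_enorm]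
  exact ENNReal.toReal_mono hw.2.ne hv

end IsSolution

/-- Pointwise bounds for solutions whose gain accumulates during a time `T`. -/
theorem exists_pointwise_bound {s : ℝ} (hs : 2 < s) {M : ℝ} (hM : 0 ≤ M) :
    ∃ A : ℝ, 0 < A ∧ ∀ (α : ℝ) (f₀ : Vel → ℝ) (f : ℝ → Vel → ℝ), IsSolution α f₀ f → 0 < α →
      α ≤ 1 → IsNormalized f₀ → DecayLE (dens f 0) M s → ∀ t T : ℝ, 0 ≤ t → 0 ≤ T →
      AccumulationBound f t T → ∀ᵐ v, f t v ≤ A * (1 + T) ^ 3 ∧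
        (v ≠ 0 → f t v ≤ A * (1 + T) / ‖v‖ ^ 2) := by
  have hpi := Real.pi_pos
  obtain ⟨p, hp⟩ : ∃ p : ℝ, p = (planeBound s).toReal := ⟨_, rfl⟩
  obtain ⟨S, hS⟩ : ∃ S : ℝ, S = (surface univ).toReal := ⟨_, rfl⟩
  have hp0 : 0 ≤ p := hp ▸ ENNReal.toReal_nonneg
  have hS0 : 0 ≤ S := hS ▸ ENNReal.toReal_nonneg
  have hp' : planeBound s = ENNReal.ofReal p := by
    rw [hp, ENNReal.ofReal_toReal (planeBound_ne_top hs)]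
  have hS' : surface univ = ENNReal.ofReal S := by
    rw [hS, ENNReal.ofReal_toReal (measure_ne_top _ _)]
  set a : ℝ := M * p + 2 * Real.pi with ha
  set b : ℝ := M * S + 1 + 2 * Real.pi ^ 2 with hb
  set k : ℝ := 2 * M * S + (4 + 4 * Real.pi) with hk
  have ha0 : 0 < a := by positivity
  have hb0 : 0 < b := by positivity
  have hk0 : 0 < k := by positivity
  -- marginals, potential and accumulation time each contribute a factor `1 + T` to the first bound;
  -- away from `v = 0` potential and accumulation time are at most of order `1/|v|` instead
  refine ⟨M + 4 * a * b + 4 * a * k, by positivity, ?_⟩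
  intro α f₀ f h hα hα1 hn hd t T ht hT hacc
  have hP : ∀ τ ∈ Icc 0 t, MarginalLE (dens f τ) (ENNReal.ofReal (a * (1 + T))) := by
    intro τ hτ
    refine (h.marginalLE hα hn hM hs hd hτ.1 (hacc.anti hτ.2)).mono ?_
    rw [hp', ← ENNReal.ofReal_mul hM, ← ENNReal.ofReal_mul (by positivity),
      ← ENNReal.ofReal_add (by positivity) (by positivity)]
    refine ENNReal.ofReal_le_ofReal ?_
    rw [ha]
    nlinarith [mul_nonneg (mul_nonneg hM hp0) hT]
  have hV : ∀ τ ∈ Ioc 0 t, ∀ v, potential (dens f τ) v ≤ ENNReal.ofReal (b * (1 + T)) := by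
    intro τ hτ v
    refine (h.potential_le hα hn hM hs hd hτ.1.le (hacc.anti hτ.2) v).trans ?_
    rw [hS', ← ENNReal.ofReal_mul hM, ← ENNReal.ofReal_mul (by positivity), ← ENNReal.ofReal_one,
      ← ENNReal.ofReal_add (by positivity) (by positivity),
      ← ENNReal.ofReal_add (by positivity) (by positivity)]
    refine ENNReal.ofReal_le_ofReal ?_
    rw [hb]
    nlinarith [mul_nonneg (mul_nonneg hM hS0) hT]
  have hU : ∀ v : Vel, v ≠ 0 → ∀ τ ∈ Ioc 0 t,
      potential (dens f τ) v ≤ ENNReal.ofReal (1 / ‖v‖ * k) := by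
    intro v hv τ hτ
    refine (h.potential_le_div hα hα1 hn hM hs hd hτ.1.le hv).trans (le_of_eq ?_)
    rw [hS', ← ENNReal.ofReal_mul (by positivity),
      ← ENNReal.ofReal_add (by positivity) (by positivity), ← ENNReal.ofReal_mul (by positivity)]
  obtain ⟨r, hr, hl, hmem⟩ := hacc
  filter_upwards [hd, h.dens_le_of_marginal_potential hα hn ht hP (r := fun _ => r) (fun _ => hr),
    h.dens_le_of_marginal_potential hα hn ht hP (r := fun v => Real.pi * ‖v‖)
      (fun v => by positivity)] with v h0 h1 h2
  have e4 : (4 : ℝ≥0∞) = ENNReal.ofReal 4 := by simp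
  have hT1 : (1 : ℝ) ≤ 1 + T := by linarith
  constructor
  · have h3 := (h1 _ (fun τ hτ => hV τ hτ v) (fun τ hτ => hl τ hτ v)).trans (add_le_add h0
      (mul_le_mul_right (hmem t ⟨ht, le_rfl⟩) _))
    rw [e4, ← ENNReal.ofReal_mul (by positivity), ← ENNReal.ofReal_mul (by positivity),
      ← ENNReal.ofReal_mul (by positivity), ← ENNReal.ofReal_add (by positivity) (by positivity)]
      at h3
    have h4 := (ENNReal.ofReal_le_ofReal_iff (by positivity)).1 h3
    have h5 : M * (1 + ‖v‖ ^ 2) ^ (-(s / 2)) ≤ M * (1 + T) ^ 3 :=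
      mul_le_mul_of_nonneg_left ((japanese_le_one hs v).trans (one_le_pow₀ hT1)) hM
    have h6 : 4 * (a * (1 + T)) * (b * (1 + T)) * T ≤ 4 * a * b * (1 + T) ^ 3 := by
      calc 4 * (a * (1 + T)) * (b * (1 + T)) * T
          ≤ 4 * (a * (1 + T)) * (b * (1 + T)) * (1 + T) := by gcongr; linarith
        _ = _ := by ring
    have h7 : 0 ≤ 4 * a * k * (1 + T) ^ 3 := by positivity
    linarith
  · intro hv
    have hv' : 0 < ‖v‖ := norm_pos_iff.2 hv
    have h3 := (h2 _ (hU v hv) (fun τ hτ => h.le_lossL hα hα1 hn hτ.1.le v)).trans (add_le_add h0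
      (mul_le_mul_right (memory_le_inv (by positivity) t) _))
    rw [e4, ← ENNReal.ofReal_mul (by positivity), ← ENNReal.ofReal_mul (by positivity),
      ← ENNReal.ofReal_mul (by positivity), ← ENNReal.ofReal_add (by positivity) (by positivity)]
      at h3
    have h4 := (ENNReal.ofReal_le_ofReal_iff (by positivity)).1 h3
    have h5 : M * (1 + ‖v‖ ^ 2) ^ (-(s / 2)) ≤ M * (1 + T) / ‖v‖ ^ 2 := by
      rw [mul_div_assoc]
      refine mul_le_mul_of_nonneg_left ((japanese_le_inv hs v).trans ?_) hM
      rw [← one_div]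
      gcongr
      linarith
    have h6 : 4 * (a * (1 + T)) * (1 / ‖v‖ * k) * (1 / (Real.pi * ‖v‖)) ≤
        4 * a * k * (1 + T) / ‖v‖ ^ 2 := by
      have h8 : 4 * (a * (1 + T)) * (1 / ‖v‖ * k) * (1 / (Real.pi * ‖v‖)) =
          4 * a * k * (1 + T) / ‖v‖ ^ 2 * (1 / Real.pi) := by field_simp
      rw [h8]
      refine mul_le_of_le_one_right (by positivity) ?_
      rw [div_le_one hpi]
      linarith [Real.pi_gt_three]
    have h7 : 0 ≤ 4 * a * b * (1 + T) / ‖v‖ ^ 2 := by positivity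
    have h8 : (M + 4 * a * b + 4 * a * k) * (1 + T) / ‖v‖ ^ 2 = M * (1 + T) / ‖v‖ ^ 2 +
        4 * a * b * (1 + T) / ‖v‖ ^ 2 + 4 * a * k * (1 + T) / ‖v‖ ^ 2 := by ring
    linarith


/-! ### Relative entropy -/

theorem lintegral_mul_lossL {g : Vel → ℝ≥0∞} (hg : Measurable g) :
    ∫⁻ v, g v * lossL g v = ∫⁻ v, ∫⁻ vs, ∫⁻ n : UnitSphere,
      ENNReal.ofReal (inner ℝ (v - vs) (n : Vel)) * (g v * g vs) ∂surface := by
  refine lintegral_congr fun v => ?_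
  rw [lossL, ← lintegral_const_mul _ (by fun_prop)]
  refine lintegral_congr fun vs => ?_
  rw [lintegral_mul_const _ (by fun_prop), lintegral_surface_inner_pos]
  ring

/-- The change of variables from pre-collisional to post-collisional velocities. -/
theorem lintegral_post_postStar {α : ℝ} (hα : 0 < α) {k : Vel → ℝ≥0∞} (hk : Measurable k) :
    ∫⁻ v, ∫⁻ vs, ∫⁻ n : UnitSphere, ENNReal.ofReal (inner ℝ (v - vs) (n : Vel)) *
        (k (post α v vs n) * k (postStar α v vs n)) ∂surface =
      ENNReal.ofReal (1 / α ^ 2) * ∫⁻ v, k v * lossL k v := by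
  have hR : ∫⁻ v, k v * lossL k v = ∫⁻ v, ∫⁻ vs, ∫⁻ n : UnitSphere,
      ENNReal.ofReal (inner ℝ (vs - v) (n : Vel)) * (k v * k vs) ∂surface := by
    refine lintegral_congr fun v => ?_
    rw [lossL, ← lintegral_const_mul _ (by fun_prop)]
    refine lintegral_congr fun vs => ?_
    rw [lintegral_mul_const _ (by fun_prop), lintegral_surface_inner_pos, norm_sub_rev]
    ring
  rw [hR, lintegral_surface_outer (F := fun v vs n => ENNReal.ofReal (inner ℝ (v - vs) n) *
        (k (post α v vs n) * k (postStar α v vs n))) (by fun_prop),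
    lintegral_surface_outer (F := fun v vs n => ENNReal.ofReal (inner ℝ (vs - v) n) *
        (k v * k vs)) (by fun_prop), ← lintegral_const_mul]
  swap
  · refine Measurable.lintegral_prod_right' (f := fun q : UnitSphere × (Vel × Vel) =>
      ENNReal.ofReal (inner ℝ (q.2.2 - q.2.1) (q.1 : Vel)) * (k q.2.1 * k q.2.2)) ?_
    fun_prop
  refine lintegral_congr fun n => ?_
  have hn := norm_coe_unitSphere n
  have h3 := lintegral_pre_preStar hα hn (H := fun p => ENNReal.ofReal
      (inner ℝ (p.1 - p.2) (n : Vel)) * (k (post α p.1 p.2 n) * k (postStar α p.1 p.2 n)))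
      (by fun_prop)
  simp only [inner_pre_sub_preStar hα _ _ hn, post_pre hα _ _ hn, postStar_pre hα _ _ hn,
    ENNReal.ofReal_mul (inv_nonneg.2 hα.le), mul_assoc] at h3
  rw [lintegral_const_mul _ (by fun_prop)] at h3
  rw [show 1 / α ^ 2 = α⁻¹ * α⁻¹ by field_simp, ENNReal.ofReal_mul (by positivity), mul_assoc, h3,
    ← mul_assoc, ← ENNReal.ofReal_mul (by positivity), inv_mul_cancel₀ hα.ne']
  simp

/-- The Gaussian reference density `δ e^{-|v|²}`. -/
noncomputable def gaussian (δ : ℝ) (v : Vel) : ℝ := δ * Real.exp (-‖v‖ ^ 2)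

/-- The entropy density of `x + η` relative to `η`, normalised to vanish at `x = 0`. -/
noncomputable def entropyFn (η x : ℝ) : ℝ := (x + η) * Real.log ((x + η) / η) - x

theorem gaussian_pos {δ : ℝ} (hδ : 0 < δ) (v : Vel) : 0 < gaussian δ v := by
  unfold gaussian; positivity

@[fun_prop]
theorem measurable_gaussian (δ : ℝ) : Measurable (gaussian δ) := by
  unfold gaussian; fun_prop

theorem log_add_div_nonneg {η x : ℝ} (hη : 0 < η) (hx : 0 ≤ x) : 0 ≤ Real.log ((x + η) / η) :=
  Real.log_nonneg (by rw [le_div_iff₀ hη]; linarith)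

theorem hasDerivAt_entropyFn {η x : ℝ} (hη : 0 < η) (hx : 0 ≤ x) :
    HasDerivAt (entropyFn η) (Real.log ((x + η) / η)) x := by
  have h1 : HasDerivAt (fun x => x + η) 1 x := (hasDerivAt_id x).add_const η
  have h2 : HasDerivAt (fun x => (x + η) / η) (1 / η) x := h1.div_const η
  have h3 := h2.log (by positivity)
  refine HasDerivAt.congr_deriv (f := entropyFn η) ((h1.mul h3).sub (hasDerivAt_id x)) ?_
  have h4 : x + η ≠ 0 := by positivity
  field_simp
  ring

/-- Young's inequality for the entropy density and its conjugate function. -/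
theorem mul_le_entropyFn_add {η x : ℝ} (hη : 0 < η) (hx : 0 ≤ x) {p : ℝ} (hp : 0 ≤ p) :
    x * p ≤ entropyFn η x + η * Real.exp p := by
  have hxη : 0 < x + η := by linarith
  -- the tangent inequality for the exponential at `log ((x + η) / η)`
  have h1 := Real.add_one_le_exp (p - Real.log ((x + η) / η))
  rw [Real.exp_sub, Real.exp_log (by positivity)] at h1
  have h2 : (x + η) * (p - Real.log ((x + η) / η) + 1) ≤ η * Real.exp p := by
    calc (x + η) * (p - Real.log ((x + η) / η) + 1)
        ≤ (x + η) * (Real.exp p / ((x + η) / η)) := by gcongr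
      _ = η * Real.exp p := by field_simp
  rw [entropyFn]
  nlinarith [mul_nonneg hη.le hp]

theorem entropyFn_nonneg {η x : ℝ} (hη : 0 < η) (hx : 0 ≤ x) : 0 ≤ entropyFn η x := by
  have hxη : 0 < x + η := by linarith
  have h1 := Real.one_sub_inv_le_log_of_pos (x := (x + η) / η) (by positivity)
  have h2 : (x + η) * (1 - ((x + η) / η)⁻¹) ≤ (x + η) * Real.log ((x + η) / η) := by gcongr
  have h3 : (x + η) * (1 - ((x + η) / η)⁻¹) = x := by field_simp; ring
  rw [entropyFn]
  linarith

theorem entropyFn_le {η x : ℝ} (hη : 0 < η) (hx : 0 ≤ x) :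
    entropyFn η x ≤ x * Real.log ((x + η) / η) := by
  have h1 := Real.log_le_sub_one_of_pos (x := (x + η) / η) (by positivity)
  have h2 : η * Real.log ((x + η) / η) ≤ x := by
    calc η * Real.log ((x + η) / η) ≤ η * ((x + η) / η - 1) := by gcongr
      _ = x := by field_simp; ring
  rw [entropyFn]
  linarith

theorem log_gaussian_le {δ A x : ℝ} (hδ : 0 < δ) (hδ1 : δ ≤ 1) (hx : 0 ≤ x) (hxA : x ≤ A)
    (v : Vel) : Real.log ((x + gaussian δ v) / gaussian δ v) ≤
      Real.log (1 + A) + Real.log (1 / δ) + ‖v‖ ^ 2 := by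
  have hg := gaussian_pos hδ v
  have h1 : gaussian δ v ≤ 1 := by
    unfold gaussian
    exact mul_le_one₀ hδ1 (Real.exp_pos _).le (by
      rw [Real.exp_le_one_iff]; nlinarith [norm_nonneg v])
  rw [Real.log_div (by positivity) hg.ne', one_div, Real.log_inv]
  have h2 : Real.log (gaussian δ v) = Real.log δ - ‖v‖ ^ 2 := by
    unfold gaussian
    rw [Real.log_mul hδ.ne' (Real.exp_pos _).ne', Real.log_exp]
    ring
  have h3 : Real.log (x + gaussian δ v) ≤ Real.log (1 + A) :=
    Real.log_le_log (by positivity) (by linarith)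
  linarith

/-- The entropy inequality for one collision. Here `a`, `a'` are the values of the density and `e`,
`e'` those of the Gaussian at the colliding velocities, `b`, `b'` and `d`, `d'` the values at the
outgoing velocities. -/
theorem entropy_collision_le {a a' b b' e e' d d' : ℝ} (ha : 0 ≤ a) (ha' : 0 ≤ a') (hb : 0 ≤ b)
    (hb' : 0 ≤ b') (he : 0 < e) (he' : 0 < e') (hd : 0 < d) (hd' : 0 < d')
    (hed : e * e' ≤ d * d') :
    a * a' * (Real.log ((b + d) / d) + Real.log ((b' + d') / d')) + a * a' ≤
      a * a' * (Real.log ((a + e) / e) + Real.log ((a' + e') / e')) + (b + d) * (b' + d') := by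
  have hX : 0 < (a + e) * (a' + e') := by positivity
  have hY : 0 < (b + d) * (b' + d') := by positivity
  have hl1 : Real.log (e * e') ≤ Real.log (d * d') := Real.log_le_log (by positivity) hed
  have hl2 := Real.log_le_sub_one_of_pos (div_pos hY hX)
  rw [Real.log_div hY.ne' hX.ne'] at hl2
  rw [Real.log_div (by positivity) (by positivity), Real.log_div (by positivity) (by positivity),
    Real.log_div (by positivity) (by positivity), Real.log_div (by positivity) (by positivity)]
  rw [Real.log_mul (by positivity) (by positivity), Real.log_mul (by positivity) (by positivity)]
    at hl1 hl2
  have haa : 0 ≤ a * a' := mul_nonneg ha ha'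
  have h3 : a * a' * ((b + d) * (b' + d') / ((a + e) * (a' + e'))) ≤ (b + d) * (b' + d') := by
    rw [← mul_div_assoc, div_le_iff₀ hX, mul_comm]
    refine mul_le_mul_of_nonneg_left ?_ hY.le
    nlinarith
  nlinarith [mul_le_mul_of_nonneg_left hl1 haa, mul_le_mul_of_nonneg_left hl2 haa]

theorem lintegral_triple_add {A B : Vel → Vel → UnitSphere → ℝ≥0∞}
    (hB : Measurable fun q : (Vel × Vel) × UnitSphere => B q.1.1 q.1.2 q.2) :
    (∫⁻ v, ∫⁻ vs, ∫⁻ n : UnitSphere, A v vs n ∂surface) +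
        ∫⁻ v, ∫⁻ vs, ∫⁻ n : UnitSphere, B v vs n ∂surface =
      ∫⁻ v, ∫⁻ vs, ∫⁻ n : UnitSphere, (A v vs n + B v vs n) ∂surface := by
  have h1 : Measurable fun p : Vel × Vel => ∫⁻ n : UnitSphere, B p.1 p.2 n ∂surface :=
    hB.lintegral_prod_right'
  have h2 : Measurable fun v => ∫⁻ vs, ∫⁻ n : UnitSphere, B v vs n ∂surface :=
    h1.lintegral_prod_right'
  rw [← lintegral_add_right _ h2]
  refine lintegral_congr fun v => ?_
  have h3 : Measurable fun vs => ∫⁻ n : UnitSphere, B v vs n ∂surface :=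
    h1.comp (f := fun vs => (v, vs)) measurable_prodMk_left
  rw [← lintegral_add_right _ h3]
  refine lintegral_congr fun vs => ?_
  have h4 : Measurable fun n => B v vs n :=
    hB.comp (f := fun n => ((v, vs), n)) measurable_prodMk_left
  rw [← lintegral_add_right _ h4]

/-- The entropy production of the collision operator relative to a Gaussian. The Gaussian does not
decrease in a collision, and `log x ≤ x - 1` bounds the production by a difference of collision
rates; the factor `1/α²` is the volume change in a collision. -/
theorem entropy_production_le {α : ℝ} (hα : 0 < α) (hα1 : α ≤ 1) {δ : ℝ} (hδ : 0 < δ) {φ : Vel → ℝ}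
    (hφ : Measurable φ) (hφ0 : ∀ v, 0 ≤ φ v) {g k w : Vel → ℝ≥0∞}
    (hg : g = fun v => ENNReal.ofReal (φ v)) (hk : k = fun v => ENNReal.ofReal (φ v + gaussian δ v))
    (hw : w = fun v => ENNReal.ofReal (Real.log ((φ v + gaussian δ v) / gaussian δ v))) :
    2 * (∫⁻ v, gainL α g g v * w v) + ∫⁻ v, g v * lossL g v ≤
      2 * (∫⁻ v, g v * lossL g v * w v) +
        ENNReal.ofReal (1 / α ^ 2) * ∫⁻ v, k v * lossL k v := by
  have hgm : Measurable g := by rw [hg]; fun_prop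
  have hkm : Measurable k := by rw [hk]; fun_prop
  have hwm : Measurable w := by rw [hw]; fun_prop
  rw [two_mul_lintegral_gainL_mul hα hgm hwm, two_mul_lintegral_lossL_mul hgm hwm,
    lintegral_mul_lossL hgm, ← lintegral_post_postStar hα hkm]
  rw [lintegral_triple_add (B := fun v vs n => ENNReal.ofReal (inner ℝ (v - vs) (n : Vel)) *
      (g v * g vs)) (by fun_prop),
    lintegral_triple_add (B := fun v vs n => ENNReal.ofReal (inner ℝ (v - vs) (n : Vel)) *
      (k (post α v vs n) * k (postStar α v vs n))) (by fun_prop)]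
  refine lintegral_mono fun v => lintegral_mono fun vs => lintegral_mono fun n => ?_
  have hL : ∀ v, 0 ≤ Real.log ((φ v + gaussian δ v) / gaussian δ v) := fun v =>
    log_add_div_nonneg (gaussian_pos hδ v) (hφ0 v)
  have hG : gaussian δ v * gaussian δ vs ≤
      gaussian δ (post α v vs n) * gaussian δ (postStar α v vs n) := by
    have h1 := norm_post_sq_add_le hα hα1 v vs 0 (norm_coe_unitSphere n)
    simp only [sub_zero] at h1
    have e1 : ∀ x y : Vel, gaussian δ x * gaussian δ y =
        δ ^ 2 * Real.exp (-(‖x‖ ^ 2 + ‖y‖ ^ 2)) := fun x y => by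
      rw [gaussian, gaussian, neg_add, Real.exp_add]; ring
    rw [e1, e1]
    gcongr
  have key := entropy_collision_le (hφ0 v) (hφ0 vs) (hφ0 (post α v vs n)) (hφ0 (postStar α v vs n))
    (gaussian_pos hδ v) (gaussian_pos hδ vs) (gaussian_pos hδ (post α v vs n))
    (gaussian_pos hδ (postStar α v vs n)) hG
  have hp : ∀ v, 0 ≤ φ v + gaussian δ v := fun v => add_nonneg (hφ0 v) (gaussian_pos hδ v).le
  have key' : g v * g vs * (w (post α v vs n) + w (postStar α v vs n)) + g v * g vs ≤
      g v * g vs * (w v + w vs) + k (post α v vs n) * k (postStar α v vs n) := by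
    simp only [hg, hw, hk]
    rw [← ENNReal.ofReal_mul (hφ0 v), ← ENNReal.ofReal_mul (hp _), ← ENNReal.ofReal_add (hL _)
      (hL _), ← ENNReal.ofReal_add (hL _) (hL _), ← ENNReal.ofReal_mul (mul_nonneg (hφ0 _) (hφ0 _)),
      ← ENNReal.ofReal_mul (mul_nonneg (hφ0 _) (hφ0 _)), ← ENNReal.ofReal_add
        (mul_nonneg (mul_nonneg (hφ0 _) (hφ0 _)) (add_nonneg (hL _) (hL _)))
        (mul_nonneg (hφ0 _) (hφ0 _)), ← ENNReal.ofReal_add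
        (mul_nonneg (mul_nonneg (hφ0 _) (hφ0 _)) (add_nonneg (hL _) (hL _)))
        (mul_nonneg (hp _) (hp _))]
    exact ENNReal.ofReal_le_ofReal key
  calc _ = ENNReal.ofReal (inner ℝ (v - vs) (n : Vel)) *
        (g v * g vs * (w (post α v vs n) + w (postStar α v vs n)) + g v * g vs) := by
          ring
    _ ≤ ENNReal.ofReal (inner ℝ (v - vs) (n : Vel)) *
        (g v * g vs * (w v + w vs) + k (post α v vs n) * k (postStar α v vs n)) :=
          mul_le_mul_right key' _
    _ = _ := by ring


/-! ### A lower bound for the loss frequency -/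

/-- The integral of `e^{-|v|²} (1 + |v|²)`. -/
noncomputable def gaussianMoment : ℝ :=
  (∫⁻ v : Vel, ENNReal.ofReal (Real.exp (-‖v‖ ^ 2)) * ENNReal.ofReal (1 + ‖v‖ ^ 2)).toReal

theorem gaussianMoment_nonneg : 0 ≤ gaussianMoment := ENNReal.toReal_nonneg

theorem lintegral_gaussianMoment :
    ∫⁻ v : Vel, ENNReal.ofReal (Real.exp (-‖v‖ ^ 2)) * ENNReal.ofReal (1 + ‖v‖ ^ 2) =
      ENNReal.ofReal gaussianMoment := by
  rw [gaussianMoment, ENNReal.ofReal_toReal]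
  have h1 : Integrable fun v : Vel => ((1 : ℝ) + ‖v‖ ^ 2) ^ (-(4 : ℝ) / 2) :=
    integrable_rpow_neg_one_add_norm_sq (by simp; norm_num)
  refine ne_top_of_le_ne_top (h1.const_mul 27).lintegral_lt_top.ne (lintegral_mono fun v => ?_)
  rw [← ENNReal.ofReal_mul (Real.exp_pos _).le]
  refine ENNReal.ofReal_le_ofReal ?_
  have h2 : (1 + ‖v‖ ^ 2) / 3 ≤ Real.exp (‖v‖ ^ 2 / 3) := by
    have := Real.add_one_le_exp (‖v‖ ^ 2 / 3)
    linarith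
  have h3 : ((1 + ‖v‖ ^ 2) / 3) ^ 3 ≤ Real.exp (‖v‖ ^ 2) := by
    calc ((1 + ‖v‖ ^ 2) / 3) ^ 3 ≤ Real.exp (‖v‖ ^ 2 / 3) ^ 3 := by gcongr
      _ = Real.exp (‖v‖ ^ 2) := by rw [← Real.exp_nat_mul]; congr 1; push_cast; ring
  rw [show -(4 : ℝ) / 2 = -((2 : ℕ) : ℝ) by norm_num, Real.rpow_neg (by positivity),
    Real.rpow_natCast, Real.exp_neg, ← div_eq_mul_inv, inv_mul_le_iff₀ (Real.exp_pos _)]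
  have h4 : (1 + ‖v‖ ^ 2) = ((1 + ‖v‖ ^ 2) / 3) ^ 3 * (27 / (1 + ‖v‖ ^ 2) ^ 2) := by
    field_simp
    norm_num
  calc (1 + ‖v‖ ^ 2) = ((1 + ‖v‖ ^ 2) / 3) ^ 3 * (27 / (1 + ‖v‖ ^ 2) ^ 2) := h4
    _ ≤ _ := by gcongr

/-- The constant in the estimate of the collision rates that involve the Gaussian. -/
noncomputable def gaussianRate : ℝ := Real.pi * (4 * gaussianMoment + gaussianMoment ^ 2)

theorem gaussianRate_nonneg : 0 ≤ gaussianRate := by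
  have := gaussianMoment_nonneg
  have := Real.pi_pos
  unfold gaussianRate
  positivity

theorem lossL_add {g k : Vel → ℝ≥0∞} (hg : Measurable g) (v : Vel) :
    lossL (fun v => g v + k v) v = lossL g v + lossL k v := by
  rw [lossL, lossL, lossL, ← lintegral_add_left (by fun_prop)]
  simp only [mul_add]

theorem measurable_lossL {g : Vel → ℝ≥0∞} (hg : Measurable g) : Measurable (lossL g) := by
  have h1 : Measurable fun r : Vel × Vel => ENNReal.ofReal (Real.pi * ‖r.1 - r.2‖) * g r.2 := by
    fun_prop
  exact h1.lintegral_prod_right'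

/-- Adding a small Gaussian changes the collision rate little. -/
theorem lintegral_add_gaussian_lossL_le {g : Vel → ℝ≥0∞} (hg : Measurable g)
    (hm : ∫⁻ v, g v * ENNReal.ofReal (1 + ‖v‖ ^ 2) ≤ 2) {δ : ℝ} (hδ : 0 < δ) (hδ1 : δ ≤ 1) :
    ∫⁻ v, (g v + ENNReal.ofReal (gaussian δ v)) *
        lossL (fun v => g v + ENNReal.ofReal (gaussian δ v)) v ≤
      (∫⁻ v, g v * lossL g v) + ENNReal.ofReal (δ * gaussianRate) := by
  have hH := gaussianMoment_nonneg
  have hpi := Real.pi_pos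
  obtain ⟨k, hk⟩ : ∃ k : Vel → ℝ≥0∞, k = fun v => ENNReal.ofReal (gaussian δ v) := ⟨_, rfl⟩
  have hkm : Measurable k := by rw [hk]; fun_prop
  have hkM : ∫⁻ v, k v * ENNReal.ofReal (1 + ‖v‖ ^ 2) = ENNReal.ofReal (δ * gaussianMoment) := by
    rw [ENNReal.ofReal_mul hδ.le, ← lintegral_gaussianMoment, ← lintegral_const_mul _ (by fun_prop)]
    refine lintegral_congr fun v => ?_
    have hkv : k v = ENNReal.ofReal (δ * Real.exp (-‖v‖ ^ 2)) := congrFun hk v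
    rw [hkv, ← mul_assoc, ← ENNReal.ofReal_mul hδ.le]
  have hm' : ∫⁻ v, g v * ENNReal.ofReal (1 + ‖v‖ ^ 2) ≤ ENNReal.ofReal 2 := by simpa using hm
  have hlg := measurable_lossL hg
  have hlk := measurable_lossL hkm
  have hsum : ∫⁻ v, (g v + k v) * lossL (fun v => g v + k v) v =
      (∫⁻ v, g v * lossL g v) + ((∫⁻ v, g v * lossL k v) + (∫⁻ v, k v * lossL g v) +
        ∫⁻ v, k v * lossL k v) := by
    rw [← lintegral_add_left (by fun_prop), ← lintegral_add_left (by fun_prop),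
      ← lintegral_add_left (by fun_prop)]
    refine lintegral_congr fun v => ?_
    rw [lossL_add hg]
    ring
  have h1 : ∫⁻ v, g v * lossL k v ≤ ENNReal.ofReal (Real.pi * (2 * (δ * gaussianMoment))) := by
    rw [ENNReal.ofReal_mul hpi.le, ENNReal.ofReal_mul zero_le_two, ← hkM]
    exact (lintegral_mul_lossL_le hg hkm).trans (mul_le_mul_right (mul_le_mul_left hm' _) _)
  have h2 : ∫⁻ v, k v * lossL g v ≤ ENNReal.ofReal (Real.pi * (δ * gaussianMoment * 2)) := by
    rw [ENNReal.ofReal_mul hpi.le, ENNReal.ofReal_mul (by positivity), ← hkM]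
    exact (lintegral_mul_lossL_le hkm hg).trans (mul_le_mul_right (mul_le_mul_right hm' _) _)
  have h3 : ∫⁻ v, k v * lossL k v ≤
      ENNReal.ofReal (Real.pi * (δ * gaussianMoment * (δ * gaussianMoment))) := by
    rw [ENNReal.ofReal_mul hpi.le, ENNReal.ofReal_mul (by positivity), ← hkM]
    exact lintegral_mul_lossL_le hkm hkm
  have hfin : ∫⁻ v, (g v + k v) * lossL (fun v => g v + k v) v ≤
      (∫⁻ v, g v * lossL g v) + ENNReal.ofReal (δ * gaussianRate) := by
    rw [hsum]
    refine add_le_add_right ((add_le_add (add_le_add h1 h2) h3).trans ?_) _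
    rw [← ENNReal.ofReal_add (by positivity) (by positivity),
      ← ENNReal.ofReal_add (by positivity) (by positivity)]
    refine ENNReal.ofReal_le_ofReal ?_
    unfold gaussianRate
    have h4 : δ * δ * (Real.pi * gaussianMoment ^ 2) ≤ δ * (Real.pi * gaussianMoment ^ 2) := by
      gcongr
      exact mul_le_of_le_one_left hδ.le hδ1
    linarith
  simpa only [hk] using hfin

namespace IsSolution

variable {α : ℝ} {f₀ : Vel → ℝ} {f : ℝ → Vel → ℝ}

/-- The rate of change of the relative entropy. -/
theorem entropy_rate_le (h : IsSolution α f₀ f) (hα : 0 < α) (hα1 : α ≤ 1) (hn : IsNormalized f₀)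
    {δ : ℝ} (hδ : 0 < δ) (hδ1 : δ ≤ 1) {t : ℝ} (ht : 0 ≤ t) :
    ∫⁻ v, gainL α (dens f t) (dens f t) v *
        ENNReal.ofReal (Real.log ((f t v + gaussian δ v) / gaussian δ v)) ≤
      (∫⁻ v, dens f t v * lossL (dens f t) v *
        ENNReal.ofReal (Real.log ((f t v + gaussian δ v) / gaussian δ v))) +
      ENNReal.ofReal (2 * Real.pi * (1 / α ^ 2 - 1) + δ / α ^ 2 * gaussianRate / 2) := by
  have hpi := Real.pi_pos
  have hR := gaussianRate_nonneg
  have hα2 : 0 ≤ 1 / α ^ 2 - 1 := by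
    rw [sub_nonneg, le_div_iff₀ (by positivity), one_mul]
    exact pow_le_one₀ hα.le hα1
  have hm := h.measurable_dens t
  obtain ⟨φ, hφ⟩ : ∃ φ : Vel → ℝ, φ = fun v => max (f t v) 0 := ⟨_, rfl⟩
  have hφm : Measurable φ := by rw [hφ]; exact (h.measurable_slice t).max measurable_const
  have hφ0 : ∀ v, 0 ≤ φ v := fun v => by rw [hφ]; exact le_max_right _ _
  have hg : dens f t = fun v => ENNReal.ofReal (φ v) := by
    funext v
    rw [congrFun hφ v, dens]
    rcases le_total 0 (f t v) with h0 | h0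
    · rw [max_eq_left h0]
    · rw [max_eq_right h0, ENNReal.ofReal_of_nonpos h0, ENNReal.ofReal_zero]
  obtain ⟨w, hw⟩ : ∃ w : Vel → ℝ≥0∞, w = fun v =>
    ENNReal.ofReal (Real.log ((φ v + gaussian δ v) / gaussian δ v)) := ⟨_, rfl⟩
  obtain ⟨k, hk⟩ : ∃ k : Vel → ℝ≥0∞, k = fun v => ENNReal.ofReal (φ v + gaussian δ v) := ⟨_, rfl⟩
  have key := entropy_production_le hα hα1 hδ hφm hφ0 hg hk hw
  have hwf : ∀ᵐ v, ENNReal.ofReal (Real.log ((f t v + gaussian δ v) / gaussian δ v)) = w v := by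
    filter_upwards [h.nonneg t ht] with v hv
    have hφv : φ v = f t v := (congrFun hφ v).trans (max_eq_left hv)
    rw [congrFun hw v, hφv]
  have hkf : k = fun v => dens f t v + ENNReal.ofReal (gaussian δ v) := by
    funext v
    rw [congrFun hk v, congrFun hg v, ENNReal.ofReal_add (hφ0 v) (gaussian_pos hδ v).le]
  have hB := lintegral_add_gaussian_lossL_le hm (h.lintegral_moment_le hα hα1 hn ht) hδ hδ1
  have hB' : ∫⁻ v, k v * lossL k v ≤ (∫⁻ v, dens f t v * lossL (dens f t) v) +
      ENNReal.ofReal (δ * gaussianRate) := by simpa only [hkf] using hB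
  have hBle : ∫⁻ v, dens f t v * lossL (dens f t) v ≤ ENNReal.ofReal (4 * Real.pi) := by
    refine (lintegral_lossL_le hm).trans ?_
    have h2 : (∫⁻ v, dens f t v * ENNReal.ofReal (1 + ‖v‖ ^ 2)) ^ 2 ≤ ENNReal.ofReal 4 := by
      calc (∫⁻ v, dens f t v * ENNReal.ofReal (1 + ‖v‖ ^ 2)) ^ 2 ≤ 2 ^ 2 :=
            pow_le_pow_left₀ zero_le (h.lintegral_moment_le hα hα1 hn ht) 2
        _ = ENNReal.ofReal 4 := by rw [ENNReal.ofReal_ofNat]; norm_num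
    rw [mul_comm 4, ENNReal.ofReal_mul hpi.le]
    exact mul_le_mul_right h2 _
  have hc : ∀ F : Vel → ℝ≥0∞, ∫⁻ v, F v *
      ENNReal.ofReal (Real.log ((f t v + gaussian δ v) / gaussian δ v)) = ∫⁻ v, F v * w v :=
    fun F => lintegral_congr_ae (hwf.mono fun v hv => congrArg (F v * ·) hv)
  rw [hc fun v => gainL α (dens f t) (dens f t) v, hc fun v => dens f t v * lossL (dens f t) v]
  obtain ⟨B, hBdef⟩ : ∃ B : ℝ≥0∞, B = ∫⁻ v, dens f t v * lossL (dens f t) v := ⟨_, rfl⟩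
  rw [← hBdef] at key hB' hBle
  have hBfin : B ≠ ∞ := ne_top_of_le_ne_top ENNReal.ofReal_ne_top hBle
  have h5 : ENNReal.ofReal (1 / α ^ 2) * ∫⁻ v, k v * lossL k v ≤
      2 * ENNReal.ofReal (2 * Real.pi * (1 / α ^ 2 - 1) + δ / α ^ 2 * gaussianRate / 2) + B := by
    calc ENNReal.ofReal (1 / α ^ 2) * ∫⁻ v, k v * lossL k v
        ≤ ENNReal.ofReal (1 / α ^ 2) * (B + ENNReal.ofReal (δ * gaussianRate)) :=
          mul_le_mul_right hB' _
      _ = ENNReal.ofReal (1 / α ^ 2 - 1) * B +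
            ENNReal.ofReal (1 / α ^ 2) * ENNReal.ofReal (δ * gaussianRate) + B := by
          have e1 : ENNReal.ofReal (1 / α ^ 2) = ENNReal.ofReal (1 / α ^ 2 - 1) + 1 := by
            rw [← ENNReal.ofReal_one, ← ENNReal.ofReal_add hα2 zero_le_one, sub_add_cancel]
          rw [mul_add]
          nth_rewrite 1 [e1]
          ring
      _ ≤ ENNReal.ofReal (1 / α ^ 2 - 1) * ENNReal.ofReal (4 * Real.pi) +
            ENNReal.ofReal (1 / α ^ 2) * ENNReal.ofReal (δ * gaussianRate) + B := by gcongr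
      _ = _ := by
          congr 1
          rw [← ENNReal.ofReal_mul hα2, ← ENNReal.ofReal_mul (by positivity),
            ← ENNReal.ofReal_add (by positivity) (by positivity), ← ENNReal.ofReal_ofNat 2,
            ← ENNReal.ofReal_mul zero_le_two]
          congr 1
          field_simp
          ring
  have h6 := key.trans (add_le_add_right h5 _)
  rw [← add_assoc, ← mul_add] at h6
  have h7 := (ENNReal.add_le_add_iff_right hBfin).1 h6
  exact (ENNReal.mul_le_mul_iff_right (a := 2) (by norm_num) (by norm_num)).1 h7

end IsSolution


namespace IsSolution

variable {α : ℝ} {f₀ : Vel → ℝ} {f : ℝ → Vel → ℝ}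

/-- Growth of the relative entropy between two positive times for a locally bounded solution. -/
theorem lintegral_entropy_le (h : IsSolution α f₀ f) (hα : 0 < α) (hα1 : α ≤ 1)
    (hn : IsNormalized f₀) {δ : ℝ} (hδ : 0 < δ) (hδ1 : δ ≤ 1) {a b : ℝ} (ha : 0 < a) (hab : a ≤ b)
    {A : ℝ} (hA : ∀ τ ∈ Ioc a b, ∀ᵐ v, f τ v ≤ A) :
    ∫⁻ v, ENNReal.ofReal (entropyFn (gaussian δ v) (f b v)) ≤
      (∫⁻ v, ENNReal.ofReal (entropyFn (gaussian δ v) (f a v))) +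
        ENNReal.ofReal ((2 * Real.pi * (1 / α ^ 2 - 1) + δ / α ^ 2 * gaussianRate / 2) *
          (b - a)) := by
  have hpi := Real.pi_pos
  have hR := gaussianRate_nonneg
  have hα2 : 0 ≤ 1 / α ^ 2 - 1 := by
    rw [sub_nonneg, le_div_iff₀ (by positivity), one_mul]
    exact pow_le_one₀ hα.le hα1
  have hηm : Measurable (gaussian δ) := measurable_gaussian δ
  have key := h.lintegral_balance hα ha.le hab
    (Ψ := fun v => entropyFn (gaussian δ v))
    (Λ := fun v x => Real.log ((x + gaussian δ v) / gaussian δ v))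
    (fun v x hx => hasDerivAt_entropyFn (gaussian_pos hδ v) hx)
    (fun v => by
      have hg := gaussian_pos hδ v
      refine ContinuousOn.log (by fun_prop) fun x hx => ?_
      have hx' : (0 : ℝ) ≤ x := hx
      positivity)
    (fun v x hx => entropyFn_nonneg (gaussian_pos hδ v) hx)
    (fun v x hx => log_add_div_nonneg (gaussian_pos hδ v) hx)
    (by
      change Measurable fun p : Vel × ℝ => (p.2 + gaussian δ p.1) *
        Real.log ((p.2 + gaussian δ p.1) / gaussian δ p.1) - p.2
      fun_prop)
    (by
      change Measurable fun p : Vel × ℝ => Real.log ((p.2 + gaussian δ p.1) / gaussian δ p.1)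
      fun_prop)
  obtain ⟨w, hw⟩ : ∃ w : ℝ → Vel → ℝ≥0∞, w = fun τ v =>
    ENNReal.ofReal (Real.log ((f τ v + gaussian δ v) / gaussian δ v)) := ⟨_, rfl⟩
  have hwv : ∀ τ v, ENNReal.ofReal (Real.log ((f τ v + gaussian δ v) / gaussian δ v)) = w τ v :=
    fun τ v => by rw [hw]
  have hrate : ∀ τ, 0 ≤ τ → ∫⁻ v, gainL α (dens f τ) (dens f τ) v * w τ v ≤
      (∫⁻ v, dens f τ v * lossL (dens f τ) v * w τ v) +
        ENNReal.ofReal (2 * Real.pi * (1 / α ^ 2 - 1) + δ / α ^ 2 * gaussianRate / 2) := by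
    intro τ hτ
    simpa only [hwv] using h.entropy_rate_le hα hα1 hn hδ hδ1 hτ
  simp only [hwv] at key
  -- the loss of entropy is finite, since `log (1 + f/η)` grows at most quadratically
  have hfin : ∫⁻ τ in Ioc a b, ∫⁻ v, dens f τ v * lossL (dens f τ) v * w τ v ≠ ∞ := by
    obtain ⟨c, hc⟩ : ∃ c : ℝ, c = Real.log (1 + A) + Real.log (1 / δ) := ⟨_, rfl⟩
    have h1 : ∫⁻ τ in Ioc a b, ∫⁻ v, dens f τ v * lossL (dens f τ) v * w τ v ≤
        ∫⁻ τ in Ioc a b, (ENNReal.ofReal c * (∫⁻ v, dens f τ v * lossL (dens f τ) v) +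
          ∫⁻ v, dens f τ v * lossL (dens f τ) v * ENNReal.ofReal (‖v - 0‖ ^ 2)) := by
      refine setLIntegral_mono_ae' measurableSet_Ioc (Eventually.of_forall fun τ hτ => ?_)
      have hm := h.measurable_dens τ
      have hlm := measurable_lossL hm
      rw [← lintegral_const_mul _ (by fun_prop), ← lintegral_add_left (by fun_prop)]
      refine lintegral_mono_ae ?_
      filter_upwards [hA τ hτ, h.nonneg τ (ha.le.trans hτ.1.le)] with v hvA hv0
      rw [mul_comm (ENNReal.ofReal c), ← mul_add]
      refine mul_le_mul_right ?_ _
      rw [← hwv, sub_zero]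
      refine (ENNReal.ofReal_le_ofReal ?_).trans ENNReal.ofReal_add_le
      rw [hc]
      exact log_gaussian_le hδ hδ1 hv0 hvA v
    refine ne_top_of_le_ne_top ?_ h1
    have hm1 : Measurable fun τ => ∫⁻ v, dens f τ v * lossL (dens f τ) v :=
      (h.measurable_dens_uncurry.mul h.measurable_lossL_dens_uncurry).lintegral_prod_right'
    rw [lintegral_add_left (by fun_prop), lintegral_const_mul _ hm1]
    refine ENNReal.add_ne_top.2 ⟨ENNReal.mul_ne_top ENNReal.ofReal_ne_top ?_,
      h.lintegral_loss_dist_sq_ne_top ha hab 0⟩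
    exact ne_top_of_le_ne_top (h.lintegral_time_loss_ne_top b)
      (lintegral_mono_set (Ioc_subset_Ioc_left ha.le))
  have hgain : ∫⁻ τ in Ioc a b, ∫⁻ v, gainL α (dens f τ) (dens f τ) v * w τ v ≤
      (∫⁻ τ in Ioc a b, ∫⁻ v, dens f τ v * lossL (dens f τ) v * w τ v) +
        ENNReal.ofReal ((2 * Real.pi * (1 / α ^ 2 - 1) + δ / α ^ 2 * gaussianRate / 2) *
          (b - a)) := by
    calc _ ≤ ∫⁻ τ in Ioc a b, ((∫⁻ v, dens f τ v * lossL (dens f τ) v * w τ v) +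
          ENNReal.ofReal (2 * Real.pi * (1 / α ^ 2 - 1) + δ / α ^ 2 * gaussianRate / 2)) :=
          setLIntegral_mono' measurableSet_Ioc fun τ hτ => hrate τ (ha.le.trans hτ.1.le)
      _ = _ := by
          rw [lintegral_add_right _ measurable_const, setLIntegral_const, Real.volume_Ioc,
            ← ENNReal.ofReal_mul (by positivity)]
  refine (ENNReal.add_le_add_iff_right hfin).1 ?_
  rw [key, add_assoc]
  refine add_le_add_right (hgain.trans (le_of_eq (add_comm _ _))) _

/-- The relative entropy of a bounded density. -/
theorem lintegral_entropy_le_of_le (h : IsSolution α f₀ f) (hα : 0 < α) (hα1 : α ≤ 1)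
    (hn : IsNormalized f₀) {δ : ℝ} (hδ : 0 < δ) (hδ1 : δ ≤ 1) {t : ℝ} (ht : 0 ≤ t) {A : ℝ}
    (hA0 : 0 ≤ A) (hA : ∀ᵐ v, f t v ≤ A) :
    ∫⁻ v, ENNReal.ofReal (entropyFn (gaussian δ v) (f t v)) ≤
      ENNReal.ofReal (Real.log (1 + A) + Real.log (1 / δ) + 1) := by
  have hm := h.measurable_dens t
  have hc : 0 ≤ Real.log (1 + A) + Real.log (1 / δ) :=
    add_nonneg (Real.log_nonneg (by linarith))
      (Real.log_nonneg (by rw [le_div_iff₀ hδ]; linarith))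
  calc ∫⁻ v, ENNReal.ofReal (entropyFn (gaussian δ v) (f t v))
      ≤ ∫⁻ v, (dens f t v * ENNReal.ofReal (Real.log (1 + A) + Real.log (1 / δ)) +
          dens f t v * ENNReal.ofReal (‖v‖ ^ 2)) := by
        refine lintegral_mono_ae ?_
        filter_upwards [hA, h.nonneg t ht] with v hvA hv0
        rw [← mul_add, dens, ← ENNReal.ofReal_add hc (by positivity), ← ENNReal.ofReal_mul hv0]
        refine ENNReal.ofReal_le_ofReal ((entropyFn_le (gaussian_pos hδ v) hv0).trans ?_)
        exact mul_le_mul_of_nonneg_left (log_gaussian_le hδ hδ1 hv0 hvA v) hv0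
    _ ≤ ENNReal.ofReal (Real.log (1 + A) + Real.log (1 / δ)) + 1 := by
        rw [lintegral_add_left (by fun_prop), lintegral_mul_const _ hm, h.lintegral_dens hα hn ht,
          one_mul]
        exact add_le_add_right (h.lintegral_energy_le hα hα1 hn ht) _
    _ = _ := by rw [ENNReal.ofReal_add hc zero_le_one, ENNReal.ofReal_one]

/-- The relative entropy controls the mass of small sets. -/
theorem mul_setLIntegral_dens_le (h : IsSolution α f₀ f) (hα : 0 < α) (hn : IsNormalized f₀)
    {δ : ℝ} (hδ : 0 < δ) (hδ1 : δ ≤ 1) {t : ℝ} (ht : 0 ≤ t) {E : Set Vel} (hE : MeasurableSet E)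
    {l : ℝ} (hl : 0 ≤ l) :
    ENNReal.ofReal l * (∫⁻ v in E, dens f t v) + ENNReal.ofReal (Real.log (1 / δ)) ≤
      (∫⁻ v, ENNReal.ofReal (entropyFn (gaussian δ v) (f t v))) +
        (ENNReal.ofReal gaussianMoment + ENNReal.ofReal (Real.exp l) * volume E) := by
  have hm := h.measurable_dens t
  have hlog : 0 ≤ Real.log (1 / δ) := Real.log_nonneg (by rw [le_div_iff₀ hδ]; linarith)
  have e1 : ENNReal.ofReal l * (∫⁻ v in E, dens f t v) + ENNReal.ofReal (Real.log (1 / δ)) =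
      ∫⁻ v, (ENNReal.ofReal l * E.indicator (dens f t) v +
        ENNReal.ofReal (Real.log (1 / δ)) * dens f t v) := by
    rw [lintegral_add_right _ (by fun_prop), lintegral_const_mul _ (hm.indicator hE),
      lintegral_const_mul _ hm, h.lintegral_dens hα hn ht, mul_one, lintegral_indicator hE]
  have e2 : ENNReal.ofReal (Real.exp l) * volume E =
      ∫⁻ v, E.indicator (fun _ => ENNReal.ofReal (Real.exp l)) v := by
    rw [lintegral_indicator hE, setLIntegral_const]
  have hGm : Measurable fun v : Vel => ENNReal.ofReal (Real.exp (-‖v‖ ^ 2)) *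
      ENNReal.ofReal (1 + ‖v‖ ^ 2) := by fun_prop
  have hSm : Measurable fun v : Vel => ENNReal.ofReal (Real.exp (-‖v‖ ^ 2)) *
      ENNReal.ofReal (1 + ‖v‖ ^ 2) + E.indicator (fun _ => ENNReal.ofReal (Real.exp l)) v :=
    hGm.add (measurable_const.indicator hE)
  rw [e1, e2, ← lintegral_gaussianMoment, ← lintegral_add_left hGm,
    ← lintegral_add_right _ hSm]
  refine lintegral_mono_ae ?_
  filter_upwards [h.nonneg t ht] with v hv
  have hG : ENNReal.ofReal (Real.exp (-‖v‖ ^ 2)) ≤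
      ENNReal.ofReal (Real.exp (-‖v‖ ^ 2)) * ENNReal.ofReal (1 + ‖v‖ ^ 2) :=
    le_mul_of_one_le_right' (ENNReal.one_le_ofReal.2 (by nlinarith [norm_nonneg v]))
  have hη := gaussian_pos hδ v
  have hent := entropyFn_nonneg hη hv
  have hexp : gaussian δ v * Real.exp (Real.log (1 / δ)) = Real.exp (-‖v‖ ^ 2) := by
    rw [Real.exp_log (by positivity), gaussian]
    field_simp
  by_cases hvE : v ∈ E
  · rw [indicator_of_mem hvE, indicator_of_mem hvE, ← add_mul, dens,
      ← ENNReal.ofReal_add hl hlog, ← ENNReal.ofReal_mul (by positivity)]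
    refine le_trans ?_ (add_le_add_right le_add_self _)
    rw [← ENNReal.ofReal_add hent (Real.exp_pos _).le]
    refine ENNReal.ofReal_le_ofReal ?_
    have h1 := mul_le_entropyFn_add hη hv (add_nonneg hl hlog)
    have h2 : gaussian δ v * Real.exp (l + Real.log (1 / δ)) ≤ Real.exp l := by
      rw [Real.exp_add, mul_left_comm, hexp]
      refine mul_le_of_le_one_right (Real.exp_pos _).le ?_
      rw [Real.exp_le_one_iff]
      nlinarith [norm_nonneg v]
    linarith
  · rw [indicator_of_notMem hvE, indicator_of_notMem hvE, mul_zero, zero_add, add_zero, dens,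
      ← ENNReal.ofReal_mul hlog]
    refine le_trans ?_ (add_le_add_right hG _)
    rw [← ENNReal.ofReal_add hent (Real.exp_pos _).le]
    refine ENNReal.ofReal_le_ofReal ?_
    have h1 := mul_le_entropyFn_add hη hv hlog
    rw [hexp] at h1
    linarith

/-- If the ball of radius `r` about `v` carries at most half of the mass, the loss frequency at `v`
is at least `π r/2`, hence at least `r`. -/
theorem le_lossL_of_ball (h : IsSolution α f₀ f) (hα : 0 < α) (hn : IsNormalized f₀) {t : ℝ}
    (ht : 0 ≤ t) {r : ℝ} (hr : 0 ≤ r) (v : Vel)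
    (hv : ∫⁻ w in Metric.ball v r, dens f t w ≤ ENNReal.ofReal (1 / 2)) :
    ENNReal.ofReal r ≤ lossL (dens f t) v := by
  have hm := h.measurable_dens t
  have hb : MeasurableSet (Metric.ball v r) := Metric.isOpen_ball.measurableSet
  have hmass := h.lintegral_dens hα hn ht
  rw [← lintegral_add_compl _ hb] at hmass
  have h1 : ENNReal.ofReal (1 / 2) ≤ ∫⁻ w in (Metric.ball v r)ᶜ, dens f t w := by
    have h2 : ENNReal.ofReal (1 / 2) + ENNReal.ofReal (1 / 2) = 1 := by
      rw [← ENNReal.ofReal_add (by norm_num) (by norm_num)]; norm_num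
    rw [← h2] at hmass
    by_contra! hlt
    exact absurd hmass (ENNReal.add_lt_add_of_le_of_lt
      (ne_top_of_le_ne_top ENNReal.ofReal_ne_top hv) hv hlt).ne
  calc ENNReal.ofReal r ≤ ENNReal.ofReal (Real.pi * r) * ENNReal.ofReal (1 / 2) := by
        rw [← ENNReal.ofReal_mul (by have := Real.pi_pos; positivity)]
        refine ENNReal.ofReal_le_ofReal ?_
        nlinarith [Real.pi_gt_three]
    _ ≤ ENNReal.ofReal (Real.pi * r) * ∫⁻ w in (Metric.ball v r)ᶜ, dens f t w :=
        mul_le_mul_right h1 _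
    _ = ∫⁻ w in (Metric.ball v r)ᶜ, ENNReal.ofReal (Real.pi * r) * dens f t w := by
        rw [lintegral_const_mul _ hm]
    _ ≤ ∫⁻ w in (Metric.ball v r)ᶜ, ENNReal.ofReal (Real.pi * ‖v - w‖) * dens f t w := by
        refine setLIntegral_mono (by fun_prop) fun w hw => ?_
        refine mul_le_mul_left (ENNReal.ofReal_le_ofReal ?_) _
        refine mul_le_mul_of_nonneg_left ?_ Real.pi_pos.le
        rw [mem_compl_iff, Metric.mem_ball, not_lt, dist_eq_norm, norm_sub_rev] at hw
        exact hw
    _ ≤ lossL (dens f t) v := setLIntegral_le_lintegral _ _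

end IsSolution


/-! ### Lower bound of the loss frequency and conclusion -/

theorem volume_ball_le (v : Vel) {r : ℝ} (hr : 0 ≤ r) :
    volume (Metric.ball v r) ≤ ENNReal.ofReal (8 * r ^ 3) := by
  rw [EuclideanSpace.volume_ball_fin_three, ← ENNReal.ofReal_pow hr,
    ← ENNReal.ofReal_mul (by positivity)]
  refine ENNReal.ofReal_le_ofReal ?_
  nlinarith [Real.pi_lt_four, pow_nonneg hr 3]

/-- Balls of radius `e^{-l/3}/2` carry at most half of the mass, where `l` depends linearly on
`(1/α² - 1) t` and on the logarithm of a bound for the density at time `1`. The Gaussian is given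
the amplitude `δ = α²/(1 + t)`, which cancels in the final inequality. -/
theorem IsSolution.lintegral_ball_le {α : ℝ} {f₀ : Vel → ℝ} {f : ℝ → Vel → ℝ}
    (h : IsSolution α f₀ f) (hα : 0 < α) (hα1 : α ≤ 1) (hn : IsNormalized f₀) {t : ℝ} (ht : 1 ≤ t)
    {A₁ A : ℝ} (hA₁0 : 0 ≤ A₁) (hA₁ : ∀ᵐ v, f 1 v ≤ A₁)
    (hA : ∀ τ ∈ Ioc 1 t, ∀ᵐ v, f τ v ≤ A) {l : ℝ}
    (hl : l = 2 * (Real.log (1 + A₁) + gaussianMoment + gaussianRate + 2 +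
      2 * Real.pi * (1 / α ^ 2 - 1) * t)) (v : Vel) :
    ∫⁻ w in Metric.ball v (Real.exp (-(l / 3)) / 2), dens f t w ≤ ENNReal.ofReal (1 / 2) := by
  have hpi := Real.pi_pos
  have hR := gaussianRate_nonneg
  have hH := gaussianMoment_nonneg
  have ht0 : 0 < 1 + t := by linarith
  have hlog : 0 ≤ Real.log (1 + A₁) := Real.log_nonneg (by linarith)
  have hα2 : 0 ≤ 1 / α ^ 2 - 1 := by
    rw [sub_nonneg, le_div_iff₀ (by positivity), one_mul]
    exact pow_le_one₀ hα.le hα1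
  have hX : 0 ≤ 2 * Real.pi * (1 / α ^ 2 - 1) * t := by positivity
  have hl0 : 0 < l := by rw [hl]; positivity
  obtain ⟨δ, hδdef⟩ : ∃ δ : ℝ, δ = α ^ 2 / (1 + t) := ⟨_, rfl⟩
  have hδ : 0 < δ := by rw [hδdef]; positivity
  have hδ1 : δ ≤ 1 := by
    rw [hδdef, div_le_one ht0]
    have := pow_le_one₀ hα.le hα1 (n := 2)
    linarith
  have hδα : δ / α ^ 2 = 1 / (1 + t) := by rw [hδdef]; field_simp
  have hlogδ : 0 ≤ Real.log (1 / δ) := Real.log_nonneg (by rw [le_div_iff₀ hδ]; linarith)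
  have hball : MeasurableSet (Metric.ball v (Real.exp (-(l / 3)) / 2)) :=
    Metric.isOpen_ball.measurableSet
  obtain ⟨m, hm⟩ : ∃ m : ℝ≥0∞, m = ∫⁻ w in Metric.ball v (Real.exp (-(l / 3)) / 2), dens f t w :=
    ⟨_, rfl⟩
  have h1 := h.mul_setLIntegral_dens_le hα hn hδ hδ1 (zero_le_one.trans ht) hball hl0.le
  have h2 := h.lintegral_entropy_le hα hα1 hn hδ hδ1 one_pos ht hA
  have h3 := h.lintegral_entropy_le_of_le hα hα1 hn hδ hδ1 zero_le_one hA₁0 hA₁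
  have h4 : ENNReal.ofReal (Real.exp l) * volume (Metric.ball v (Real.exp (-(l / 3)) / 2)) ≤
      ENNReal.ofReal 1 := by
    refine (mul_le_mul_right (volume_ball_le v (by positivity)) _).trans (le_of_eq ?_)
    rw [← ENNReal.ofReal_mul (Real.exp_pos _).le, div_pow, ← Real.exp_nat_mul]
    congr 1
    rw [show ((3 : ℕ) : ℝ) * -(l / 3) = -l by push_cast; ring, Real.exp_neg]
    field_simp
    norm_num
  rw [← hm] at h1 ⊢
  have h5 : ENNReal.ofReal l * m + ENNReal.ofReal (Real.log (1 / δ)) ≤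
      ENNReal.ofReal (l / 2) + ENNReal.ofReal (Real.log (1 / δ)) := by
    refine (h1.trans (add_le_add (h2.trans (add_le_add_left h3 _))
      (add_le_add_right h4 _))).trans ?_
    have e0 : 0 ≤ (2 * Real.pi * (1 / α ^ 2 - 1) + δ / α ^ 2 * gaussianRate / 2) * (t - 1) :=
      mul_nonneg (by positivity) (by linarith)
    rw [← ENNReal.ofReal_add (by positivity) e0, ← ENNReal.ofReal_add hH zero_le_one,
      ← ENNReal.ofReal_add (by positivity) (by positivity),
      ← ENNReal.ofReal_add (by positivity) hlogδ]
    refine ENNReal.ofReal_le_ofReal ?_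
    have e1 : 2 * Real.pi * (1 / α ^ 2 - 1) * (t - 1) ≤ 2 * Real.pi * (1 / α ^ 2 - 1) * t := by
      gcongr; linarith
    have e2 : δ / α ^ 2 * gaussianRate / 2 * (t - 1) ≤ gaussianRate := by
      rw [hδα]
      have e3 : 1 / (1 + t) * gaussianRate / 2 * (t - 1) =
          gaussianRate * ((t - 1) / (2 * (1 + t))) := by field_simp
      rw [e3]
      refine mul_le_of_le_one_right hR ?_
      rw [div_le_one (by positivity)]
      linarith
    rw [hl]
    linarith
  have h6 := (ENNReal.add_le_add_iff_right ENNReal.ofReal_ne_top).1 h5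
  rw [show l / 2 = l * (1 / 2) by ring, ENNReal.ofReal_mul hl0.le] at h6
  exact (ENNReal.mul_le_mul_iff_right (by simpa using hl0) ENNReal.ofReal_ne_top).1 h6

/-- The loss frequency decays at most exponentially in time, with a rate that depends on the
restitution coefficient only. -/
theorem exists_le_lossL {s : ℝ} (hs : 2 < s) {M : ℝ} (hM : 0 ≤ M) :
    ∃ c : ℝ, 0 < c ∧ ∀ (α : ℝ) (f₀ : Vel → ℝ) (f : ℝ → Vel → ℝ), IsSolution α f₀ f → 0 < α →
      α ≤ 1 → IsNormalized f₀ → DecayLE (dens f 0) M s → ∀ t : ℝ, 0 ≤ t → ∀ v,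
        ENNReal.ofReal (c * Real.exp (-(4 * Real.pi / 3 * (1 / α ^ 2 - 1) * t))) ≤
          lossL (dens f t) v := by
  have hpi := Real.pi_pos
  have hR := gaussianRate_nonneg
  have hH := gaussianMoment_nonneg
  obtain ⟨A, hA0, hA⟩ := exists_pointwise_bound hs hM
  obtain ⟨K, hK⟩ : ∃ K : ℝ,
      K = Real.log (1 + A * (1 + 1) ^ 3) + gaussianMoment + gaussianRate + 2 := ⟨_, rfl⟩
  refine ⟨min (1 / (3 * (1 + 8 * A))) (Real.exp (-(2 * K / 3)) / 2), by positivity, ?_⟩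
  intro α f₀ f h hα hα1 hn hd t ht v
  have hα2 : 0 ≤ 1 / α ^ 2 - 1 := by
    rw [sub_nonneg, le_div_iff₀ (by positivity), one_mul]
    exact pow_le_one₀ hα.le hα1
  have hbound : ∀ τ, 0 ≤ τ → ∀ᵐ v, f τ v ≤ A * (1 + τ) ^ 3 := fun τ hτ =>
    (hA α f₀ f h hα hα1 hn hd τ τ hτ hτ (accumulationBound_time f τ)).mono fun v hv => hv.1
  -- for short times the density is bounded, for long times the relative entropy is used
  rcases le_total t 1 with ht1 | ht1
  · refine le_trans (ENNReal.ofReal_le_ofReal ?_) (h.le_lossL_of_ball hα hn ht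
      (r := 1 / (3 * (1 + 8 * A))) (by positivity) v ?_)
    · refine (mul_le_of_le_one_right (by positivity) ?_).trans (min_le_left _ _)
      rw [Real.exp_le_one_iff, neg_nonpos]
      positivity
    · calc ∫⁻ w in Metric.ball v (1 / (3 * (1 + 8 * A))), dens f t w
          ≤ ∫⁻ w in Metric.ball v (1 / (3 * (1 + 8 * A))), ENNReal.ofReal (8 * A) := by
            refine lintegral_mono_ae (ae_restrict_of_ae ?_)
            filter_upwards [hbound t ht] with w hw
            refine ENNReal.ofReal_le_ofReal (hw.trans ?_)
            have : (1 + t) ^ 3 ≤ (1 + 1) ^ 3 := by gcongr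
            nlinarith
        _ ≤ ENNReal.ofReal (8 * A) * ENNReal.ofReal (8 * (1 / (3 * (1 + 8 * A))) ^ 3) := by
            rw [setLIntegral_const]
            exact mul_le_mul_right (volume_ball_le v (by positivity)) _
        _ ≤ ENNReal.ofReal (1 / 2) := by
            rw [← ENNReal.ofReal_mul (by positivity)]
            refine ENNReal.ofReal_le_ofReal ?_
            have e : 8 * A * (8 * (1 / (3 * (1 + 8 * A))) ^ 3) =
                64 * A / (27 * (1 + 8 * A) ^ 3) := by field_simp; norm_num
            rw [e, div_le_div_iff₀ (by positivity) (by norm_num)]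
            nlinarith [mul_pos hA0 hA0, mul_pos (mul_pos hA0 hA0) hA0]
  · obtain ⟨l, hl⟩ : ∃ l : ℝ, l = 2 * (Real.log (1 + A * (1 + 1) ^ 3) + gaussianMoment +
      gaussianRate + 2 + 2 * Real.pi * (1 / α ^ 2 - 1) * t) := ⟨_, rfl⟩
    refine le_trans (ENNReal.ofReal_le_ofReal ?_) (h.le_lossL_of_ball hα hn ht
      (r := Real.exp (-(l / 3)) / 2) (by positivity) v
      (h.lintegral_ball_le hα hα1 hn ht1 (by positivity) (hbound 1 zero_le_one)
        (A := A * (1 + t) ^ 3) (fun τ hτ => ?_) hl v))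
    · have e : Real.exp (-(l / 3)) / 2 = Real.exp (-(2 * K / 3)) / 2 *
          Real.exp (-(4 * Real.pi / 3 * (1 / α ^ 2 - 1) * t)) := by
        rw [div_mul_eq_mul_div, ← Real.exp_add]
        congr 2
        rw [hl, hK]
        ring
      rw [e]
      exact mul_le_mul_of_nonneg_right (min_le_right _ _) (Real.exp_pos _).le
    · have hτ0 : 0 ≤ τ := zero_le_one.trans hτ.1.le
      filter_upwards [hbound τ hτ0] with w hw
      refine hw.trans ?_
      have := hτ.2
      gcongr

/-- Both pointwise bounds for one value of the weighted norm of the initial datum. -/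
theorem exists_main_bound {s : ℝ} (hs : 2 < s) {M : ℝ} (hM : 0 ≤ M) :
    ∃ C : ℝ, 0 < C ∧ ∀ (α : ℝ) (f₀ : Vel → ℝ) (f : ℝ → Vel → ℝ), IsSolution α f₀ f → 0 < α →
      α ≤ 1 → IsNormalized f₀ → DecayLE (dens f 0) M s → ∀ t : ℝ, 0 ≤ t → ∀ᵐ v,
        f t v ≤ C * min ((1 + t) ^ 3 / (1 + ‖v‖))
          (Real.exp (4 * Real.pi * (1 / α ^ 2 - 1) * t) / (1 + ‖v‖) ^ 2) ∧
        (v ≠ 0 → f t v ≤ C * min ((1 + t) / ‖v‖ ^ 2)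
          (Real.exp (4 * Real.pi * (1 / α ^ 2 - 1) * t) / (1 + ‖v‖) ^ 2)) := by
  have hpi := Real.pi_pos
  obtain ⟨A, hA0, hA⟩ := exists_pointwise_bound hs hM
  obtain ⟨c, hc0, hc⟩ := exists_le_lossL hs hM
  have hD1 : 1 ≤ (1 + 1 / c) ^ 3 :=
    one_le_pow₀ (le_add_of_nonneg_right (by positivity))
  refine ⟨4 * A * (1 + 1 / c) ^ 3, by positivity, ?_⟩
  intro α f₀ f h hα hα1 hn hd t ht
  have hα2 : 0 ≤ 1 / α ^ 2 - 1 := by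
    rw [sub_nonneg, le_div_iff₀ (by positivity), one_mul]
    exact pow_le_one₀ hα.le hα1
  obtain ⟨x, hx⟩ : ∃ x : ℝ, x = 4 * Real.pi / 3 * (1 / α ^ 2 - 1) * t := ⟨_, rfl⟩
  have hx0 : 0 ≤ x := by rw [hx]; positivity
  have hx1 : 1 ≤ Real.exp x := Real.one_le_exp hx0
  have hr : 0 < c * Real.exp (-x) := by positivity
  have hacc : AccumulationBound f t (1 / (c * Real.exp (-x))) := by
    refine accumulationBound_inv hr fun τ hτ v => ?_
    refine (ENNReal.ofReal_le_ofReal ?_).trans (hc α f₀ f h hα hα1 hn hd τ hτ.1.le v)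
    rw [hx]
    have := hτ.2
    gcongr
  have hT : 1 + 1 / (c * Real.exp (-x)) ≤ (1 + 1 / c) * Real.exp x := by
    have e : 1 / (c * Real.exp (-x)) = 1 / c * Real.exp x := by
      rw [Real.exp_neg]; field_simp
    rw [e]
    linarith
  have hexp : Real.exp x ^ 3 = Real.exp (4 * Real.pi * (1 / α ^ 2 - 1) * t) := by
    rw [← Real.exp_nat_mul, hx]
    congr 1
    push_cast
    ring
  -- away from the origin the second bound for the density is used, near the origin the first
  have hcomb : ∀ {T y : ℝ} {v : Vel}, 0 ≤ T → y ≤ A * (1 + T) ^ 3 →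
      (v ≠ 0 → y ≤ A * (1 + T) / ‖v‖ ^ 2) → y ≤ 4 * A * (1 + T) ^ 3 / (1 + ‖v‖) ^ 2 := by
    intro T y v hT0 h1 h2
    rcases le_total 1 ‖v‖ with hv | hv
    · have hv0 : v ≠ 0 := norm_pos_iff.1 (by linarith)
      refine (h2 hv0).trans ?_
      rw [div_le_div_iff₀ (by positivity) (by positivity)]
      have e1 : (1 + ‖v‖) ^ 2 ≤ 4 * ‖v‖ ^ 2 := by nlinarith
      have e2 : 1 + T ≤ (1 + T) ^ 3 := le_self_pow₀ (by linarith) (by norm_num)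
      calc A * (1 + T) * (1 + ‖v‖) ^ 2 ≤ A * (1 + T) ^ 3 * (4 * ‖v‖ ^ 2) := by gcongr
        _ = _ := by ring
    · refine h1.trans ?_
      rw [le_div_iff₀ (by positivity)]
      have e1 : (1 + ‖v‖) ^ 2 ≤ 4 := by nlinarith [norm_nonneg v]
      calc A * (1 + T) ^ 3 * (1 + ‖v‖) ^ 2 ≤ A * (1 + T) ^ 3 * 4 := by gcongr
        _ = _ := by ring
  filter_upwards [hA α f₀ f h hα hα1 hn hd t t ht ht (accumulationBound_time f t),
    hA α f₀ f h hα hα1 hn hd t _ ht (by positivity) hacc] with v h1 h2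
  have hsecond : f t v ≤ 4 * A * (1 + 1 / c) ^ 3 *
      (Real.exp (4 * Real.pi * (1 / α ^ 2 - 1) * t) / (1 + ‖v‖) ^ 2) := by
    refine (hcomb (by positivity) h2.1 h2.2).trans ?_
    rw [← hexp, ← mul_div_assoc]
    refine div_le_div_of_nonneg_right ?_ (by positivity)
    rw [mul_assoc (4 * A), ← mul_pow]
    gcongr
  refine ⟨?_, fun hv => ?_⟩
  · rw [mul_min_of_nonneg _ _ (by positivity)]
    refine le_min ((hcomb ht h1.1 h1.2).trans ?_) hsecond
    have e1 : 4 * A * (1 + t) ^ 3 / (1 + ‖v‖) ^ 2 ≤ 4 * A * (1 + t) ^ 3 / (1 + ‖v‖) := by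
      gcongr
      exact le_self_pow₀ (by linarith [norm_nonneg v]) (by norm_num)
    refine e1.trans ?_
    rw [mul_assoc (4 * A), mul_div_assoc]
    refine mul_le_mul_of_nonneg_left ?_ (by positivity)
    rw [← mul_div_assoc]
    gcongr
    exact le_mul_of_one_le_left (by positivity) hD1
  · rw [mul_min_of_nonneg _ _ (by positivity)]
    refine le_min ((h1.2 hv).trans ?_) hsecond
    rw [mul_div_assoc]
    refine mul_le_mul_of_nonneg_right ?_ (by positivity)
    nlinarith

end InelasticBoltzmann

theorem theorem1p1 :
    ∃ C₂ : ℝ, 0 < C₂ ∧ ∀ s : ℝ, 2 < s →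
      ∃ C₁ C₃ : ℝ → ℝ, (∀ M, 0 < C₁ M) ∧ (∀ M, 0 < C₃ M) ∧
        ∀ (α : ℝ) (f₀ : InelasticBoltzmann.Vel → ℝ) (f : ℝ → InelasticBoltzmann.Vel → ℝ),
          0 < α → α ≤ 1 →
          InelasticBoltzmann.IsNormalized f₀ →
          InelasticBoltzmann.MemWeightedLp ∞ s f₀ →
          InelasticBoltzmann.IsSolution α f₀ f →
          (∀ t : ℝ, 0 < t → ∀ᵐ v : InelasticBoltzmann.Vel,
            f t v ≤ C₁ (InelasticBoltzmann.weightedNorm ∞ s f₀).toReal *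
              min ((1 + t) ^ 3 / (1 + ‖v‖))
                (Real.exp (C₂ * (1 / α ^ 2 - 1) * t) / (1 + ‖v‖) ^ 2)) ∧
          (∀ t : ℝ, 0 < t → ∀ᵐ v : InelasticBoltzmann.Vel, v ≠ 0 →
            f t v ≤ C₃ (InelasticBoltzmann.weightedNorm ∞ s f₀).toReal *
              min ((1 + t) / ‖v‖ ^ 2)
                (Real.exp (C₂ * (1 / α ^ 2 - 1) * t) / (1 + ‖v‖) ^ 2)) := by
  have hpi := Real.pi_pos
  refine ⟨4 * Real.pi, by positivity, fun s hs => ?_⟩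
  -- the norm is nonnegative, so the values of the constants at negative arguments are irrelevant
  choose C hC0 hC using fun M : ℝ => InelasticBoltzmann.exists_main_bound hs (le_max_right M 0)
  refine ⟨C, C, hC0, hC0, ?_⟩
  intro α f₀ f hα hα1 hn hw h
  have hd := h.dens_zero_decay hw
  have hmax : max (InelasticBoltzmann.weightedNorm ∞ s f₀).toReal 0 =
      (InelasticBoltzmann.weightedNorm ∞ s f₀).toReal := max_eq_left ENNReal.toReal_nonneg
  have key := hC (InelasticBoltzmann.weightedNorm ∞ s f₀).toReal α f₀ f h hα hα1 hn
    (hmax.symm ▸ hd)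
  exact ⟨fun t ht => (key t ht.le).mono fun v hv => hv.1,
    fun t ht => (key t ht.le).mono fun v hv => hv.2⟩
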